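/- Let $\mathbb K$ be a field of characteristic zero. **The Poisson algebra.** For a finite dimensional Lie algebra $\mathfrak g$ put $C^{p,q}=\bigwedge^p\mathfrak g^*\otimes\bigwedge^q\mathfrak g$, and let $C^{\bullet,\bullet}=\bigoplus_{p,q}C^{p,q}$ have the product $(\phi\otimes v)\vee(\psi\otimes w)=(-1)^{p_2q_1}\,\phi\wedge\psi\otimes v\wedge w$ for $\phi\otimes v\in C^{p_1,q_1}$, $\psi\otimes w\in C^{p_2,q_2}$. Let $\{-,-\}\colon C^{p_1,q_1}\times C^{p_2,q_2}\to C^{p_1+p_2-1,q_1+q_2-1}$ be the Lie super-bracket determined by $\{\mathfrak g,\mathfrak g\}=\{\mathfrak g^*,\mathfrak g^*\}=0$, $\{\phi,v\}=\{v,\phi\}=\phi(v)$ for $\phi\in\mathfrak g^*$, $v\in\mathfrak g$, $\{a,b\}=-(-1)^{(p_1+q_1)(p_2+q_2)}\{b,a\}$ and $\{a\vee b,c\}=a\vee\{b,c\}+(-1)^{(p_1+q_1)(p_2+q_2)}b\vee\{a,c\}$ for $a\in C^{p_1,q_1}$, $b\in C^{p_2,q_2}$. If $\mu\in C^{2,1}$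 is the Lie bracket of $\mathfrak g$, then $d=\{\mu,-\}$ is the Chevalley--Eilenberg differential. Its cohomology $\bigoplus_{p,q}H^{p,q}(\mathfrak g)$, $H^{p,q}(\mathfrak g)=H^p(\mathfrak g,\bigwedge^q\mathfrak g)$, inherits the bracket, and $H_E^{\bullet,\bullet}(\mathfrak g)=\bigoplus_{p+q\text{ even}}H^{p,q}(\mathfrak g)$ is closed under it. **The Heisenberg algebra.** Let $\mathfrak h$ have the basis $x_1,x_{-1},h_0$ with only non-zero bracket $[x_1,x_{-1}]=h_0$ (up to antisymmetry), and let $x^{-1},x^{1},h^0$ be the dual basis: $x^{-1}$ is dual to $x_1$, $x^1$ to $x_{-1}$, $h^0$ to $h_0$. The group $G=\mathrm{SL}(2,\mathbb K)$ acts on $\mathfrak h$ by automorphisms: canonically on $\langle x_1,x_{-1}\rangle\cong\mathbb K^2$ (with $x_1=(1,0)$, $x_{-1}=(0,1)$) and trivially on $h_0$. Hence it acts on $C^{\bullet,\bullet}$ (contragrediently on $\mathfrak h^*$) and on $H_E^{\bullet,\bullet}(\mathfrak h)$. **The labeling.** Let $V_0=\mathbb K$, $V_1=\mathbb K^2$,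 $V_2=\mathfrak{sl}(2,\mathbb K)$ be the trivial, the canonical and the adjoint representation of $G$, with highest weight vectors $\bar v_0=1$, $\bar v_1=(1,0)$, $\bar v_2=\left(\begin{smallmatrix}0&1\\0&0\end{smallmatrix}\right)$. For each of the following triples $(i,j,k)$ let $m^{i,j,k}\colon V_i\otimes V_j\to V_k$ be: $m^{0,i,i}$ and $m^{i,0,i}$, the scalar multiplications; $m^{1,1,0}(x\otimes y)=x_1y_2-x_2y_1$; $m^{1,1,2}(x\otimes y)=\left(\begin{smallmatrix}x_1y_2+x_2y_1&-2x_1y_1\\2x_2y_2&-x_1y_2-x_2y_1\end{smallmatrix}\right)$; $m^{2,1,1}(A\otimes x)=m^{1,2,1}(x\otimes A)=x A^t$ (row vectors); $m^{2,2,0}(A\otimes B)=\operatorname{tr}(AB)$; $m^{2,2,2}(A\otimes B)=AB-BA$. Each is a basis of $\operatorname{Hom}_G(V_i\otimes V_j,V_k)$; for all other triples this space is $0$. **The components.** Let $\tau^{p,q}_k\colon V_k\to H_E^{\bullet,\bullet}(\mathfrak h)$ be $G$-morphisms that send $\bar v_k$ to the class of the following cocycle (wedge signs omitted), and let $H^{p,q}_k$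 be the image of $\tau^{p,q}_k$. - $H^{0,0}_0$: $1\otimes1$ - $H^{1,1}_0$: $x^1\otimes x_{-1}+x^{-1}\otimes x_1+2h^0\otimes h_0$ - $H^{1,1}_2$: $x^1\otimes x_1$ - $H^{2,0}_1$: $x^1h^0\otimes1$ - $H^{0,2}_1$: $1\otimes x_1h_0$ - $H^{2,2}_0$: $x^{-1}x^1\otimes x_1x_{-1}$ - $H^{2,2}_2$: $x^1h^0\otimes x_1h_0$ - $H^{3,1}_1$: $x^{-1}x^1h^0\otimes x_1$ - $H^{1,3}_1$: $x^1\otimes x_1x_{-1}h_0$ - $H^{3,3}_0$: $x^{-1}x^1h^0\otimes x_1x_{-1}h_0$ **Theorem.** Such $G$-morphisms exist. For every such choice, $G$ acts on $H_E^{\bullet,\bullet}(\mathfrak h)$ by automorphisms of the bracket, the $\tau^{p,q}_k$ are injective, $H_E^{\bullet,\bullet}(\mathfrak h)$ is the direct sum of the ten subspaces $H^{p,q}_k$, and the $G$-table of the Poisson bracket is the table below. Here an entry $\{H_{i}^{p_1,q_1},H_{j}^{p_2,q_2}\}=\sum_s c_s H^{p_s,q_s}_{k_s}$ means that $$\{\tau^{p_1,q_1}_{i}(u),\tau^{p_2,q_2}_{j}(v)\}=\sum_s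 c_s\,\tau^{p_s,q_s}_{k_s}\big(m^{i,j,k_s}(u\otimes v)\big)\qquad\text{for all }u\in V_{i},\ v\in V_{j}.$$ All entries that are not listed are $0$. - Row $H^{1,1}_0$: $\{H^{1,1}_0,H^{2,0}_1\}=3H^{2,0}_1$, $\{H^{1,1}_0,H^{0,2}_1\}=-3H^{0,2}_1$, $\{H^{1,1}_0,H^{3,1}_1\}=3H^{3,1}_1$, $\{H^{1,1}_0,H^{1,3}_1\}=-3H^{1,3}_1$. - Row $H^{1,1}_2$: $\{H^{1,1}_2,X\}=-X$ for $X=H^{1,1}_2,\ H^{2,0}_1,\ H^{0,2}_1,\ H^{2,2}_2,\ H^{3,1}_1,\ H^{1,3}_1$. - Row $H^{2,0}_1$: $\{H^{2,0}_1,H^{1,1}_0\}=-3H^{2,0}_1$, $\{H^{2,0}_1,H^{1,1}_2\}=H^{2,0}_1$, $\{H^{2,0}_1,H^{0,2}_1\}=\frac12H^{1,1}_2-\frac12H^{1,1}_0$, $\{H^{2,0}_1,H^{2,2}_0\}=H^{3,1}_1$, $\{H^{2,0}_1,H^{2,2}_2\}=H^{3,1}_1$, $\{H^{2,0}_1,H^{1,3}_1\}=-\frac12H^{2,2}_2-\frac32H^{2,2}_0$.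 - Row $H^{0,2}_1$: $\{H^{0,2}_1,H^{1,1}_0\}=3H^{0,2}_1$, $\{H^{0,2}_1,H^{1,1}_2\}=H^{0,2}_1$, $\{H^{0,2}_1,H^{2,0}_1\}=-\frac12H^{1,1}_2-\frac12H^{1,1}_0$, $\{H^{0,2}_1,H^{2,2}_0\}=H^{1,3}_1$, $\{H^{0,2}_1,H^{2,2}_2\}=-H^{1,3}_1$, $\{H^{0,2}_1,H^{3,1}_1\}=-\frac12H^{2,2}_2+\frac32H^{2,2}_0$. - Row $H^{2,2}_0$: $\{H^{2,2}_0,H^{2,0}_1\}=-H^{3,1}_1$, $\{H^{2,2}_0,H^{0,2}_1\}=-H^{1,3}_1$. - Row $H^{2,2}_2$: $\{H^{2,2}_2,H^{1,1}_2\}=-H^{2,2}_2$, $\{H^{2,2}_2,H^{2,0}_1\}=-H^{3,1}_1$, $\{H^{2,2}_2,H^{0,2}_1\}=H^{1,3}_1$. - Row $H^{3,1}_1$: $\{H^{3,1}_1,H^{1,1}_0\}=-3H^{3,1}_1$, $\{H^{3,1}_1,H^{1,1}_2\}=H^{3,1}_1$, $\{H^{3,1}_1,H^{0,2}_1\}=\frac12H^{2,2}_2+\frac32H^{2,2}_0$.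 - Row $H^{1,3}_1$: $\{H^{1,3}_1,H^{1,1}_0\}=3H^{1,3}_1$, $\{H^{1,3}_1,H^{1,1}_2\}=H^{1,3}_1$, $\{H^{1,3}_1,H^{2,0}_1\}=\frac12H^{2,2}_2-\frac32H^{2,2}_0$. -/

import Mathlib

noncomputable section

universe u v w

namespace LiePoisson

open Module

open scoped TensorProduct

section BigBracket

variable (K : Type*) (V : Type*) [Field K] [AddCommGroup V] [Module K V]

/-- The total space `C^{•,•} = ⋀ V* ⊗ ⋀ V`, realised as the exterior algebra of `V* ⊕ V`.
The element `φ ⊗ v` is `tens φ v` below, and the bihomogeneous component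
`C^{p,q} = ⋀^p V* ⊗ ⋀^q V` is `bideg p q`. -/
abbrev Cochain : Type _ := ExteriorAlgebra K (Dual K V × V)

instance : Semiring (Cochain K V) := inferInstance
instance : Ring (Cochain K V) := inferInstance
instance : AddCommMonoid (Cochain K V) := inferInstance
instance : AddCommGroup (Cochain K V) := inferInstance
instance : Module K (Cochain K V) := inferInstance
instance : Algebra K (Cochain K V) := inferInstance
instance : NonUnitalNonAssocSemiring (Cochain K V) := inferInstance

variable {K V}

/-- The inclusion `V* = C^{1,0} → C`. -/
def covec : Dual K V →ₗ[K] Cochain K V := ExteriorAlgebra.ι K ∘ₗ LinearMap.inl K _ _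

/-- The inclusion `V = C^{0,1} → C`. -/
def vec : V →ₗ[K] Cochain K V := ExteriorAlgebra.ι K ∘ₗ LinearMap.inr K _ _

/-- The bilinear map `⋀ V* × ⋀ V → C` that sends `(φ, v)` to `φ ⊗ v`. -/
def tens : ExteriorAlgebra K (Dual K V) →ₗ[K] ExteriorAlgebra K V →ₗ[K] Cochain K V :=
  (LinearMap.mul K (Cochain K V)).compl₁₂
    (ExteriorAlgebra.map (LinearMap.inl K (Dual K V) V)).toLinearMap
    (ExteriorAlgebra.map (LinearMap.inr K (Dual K V) V)).toLinearMap

variable (K V) in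
/-- The bihomogeneous component `C^{p,q} = ⋀^p V* ⊗ ⋀^q V`. -/
def bideg (p q : ℕ) : Submodule K (Cochain K V) :=
  Submodule.map₂ tens (⋀[K]^p (Dual K V)) (⋀[K]^q V)

/-- The canonical symmetric pairing on `V* ⊕ V`: `⟨(φ, v), (ψ, w)⟩ = ψ v + φ w`. -/
def pairing : (Dual K V × V) →ₗ[K] Dual K (Dual K V × V) :=
  LinearMap.mk₂ K (fun a b => b.1 a.2 + a.1 b.2)
    (fun a a' b => by simp; abel) (fun c a b => by simp [mul_add])
    (fun a b b' => by simp; abel) (fun c a b => by simp [mul_add])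

@[simp] lemma pairing_apply (a b : Dual K V × V) : pairing a b = b.1 a.2 + a.1 b.2 := rfl

/-- The parity involution: it is `(-1)^{p+q}` on `C^{p,q}`. -/
abbrev parity : Cochain K V →ₐ[K] Cochain K V := CliffordAlgebra.involute

/-- Contraction: the odd super-derivation of `C` that extends a linear form on `V* ⊕ V`. -/
abbrev contr (d : Dual K (Dual K V × V)) : Cochain K V →ₗ[K] Cochain K V :=
  CliffordAlgebra.contractLeft d

/-- The canonical element `∑_i b^i ⊗ b_i` does not depend on the basis. -/
lemma casimir {ι ι' X : Type*} [Fintype ι] [Fintype ι'] [AddCommGroup X] [Module K X]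
    (b : Basis ι K V) (b' : Basis ι' K V) (F : Dual K V →ₗ[K] V →ₗ[K] X) :
    ∑ j, F (b'.coord j) (b' j) = ∑ i, F (b.coord i) (b i) := by
  have h1 : ∀ j, F (b'.coord j) (b' j) = ∑ i, F (b.coord i (b' j) • b'.coord j) (b i) := by
    intro j
    have h := congrArg (F (b'.coord j)) (b.sum_repr (b' j)).symm
    rw [map_sum] at h
    rw [h]
    refine Finset.sum_congr rfl fun i _ => ?_
    rw [map_smul, map_smul, LinearMap.smul_apply, Basis.coord_apply]
  simp_rw [h1]
  rw [Finset.sum_comm]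
  refine Finset.sum_congr rfl fun i _ => ?_
  rw [← LinearMap.sum_apply, ← map_sum, b'.sum_dual_apply_smul_coord]

lemma pairing_eq_sum {ι : Type*} [Fintype ι] (b : Basis ι K V) (w : Dual K V × V) :
    pairing w = ∑ i, (pairing (0, b i) w • pairing (b.coord i, (0 : V))
      + pairing (b.coord i, (0 : V)) w • pairing ((0 : Dual K V), b i)) := by
  have h : w = ∑ i, (w.1 (b i) • (b.coord i, (0 : V)) + b.coord i w.2 • ((0 : Dual K V), b i)) := by
    ext1
    · simp only [Prod.fst_sum, Prod.fst_add, Prod.smul_fst, smul_zero, add_zero]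
      exact (b.sum_dual_apply_smul_coord w.1).symm
    · simp only [Prod.snd_sum, Prod.snd_add, Prod.smul_snd, smul_zero, zero_add, Basis.coord_apply]
      exact (b.sum_repr w.2).symm
  conv_lhs => rw [h]
  simp only [map_sum, map_add, map_smul, pairing_apply, LinearMap.zero_apply, map_zero, add_zero,
    zero_add, Basis.coord_apply]

/-! ### Contractions, parity and super-commutation -/

section contractions

variable {W : Type*} [AddCommGroup W] [Module K W]

lemma contractLeft_mul (d : Dual K W) (x y : ExteriorAlgebra K W) :
    CliffordAlgebra.contractLeft d (x * y) =
      CliffordAlgebra.contractLeft d x * y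
        + CliffordAlgebra.involute x * CliffordAlgebra.contractLeft d y := by
  induction x using CliffordAlgebra.left_induction with
  | algebraMap r =>
    rw [CliffordAlgebra.contractLeft_algebraMap_mul, CliffordAlgebra.contractLeft_algebraMap,
      AlgHom.commutes, zero_mul, zero_add]
  | add x x' hx hx' => simp only [add_mul, map_add, hx, hx']; abel
  | ι_mul x m hx =>
    rw [mul_assoc, CliffordAlgebra.contractLeft_ι_mul, hx, CliffordAlgebra.contractLeft_ι_mul,
      map_mul, CliffordAlgebra.involute_ι]
    simp only [sub_mul, smul_mul_assoc, mul_add, neg_mul, mul_assoc]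
    abel

lemma contractLeft_involute (d : Dual K W) (x : ExteriorAlgebra K W) :
    CliffordAlgebra.contractLeft d (CliffordAlgebra.involute x) =
      - CliffordAlgebra.involute (CliffordAlgebra.contractLeft d x) := by
  induction x using CliffordAlgebra.left_induction with
  | algebraMap r => simp
  | add x x' hx hx' => simp only [map_add, hx, hx']; abel
  | ι_mul x m hx =>
    rw [map_mul, CliffordAlgebra.involute_ι, neg_mul, map_neg, CliffordAlgebra.contractLeft_ι_mul,
      hx, CliffordAlgebra.contractLeft_ι_mul, map_sub, map_smul, map_mul,
      CliffordAlgebra.involute_ι]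
    simp

/-- `x` is even and commutes with everything. -/
def IsEv (x : ExteriorAlgebra K W) : Prop :=
  CliffordAlgebra.involute x = x ∧ ∀ y, y * x = x * y

/-- `x` is odd and super-commutes with everything. -/
def IsOd (x : ExteriorAlgebra K W) : Prop :=
  CliffordAlgebra.involute x = -x ∧ ∀ y, y * x = x * CliffordAlgebra.involute y

lemma IsOd.ι (w : W) : IsOd (ExteriorAlgebra.ι K w) := by
  refine ⟨CliffordAlgebra.involute_ι w, fun y => ?_⟩
  induction y using CliffordAlgebra.left_induction with
  | algebraMap r => rw [AlgHom.commutes, Algebra.commutes]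
  | add x x' hx hx' => simp only [map_add, add_mul, mul_add, hx, hx']
  | ι_mul x m hx =>
    rw [mul_assoc, hx, map_mul, CliffordAlgebra.involute_ι, ← mul_assoc, ← mul_assoc]
    congr 1
    rw [mul_neg]
    exact eq_neg_of_add_eq_zero_left (ExteriorAlgebra.ι_add_mul_swap m w)

lemma IsOd.mul {x y : ExteriorAlgebra K W} (hx : IsOd x) (hy : IsOd y) : IsEv (x * y) := by
  refine ⟨by rw [map_mul, hx.1, hy.1, neg_mul_neg], fun z => ?_⟩
  rw [← mul_assoc, hx.2, mul_assoc, hy.2, CliffordAlgebra.involute_involute, mul_assoc]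

lemma IsEv.mul_od {x y : ExteriorAlgebra K W} (hx : IsEv x) (hy : IsOd y) : IsOd (x * y) := by
  refine ⟨by rw [map_mul, hx.1, hy.1, mul_neg], fun z => ?_⟩
  rw [← mul_assoc, hx.2, mul_assoc, hy.2, mul_assoc]

lemma IsEv.mul {x y : ExteriorAlgebra K W} (hx : IsEv x) (hy : IsEv y) : IsEv (x * y) := by
  refine ⟨by rw [map_mul, hx.1, hy.1], fun z => ?_⟩
  rw [← mul_assoc, hx.2, mul_assoc, hy.2, mul_assoc]

lemma IsOd.mul_ev {x y : ExteriorAlgebra K W} (hx : IsOd x) (hy : IsEv y) : IsOd (x * y) := by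
  rw [hy.2]; exact hy.mul_od hx

lemma IsEv.add {x y : ExteriorAlgebra K W} (hx : IsEv x) (hy : IsEv y) : IsEv (x + y) :=
  ⟨by rw [map_add, hx.1, hy.1], fun z => by rw [mul_add, add_mul, hx.2, hy.2]⟩

lemma IsOd.add {x y : ExteriorAlgebra K W} (hx : IsOd x) (hy : IsOd y) : IsOd (x + y) :=
  ⟨by rw [map_add, hx.1, hy.1, neg_add], fun z => by rw [mul_add, add_mul, hx.2, hy.2]⟩

lemma IsEv.smul {x : ExteriorAlgebra K W} (r : K) (hx : IsEv x) : IsEv (r • x) :=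
  ⟨by rw [map_smul, hx.1], fun z => by rw [mul_smul_comm, smul_mul_assoc, hx.2]⟩

lemma IsOd.smul {x : ExteriorAlgebra K W} (r : K) (hx : IsOd x) : IsOd (r • x) :=
  ⟨by rw [map_smul, hx.1, smul_neg], fun z => by rw [mul_smul_comm, smul_mul_assoc, hx.2]⟩

lemma IsOd.zero : IsOd (0 : ExteriorAlgebra K W) := ⟨by simp, by simp⟩

lemma IsEv.algebraMap (r : K) : IsEv (algebraMap K (ExteriorAlgebra K W) r) :=
  ⟨AlgHom.commutes _ _, fun y => (Algebra.commutes r y).symm⟩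

lemma IsOd.sum {ι : Type*} (s : Finset ι) {f : ι → ExteriorAlgebra K W} (h : ∀ i, IsOd (f i)) :
    IsOd (∑ i ∈ s, f i) :=
  Finset.sum_induction f IsOd (fun _ _ => IsOd.add) IsOd.zero (fun i _ => h i)

lemma IsOd.contr {x : ExteriorAlgebra K W} (hx : IsOd x) (d : Dual K W) :
    IsEv (CliffordAlgebra.contractLeft d x) := by
  have h1 : CliffordAlgebra.involute (CliffordAlgebra.contractLeft d x)
      = CliffordAlgebra.contractLeft d x := by
    have := contractLeft_involute d x
    rw [hx.1, map_neg] at this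
    exact (neg_injective this).symm
  refine ⟨h1, fun y => ?_⟩
  have h := congrArg (CliffordAlgebra.contractLeft d) (hx.2 (CliffordAlgebra.involute y))
  rw [contractLeft_mul, contractLeft_mul, CliffordAlgebra.involute_involute, hx.2, hx.1,
    contractLeft_involute, map_neg, CliffordAlgebra.involute_involute] at h
  simp only [mul_neg, neg_mul] at h
  rw [add_comm] at h
  have h2 := add_right_cancel h
  exact h2

lemma IsEv.contr {x : ExteriorAlgebra K W} (hx : IsEv x) (d : Dual K W) :
    IsOd (CliffordAlgebra.contractLeft d x) := by
  have h1 : CliffordAlgebra.involute (CliffordAlgebra.contractLeft d x)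
      = - CliffordAlgebra.contractLeft d x := by
    have := contractLeft_involute d x
    rw [hx.1] at this
    exact (neg_eq_iff_eq_neg.mpr this).symm
  refine ⟨h1, fun y => ?_⟩
  have h := congrArg (CliffordAlgebra.contractLeft d) (hx.2 (CliffordAlgebra.involute y))
  rw [contractLeft_mul, contractLeft_mul, CliffordAlgebra.involute_involute, hx.2, hx.1] at h
  rw [add_comm] at h
  exact add_right_cancel h

lemma ev_od_of_mem_pow {S : Submodule K (ExteriorAlgebra K W)} {n : ℕ}
    (hS : ∀ x ∈ S, IsOd x) {x : ExteriorAlgebra K W} (hx : x ∈ S ^ n) :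
    (Even n → IsEv x) ∧ (Odd n → IsOd x) := by
  induction hx using Submodule.pow_induction_on_left' with
  | algebraMap r => exact ⟨fun _ => IsEv.algebraMap r, fun h => by simp at h⟩
  | add x y i hx hy h1 h2 =>
    exact ⟨fun h => (h1.1 h).add (h2.1 h), fun h => (h1.2 h).add (h2.2 h)⟩
  | mem_mul m hm i x hx h =>
    constructor
    · intro hi
      exact (hS m hm).mul (h.2 (by simpa [Nat.even_add_one] using hi))
    · intro hi
      exact (hS m hm).mul_ev (h.1 (by simpa [Nat.odd_add_one] using hi))

end contractions

/-! ### Bidegrees -/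

lemma isOd_covec (φ : Dual K V) : IsOd (covec φ : Cochain K V) := IsOd.ι _
lemma isOd_vec (v : V) : IsOd (vec v : Cochain K V) := IsOd.ι _

lemma map_inl_power (p : ℕ) :
    (⋀[K]^p (Dual K V)).map (ExteriorAlgebra.map (LinearMap.inl K (Dual K V) V)).toLinearMap
      = (LinearMap.range (covec : Dual K V →ₗ[K] Cochain K V)) ^ p := by
  rw [Submodule.map_pow, ExteriorAlgebra.ι_range_map_map, covec, LinearMap.range_comp]

lemma map_inr_power (q : ℕ) :
    (⋀[K]^q V).map (ExteriorAlgebra.map (LinearMap.inr K (Dual K V) V)).toLinearMap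
      = (LinearMap.range (vec : V →ₗ[K] Cochain K V)) ^ q := by
  rw [Submodule.map_pow, ExteriorAlgebra.ι_range_map_map, vec, LinearMap.range_comp]

lemma bideg_eq (p q : ℕ) : bideg K V p q =
    (LinearMap.range (covec : Dual K V →ₗ[K] Cochain K V)) ^ p
      * (LinearMap.range (vec : V →ₗ[K] Cochain K V)) ^ q := by
  rw [← map_inl_power, ← map_inr_power, Submodule.mul_eq_map₂, Submodule.map₂_map_map]
  rfl

lemma ev_od_covec_pow {p : ℕ} {x : Cochain K V}
    (hx : x ∈ (LinearMap.range (covec : Dual K V →ₗ[K] Cochain K V)) ^ p) :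
    (Even p → IsEv x) ∧ (Odd p → IsOd x) :=
  ev_od_of_mem_pow (by rintro _ ⟨φ, rfl⟩; exact isOd_covec φ) hx

lemma ev_od_vec_pow {q : ℕ} {x : Cochain K V}
    (hx : x ∈ (LinearMap.range (vec : V →ₗ[K] Cochain K V)) ^ q) :
    (Even q → IsEv x) ∧ (Odd q → IsOd x) :=
  ev_od_of_mem_pow (by rintro _ ⟨φ, rfl⟩; exact isOd_vec φ) hx

lemma ev_od_mul {W : Type*} [AddCommGroup W] [Module K W] {x y : ExteriorAlgebra K W} {p q : ℕ}
    (hx : (Even p → IsEv x) ∧ (Odd p → IsOd x)) (hy : (Even q → IsEv y) ∧ (Odd q → IsOd y)) :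
    (Even (p + q) → IsEv (x * y)) ∧ (Odd (p + q) → IsOd (x * y)) := by
  rcases Nat.even_or_odd p with hp | hp <;> rcases Nat.even_or_odd q with hq | hq
  · exact ⟨fun _ => (hx.1 hp).mul (hy.1 hq),
      fun h => absurd (hp.add hq) (Nat.not_even_iff_odd.2 h)⟩
  · exact ⟨fun h => absurd (hp.add_odd hq) (Nat.not_odd_iff_even.2 h),
      fun _ => (hx.1 hp).mul_od (hy.2 hq)⟩
  · exact ⟨fun h => absurd (hp.add_even hq) (Nat.not_odd_iff_even.2 h),
      fun _ => (hx.2 hp).mul_ev (hy.1 hq)⟩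
  · exact ⟨fun _ => (hx.2 hp).mul (hy.2 hq),
      fun h => absurd (hp.add_odd hq) (Nat.not_even_iff_odd.2 h)⟩

lemma super_comm {W : Type*} [AddCommGroup W] [Module K W] {x y : ExteriorAlgebra K W} {p q : ℕ}
    (hx : (Even p → IsEv x) ∧ (Odd p → IsOd x)) (hy : (Even q → IsEv y) ∧ (Odd q → IsOd y)) :
    y * x = (-1 : K) ^ (p * q) • (x * y) := by
  rcases Nat.even_or_odd p with hp | hp
  · rw [(hp.mul_right q).neg_one_pow, one_smul, (hx.1 hp).2]
  · rcases Nat.even_or_odd q with hq | hq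
    · rw [(hq.mul_left p).neg_one_pow, one_smul, (hy.1 hq).2]
    · rw [(hp.mul hq).neg_one_pow, (hx.2 hp).2, (hy.2 hq).1, neg_smul, one_smul, mul_neg]

lemma bideg_induction {p q : ℕ} {P : Cochain K V → Prop} {x : Cochain K V}
    (hx : x ∈ bideg K V p q)
    (mul : ∀ a ∈ (LinearMap.range (covec : Dual K V →ₗ[K] Cochain K V)) ^ p,
      ∀ b ∈ (LinearMap.range (vec : V →ₗ[K] Cochain K V)) ^ q, P (a * b))
    (add : ∀ a b, P a → P b → P (a + b)) : P x := by
  rw [bideg_eq] at hx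
  exact Submodule.mul_induction_on hx mul add

lemma ev_od_bideg {p q : ℕ} {x : Cochain K V} (hx : x ∈ bideg K V p q) :
    (Even (p + q) → IsEv x) ∧ (Odd (p + q) → IsOd x) := by
  refine bideg_induction (P := fun x => (Even (p + q) → IsEv x) ∧ (Odd (p + q) → IsOd x)) hx
    (fun a ha b hb => ?_) (fun a b ha hb => ?_)
  · exact ev_od_mul (ev_od_covec_pow ha) (ev_od_vec_pow hb)
  · exact ⟨fun h => (ha.1 h).add (hb.1 h), fun h => (ha.2 h).add (hb.2 h)⟩

/-- The product of `C` in terms of `⋀ V* ⊗ ⋀ V`, with the Koszul sign: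
`(φ ⊗ v) ∨ (ψ ⊗ w) = (-1)^{p₂ q₁} (φ ∧ ψ) ⊗ (v ∧ w)`. -/
theorem tens_mul_tens {q₁ p₂ : ℕ} (φ : ExteriorAlgebra K (Dual K V)) (v : ExteriorAlgebra K V)
    (hv : v ∈ ⋀[K]^q₁ V) (ψ : ExteriorAlgebra K (Dual K V)) (hψ : ψ ∈ ⋀[K]^p₂ (Dual K V))
    (w : ExteriorAlgebra K V) :
    tens φ v * tens ψ w = (-1 : K) ^ (p₂ * q₁) • tens (φ * ψ) (v * w) := by
  have h1 := ev_od_vec_pow (map_inr_power (K := K) (V := V) q₁ ▸ Submodule.mem_map_of_mem hv)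
  have h2 := ev_od_covec_pow (map_inl_power (K := K) (V := V) p₂ ▸ Submodule.mem_map_of_mem hψ)
  have h3 := super_comm h2 h1
  simp only [AlgHom.toLinearMap_apply] at h3
  simp only [tens, LinearMap.compl₁₂_apply, LinearMap.mul_apply', AlgHom.toLinearMap_apply,
    map_mul]
  rw [mul_assoc, ← mul_assoc _ _ (ExteriorAlgebra.map (LinearMap.inr K (Dual K V) V) w), h3]
  simp only [smul_mul_assoc, mul_smul_comm, mul_assoc]

/-- Contractions by elements of `V` lower the first degree. -/
lemma contr_covec_pow (d : Dual K (Dual K V × V)) {p : ℕ} {x : Cochain K V}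
    (hx : x ∈ (LinearMap.range (covec : Dual K V →ₗ[K] Cochain K V)) ^ p) :
    contr d x ∈ (LinearMap.range (covec : Dual K V →ₗ[K] Cochain K V)) ^ (p - 1) := by
  induction hx using Submodule.pow_induction_on_left' with
  | algebraMap r => simp
  | add x y i hx hy h1 h2 => rw [map_add]; exact add_mem h1 h2
  | mem_mul m hm i x hx h =>
    obtain ⟨φ, rfl⟩ := hm
    change CliffordAlgebra.contractLeft d (CliffordAlgebra.ι 0 _ * x) ∈ _
    rw [CliffordAlgebra.contractLeft_ι_mul]
    refine sub_mem (Submodule.smul_mem _ _ hx) ?_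
    rcases i with _ | i
    · rw [pow_zero] at hx
      obtain ⟨r, rfl⟩ := Submodule.mem_one.1 hx
      simp
    · rw [Nat.succ_sub_one, pow_succ']
      exact Submodule.mul_mem_mul ⟨φ, rfl⟩ h

lemma contr_vec_pow (d : Dual K (Dual K V × V)) {p : ℕ} {x : Cochain K V}
    (hx : x ∈ (LinearMap.range (vec : V →ₗ[K] Cochain K V)) ^ p) :
    contr d x ∈ (LinearMap.range (vec : V →ₗ[K] Cochain K V)) ^ (p - 1) := by
  induction hx using Submodule.pow_induction_on_left' with
  | algebraMap r => simp
  | add x y i hx hy h1 h2 => rw [map_add]; exact add_mem h1 h2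
  | mem_mul m hm i x hx h =>
    obtain ⟨φ, rfl⟩ := hm
    change CliffordAlgebra.contractLeft d (CliffordAlgebra.ι 0 _ * x) ∈ _
    rw [CliffordAlgebra.contractLeft_ι_mul]
    refine sub_mem (Submodule.smul_mem _ _ hx) ?_
    rcases i with _ | i
    · rw [pow_zero] at hx
      obtain ⟨r, rfl⟩ := Submodule.mem_one.1 hx
      simp
    · rw [Nat.succ_sub_one, pow_succ']
      exact Submodule.mul_mem_mul ⟨φ, rfl⟩ h

lemma contr_vec_covec_pow (φ : Dual K V) {p : ℕ} {x : Cochain K V}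
    (hx : x ∈ (LinearMap.range (covec : Dual K V →ₗ[K] Cochain K V)) ^ p) :
    contr (pairing (φ, 0)) x = 0 := by
  induction hx using Submodule.pow_induction_on_left' with
  | algebraMap r => simp
  | add x y i hx hy h1 h2 => rw [map_add, h1, h2, add_zero]
  | mem_mul m hm i x hx h =>
    obtain ⟨ψ, rfl⟩ := hm
    change CliffordAlgebra.contractLeft _ (CliffordAlgebra.ι 0 _ * x) = _
    rw [CliffordAlgebra.contractLeft_ι_mul, h]
    simp

lemma contr_covec_vec_pow (v : V) {p : ℕ} {x : Cochain K V}
    (hx : x ∈ (LinearMap.range (vec : V →ₗ[K] Cochain K V)) ^ p) :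
    contr (pairing (0, v)) x = 0 := by
  induction hx using Submodule.pow_induction_on_left' with
  | algebraMap r => simp
  | add x y i hx hy h1 h2 => rw [map_add, h1, h2, add_zero]
  | mem_mul m hm i x hx h =>
    obtain ⟨ψ, rfl⟩ := hm
    change CliffordAlgebra.contractLeft _ (CliffordAlgebra.ι 0 _ * x) = _
    rw [CliffordAlgebra.contractLeft_ι_mul, h]
    simp

lemma parity_bideg {p q : ℕ} {x : Cochain K V} (hx : x ∈ bideg K V p q) :
    parity x ∈ bideg K V p q := by
  rcases Nat.even_or_odd (p + q) with h | h
  · rw [((ev_od_bideg hx).1 h).1]; exact hx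
  · rw [((ev_od_bideg hx).2 h).1]; exact neg_mem hx

lemma contr_vec_bideg (v : V) {p q : ℕ} {x : Cochain K V} (hx : x ∈ bideg K V p q) :
    contr (pairing (0, v)) x ∈ bideg K V (p - 1) q ∧ (p = 0 → contr (pairing (0, v)) x = 0) := by
  refine bideg_induction (P := fun x => contr (pairing (0, v)) x ∈ bideg K V (p - 1) q ∧
    (p = 0 → contr (pairing (0, v)) x = 0)) hx
    (fun a ha b hb => ?_) (fun a b ha hb => ?_)
  · change CliffordAlgebra.contractLeft _ _ ∈ _ ∧ (_ → CliffordAlgebra.contractLeft _ _ = _)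
    rw [contractLeft_mul, contr_covec_vec_pow v hb, mul_zero, add_zero]
    refine ⟨?_, ?_⟩
    · rw [bideg_eq]; exact Submodule.mul_mem_mul (contr_covec_pow _ ha) hb
    · rintro rfl
      rw [pow_zero] at ha
      obtain ⟨r, rfl⟩ := Submodule.mem_one.1 ha
      simp
  · rw [map_add]
    exact ⟨add_mem ha.1 hb.1, fun h => by rw [ha.2 h, hb.2 h, add_zero]⟩

lemma contr_covec_bideg (φ : Dual K V) {p q : ℕ} {x : Cochain K V} (hx : x ∈ bideg K V p q) :
    contr (pairing (φ, 0)) x ∈ bideg K V p (q - 1) ∧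
      (q = 0 → contr (pairing (φ, 0)) x = 0) := by
  refine bideg_induction (P := fun x => contr (pairing (φ, 0)) x ∈ bideg K V p (q - 1) ∧
    (q = 0 → contr (pairing (φ, 0)) x = 0)) hx
    (fun a ha b hb => ?_) (fun a b ha hb => ?_)
  · change CliffordAlgebra.contractLeft _ _ ∈ _ ∧ (_ → CliffordAlgebra.contractLeft _ _ = _)
    rw [contractLeft_mul, contr_vec_covec_pow φ ha, zero_mul, zero_add]
    refine ⟨?_, ?_⟩
    · rw [bideg_eq]
      refine Submodule.mul_mem_mul ?_ (contr_vec_pow _ hb)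
      rcases Nat.even_or_odd p with h | h
      · rw [((ev_od_covec_pow ha).1 h).1]; exact ha
      · rw [((ev_od_covec_pow ha).2 h).1]; exact neg_mem ha
    · rintro rfl
      rw [pow_zero] at hb
      obtain ⟨r, rfl⟩ := Submodule.mem_one.1 hb
      simp
  · rw [map_add]
    exact ⟨add_mem ha.1 hb.1, fun h => by rw [ha.2 h, hb.2 h, add_zero]⟩

lemma mul_bideg {p₁ q₁ p₂ q₂ : ℕ} {x y : Cochain K V} (hx : x ∈ bideg K V p₁ q₁)
    (hy : y ∈ bideg K V p₂ q₂) : x * y ∈ bideg K V (p₁ + p₂) (q₁ + q₂) := by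
  refine bideg_induction (P := fun x => x * y ∈ bideg K V (p₁ + p₂) (q₁ + q₂)) hx
    (fun a ha b hb => ?_) (fun c d hc hd => ?_)
  · refine bideg_induction (P := fun y => a * b * y ∈ bideg K V (p₁ + p₂) (q₁ + q₂)) hy
      (fun a' ha' b' hb' => ?_) (fun c d hc hd => ?_)
    · rw [mul_assoc, ← mul_assoc b, super_comm (ev_od_covec_pow ha') (ev_od_vec_pow hb),
        smul_mul_assoc, mul_smul_comm, mul_assoc, ← mul_assoc a, bideg_eq, pow_add, pow_add]
      exact Submodule.smul_mem _ _ (Submodule.mul_mem_mul (Submodule.mul_mem_mul ha ha')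
        (Submodule.mul_mem_mul hb hb'))
    · rw [mul_add]; exact add_mem hc hd
  · rw [add_mul]; exact add_mem hc hd

variable [FiniteDimensional K V]

/-- The canonical Poisson super-bracket on `C`, written in a basis `b_i` of `V` with its dual
basis `b^i`:
`{a, c} = ∑_i (-1)^{|a|-1} (∂a/∂b^i · ∂c/∂b_i + ∂a/∂b_i · ∂c/∂b^i)`.
It does not depend on the basis; see `poisson_vec_covec`, `poisson_swap`, `poisson_mul` for
the properties that determine it. -/
def poisson : Cochain K V →ₗ[K] Cochain K V →ₗ[K] Cochain K V :=
  ∑ i, ((LinearMap.mul K (Cochain K V)).compl₁₂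
          (parity.toLinearMap ∘ₗ contr (pairing (0, finBasis K V i)))
          (contr (pairing ((finBasis K V).coord i, 0)))
      + (LinearMap.mul K (Cochain K V)).compl₁₂
          (parity.toLinearMap ∘ₗ contr (pairing ((finBasis K V).coord i, 0)))
          (contr (pairing (0, finBasis K V i))))

/-! ### Basis independence and general rules -/

lemma poisson_apply {ι : Type*} [Fintype ι] (b : Basis ι K V) (a c : Cochain K V) :
    poisson a c = ∑ i, (parity (contr (pairing (0, b i)) a) * contr (pairing (b.coord i, 0)) c
      + parity (contr (pairing (b.coord i, 0)) a) * contr (pairing (0, b i)) c) := by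
  let F : Dual K V →ₗ[K] V →ₗ[K] Cochain K V :=
    LinearMap.mk₂ K (fun φ v => parity (contr (pairing (0, v)) a) * contr (pairing (φ, 0)) c
      + parity (contr (pairing (φ, 0)) a) * contr (pairing (0, v)) c)
      (fun φ φ' v => by
        have : ((φ + φ', 0) : Dual K V × V) = (φ, 0) + (φ', 0) := by simp
        simp only [this, map_add, LinearMap.add_apply]; noncomm_ring)
      (fun r φ v => by
        have : ((r • φ, 0) : Dual K V × V) = r • (φ, 0) := by simp
        simp only [this, map_smul, LinearMap.smul_apply, smul_add]; simp)
      (fun φ v v' => by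
        have : ((0, v + v') : Dual K V × V) = (0, v) + (0, v') := by simp
        simp only [this, map_add, LinearMap.add_apply]; noncomm_ring)
      (fun r φ v => by
        have : ((0, r • v) : Dual K V × V) = r • (0, v) := by simp
        simp only [this, map_smul, LinearMap.smul_apply, smul_add]; simp)
  have := casimir (finBasis K V) b F
  simp only [F, LinearMap.mk₂_apply] at this
  rw [this]
  simp [poisson, LinearMap.sum_apply]

/-! ### The axioms of the Poisson super-bracket -/

/-- `{w, c}` for a generator `w ∈ V* ⊕ V` is the contraction of `c` by `⟨w, -⟩`. -/
lemma poisson_ι (w : Dual K V × V) (c : Cochain K V) :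
    poisson (ExteriorAlgebra.ι K w) c = contr (pairing w) c := by
  rw [poisson_apply (finBasis K V), pairing_eq_sum (finBasis K V)]
  simp only [CliffordAlgebra.contractLeft_ι, AlgHom.commutes, map_sum, LinearMap.sum_apply,
    map_add, map_smul, LinearMap.add_apply, LinearMap.smul_apply, ← Algebra.smul_def]

lemma poisson_algebraMap (r : K) (c : Cochain K V) :
    poisson (algebraMap K (Cochain K V) r) c = 0 := by
  rw [poisson_apply (finBasis K V)]; simp

/-- Property `{𝔤*, 𝔤} = {𝔤, 𝔤*} = ` evaluation. -/
theorem poisson_covec_vec (φ : Dual K V) (v : V) :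
    poisson (covec φ) (vec v) = algebraMap K (Cochain K V) (φ v) := by
  simp [covec, vec, poisson_ι]

theorem poisson_vec_covec (φ : Dual K V) (v : V) :
    poisson (vec v) (covec φ) = algebraMap K (Cochain K V) (φ v) := by
  simp [covec, vec, poisson_ι]

/-- Property `{𝔤, 𝔤} = 0`. -/
theorem poisson_vec_vec (v w : V) : poisson (vec v) (vec w : Cochain K V) = 0 := by
  simp [vec, poisson_ι]

/-- Property `{𝔤*, 𝔤*} = 0`. -/
theorem poisson_covec_covec (φ ψ : Dual K V) : poisson (covec φ) (covec ψ : Cochain K V) = 0 := by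
  simp [covec, poisson_ι]

/-- The Poisson identity, with the sign written through `parity`. -/
lemma poisson_mul_aux (x y c : Cochain K V) {n m : ℕ}
    (hx : (Even n → IsEv x) ∧ (Odd n → IsOd x)) (hy : (Even m → IsEv y) ∧ (Odd m → IsOd y)) :
    poisson (x * y) c = x * poisson y c + (-1 : K) ^ (n * m) • (y * poisson x c) := by
  have key : ∀ d : Dual K (Dual K V × V),
      parity (contr d (x * y)) = x * parity (contr d y)
        + (-1 : K) ^ (n * m) • (y * parity (contr d x)) := by
    intro d
    change CliffordAlgebra.involute (CliffordAlgebra.contractLeft d (x * y)) = _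
    rw [contractLeft_mul, map_add, map_mul, map_mul, CliffordAlgebra.involute_involute, add_comm]
    congr 1
    rcases Nat.even_or_odd n with hn | hn <;> rcases Nat.even_or_odd m with hm | hm
    · rw [(hn.mul_right m).neg_one_pow, one_smul, (hy.1 hm).1, (hy.1 hm).2]
    · rw [(hn.mul_right m).neg_one_pow, one_smul, (hy.2 hm).1, mul_neg, (hy.2 hm).2,
        CliffordAlgebra.involute_involute, ((hx.1 hn).contr d).1, mul_neg]
    · rw [(hm.mul_left n).neg_one_pow, one_smul, (hy.1 hm).1, (hy.1 hm).2]
    · rw [(hn.mul hm).neg_one_pow, (hy.2 hm).1, mul_neg, (hy.2 hm).2,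
        CliffordAlgebra.involute_involute, ((hx.2 hn).contr d).1, neg_smul, one_smul]
  simp only [poisson_apply (finBasis K V), key]
  simp only [Finset.mul_sum, Finset.smul_sum, ← Finset.sum_add_distrib]
  refine Finset.sum_congr rfl fun i _ => ?_
  simp only [add_mul, mul_add, smul_add, mul_assoc, smul_mul_assoc]
  abel

/-- Super-derivation in the second argument, for an odd first argument. -/
lemma poisson_od_mul (t x y : Cochain K V) (ht : IsOd t) :
    poisson t (x * y) = poisson t x * y + parity x * poisson t y := by
  simp only [poisson_apply (finBasis K V), Finset.mul_sum, Finset.sum_mul,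
    ← Finset.sum_add_distrib]
  refine Finset.sum_congr rfl fun i _ => ?_
  simp only [contractLeft_mul, (ht.contr _).1, mul_add, add_mul, ← mul_assoc,
    (ht.contr _).2]
  abel

lemma poisson_od_involute (t x : Cochain K V) (ht : IsOd t) :
    poisson t (parity x) = - parity (poisson t x) := by
  simp only [poisson_apply (finBasis K V), map_sum, map_add, map_mul, contractLeft_involute,
    (ht.contr _).1, mul_neg, ← Finset.sum_neg_distrib, neg_add]

/-- A basis of linear forms on `V* ⊕ V`; the index `k.swap` gives the dual form. -/
def form (k : Fin (finrank K V) ⊕ Fin (finrank K V)) : Dual K (Dual K V × V) :=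
  k.elim (fun i => pairing (0, finBasis K V i)) (fun i => pairing ((finBasis K V).coord i, 0))

lemma poisson_eq_sum_form (a c : Cochain K V) :
    poisson a c = ∑ k, parity (contr (form k) a) * contr (form k.swap) c := by
  rw [poisson_apply (finBasis K V), Fintype.sum_sum_type, ← Finset.sum_add_distrib]
  rfl

lemma poisson_od_contr (t x : Cochain K V) (ht : IsOd t) (d : Dual K (Dual K V × V)) :
    poisson t (contr d x) + contr d (poisson t x)
      = ∑ k, contr d (contr (form k) t) * contr (form k.swap) x := by
  simp only [poisson_eq_sum_form, map_sum, contractLeft_mul, (ht.contr _).1,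
    ← Finset.sum_add_distrib]
  refine Finset.sum_congr rfl fun k _ => ?_
  rw [CliffordAlgebra.contractLeft_comm (d := d) (d' := form k.swap) x]
  noncomm_ring

/-- The super-Jacobi identity with an odd first entry. -/
theorem poisson_jacobi_od (t x y : Cochain K V) (ht : IsOd t) :
    poisson t (poisson x y) = poisson (poisson t x) y + poisson (parity x) (poisson t y) := by
  have h1 : poisson t (poisson x y) - poisson (poisson t x) y - poisson (parity x) (poisson t y)
      = ∑ j, (- parity (poisson t (contr (form j) x) + contr (form j) (poisson t x))
            * contr (form j.swap) y
          + contr (form j) x * (poisson t (contr (form j.swap) y)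
            + contr (form j.swap) (poisson t y))) := by
    rw [poisson_eq_sum_form x y, map_sum, poisson_eq_sum_form (poisson t x) y,
      poisson_eq_sum_form (parity x), ← Finset.sum_sub_distrib, ← Finset.sum_sub_distrib]
    refine Finset.sum_congr rfl fun j _ => ?_
    rw [poisson_od_mul _ _ _ ht, poisson_od_involute _ _ ht, contractLeft_involute, map_neg,
      CliffordAlgebra.involute_involute, map_add]
    noncomm_ring
  have h2 : ∑ j, (- parity (poisson t (contr (form j) x) + contr (form j) (poisson t x))
            * contr (form j.swap) y
          + contr (form j) x * (poisson t (contr (form j.swap) y)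
            + contr (form j.swap) (poisson t y))) = 0 := by
    simp only [poisson_od_contr _ _ ht, map_sum, map_mul, ((ht.contr _).contr _).1, neg_mul,
      Finset.sum_neg_distrib, neg_neg, Finset.sum_mul, Finset.mul_sum, Finset.sum_add_distrib]
    rw [add_eq_zero_iff_eq_neg, Finset.sum_comm, ← Finset.sum_neg_distrib]
    rw [← (Equiv.sumComm _ _).sum_comp]
    refine Finset.sum_congr rfl fun k _ => ?_
    rw [← Finset.sum_neg_distrib]
    refine Finset.sum_congr rfl fun j _ => ?_
    simp only [Equiv.sumComm_apply, Sum.swap_swap]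
    rw [← mul_assoc (contr (form k) x), ((ht.contr _).contr _).2,
      CliffordAlgebra.contractLeft_comm (d := form j)]
    simp only [neg_mul]
  rw [h2] at h1
  rw [sub_sub, sub_eq_zero] at h1
  exact h1

lemma ev_od_contr {W : Type*} [AddCommGroup W] [Module K W] {x : ExteriorAlgebra K W} {n : ℕ}
    (hx : (Even n → IsEv x) ∧ (Odd n → IsOd x)) (d : Dual K W) :
    (Even (n + 1) → IsEv (CliffordAlgebra.contractLeft d x)) ∧
      (Odd (n + 1) → IsOd (CliffordAlgebra.contractLeft d x)) :=
  ⟨fun h => (hx.2 (by simpa [Nat.even_add_one] using h)).contr d,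
    fun h => (hx.1 (by simpa [Nat.odd_add_one] using h)).contr d⟩

/-- The Poisson identity. -/
theorem poisson_mul {p₁ q₁ p₂ q₂ : ℕ} {a b : Cochain K V} (ha : a ∈ bideg K V p₁ q₁)
    (hb : b ∈ bideg K V p₂ q₂) (c : Cochain K V) :
    poisson (a * b) c
      = a * poisson b c + (-1 : K) ^ ((p₁ + q₁) * (p₂ + q₂)) • (b * poisson a c) :=
  poisson_mul_aux a b c (ev_od_bideg ha) (ev_od_bideg hb)

/-- Super-antisymmetry. -/
theorem poisson_swap {p₁ q₁ p₂ q₂ : ℕ} {a b : Cochain K V} (ha : a ∈ bideg K V p₁ q₁)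
    (hb : b ∈ bideg K V p₂ q₂) :
    poisson a b = - ((-1 : K) ^ ((p₁ + q₁) * (p₂ + q₂)) • poisson b a) := by
  have ha' := ev_od_bideg ha
  have hb' := ev_od_bideg hb
  rw [poisson_eq_sum_form a, poisson_eq_sum_form b, ← (Equiv.sumComm _ _).sum_comp,
    Finset.smul_sum, ← Finset.sum_neg_distrib]
  refine Finset.sum_congr rfl fun k _ => ?_
  simp only [Equiv.sumComm_apply, Sum.swap_swap]
  rcases Nat.even_or_odd (p₁ + q₁) with hn | hn <;> rcases Nat.even_or_odd (p₂ + q₂) with hm | hm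
  · have h1 := (ha'.1 hn).contr (form k.swap)
    have h2 := (hb'.1 hm).contr (form k)
    rw [(hn.mul_right _).neg_one_pow, one_smul, h1.1, h2.1, neg_mul, neg_mul, h1.2, h2.1]
    simp
  · have h1 := (ha'.1 hn).contr (form k.swap)
    have h2 := (hb'.2 hm).contr (form k)
    rw [(hn.mul_right _).neg_one_pow, one_smul, h1.1, h2.1, neg_mul, h1.2, h2.1]
  · have h1 := (ha'.2 hn).contr (form k.swap)
    have h2 := (hb'.1 hm).contr (form k)
    rw [(hm.mul_left _).neg_one_pow, one_smul, h1.1, h2.1, neg_mul, neg_neg, h1.2]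
  · have h1 := (ha'.2 hn).contr (form k.swap)
    have h2 := (hb'.2 hm).contr (form k)
    rw [(hn.mul hm).neg_one_pow, h1.1, h2.1, h1.2]
    simp

/-- The bracket has bidegree `(-1, -1)`. -/
theorem poisson_bideg {p₁ q₁ p₂ q₂ : ℕ} {a c : Cochain K V} (ha : a ∈ bideg K V p₁ q₁)
    (hc : c ∈ bideg K V p₂ q₂) :
    poisson a c ∈ bideg K V (p₁ + p₂ - 1) (q₁ + q₂ - 1) ∧
      (p₁ + p₂ = 0 ∨ q₁ + q₂ = 0 → poisson a c = 0) := by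
  have key : ∀ i, (parity (contr (pairing (0, finBasis K V i)) a)
        * contr (pairing ((finBasis K V).coord i, 0)) c
        ∈ bideg K V (p₁ + p₂ - 1) (q₁ + q₂ - 1) ∧
      (p₁ = 0 ∨ q₂ = 0 → parity (contr (pairing (0, finBasis K V i)) a)
        * contr (pairing ((finBasis K V).coord i, 0)) c = 0)) ∧
      (parity (contr (pairing ((finBasis K V).coord i, 0)) a)
        * contr (pairing (0, finBasis K V i)) c
        ∈ bideg K V (p₁ + p₂ - 1) (q₁ + q₂ - 1) ∧
      (q₁ = 0 ∨ p₂ = 0 → parity (contr (pairing ((finBasis K V).coord i, 0)) a)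
        * contr (pairing (0, finBasis K V i)) c = 0)) := by
    intro i
    have h1 := contr_vec_bideg (finBasis K V i) ha
    have h2 := contr_covec_bideg ((finBasis K V).coord i) hc
    have h3 := contr_covec_bideg ((finBasis K V).coord i) ha
    have h4 := contr_vec_bideg (finBasis K V i) hc
    have h12 : p₁ = 0 ∨ q₂ = 0 → parity (contr (pairing (0, finBasis K V i)) a)
        * contr (pairing ((finBasis K V).coord i, 0)) c = 0 := by
      rintro (h | h)
      · rw [h1.2 h, map_zero, zero_mul]
      · rw [h2.2 h, mul_zero]
    have h34 : q₁ = 0 ∨ p₂ = 0 → parity (contr (pairing ((finBasis K V).coord i, 0)) a)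
        * contr (pairing (0, finBasis K V i)) c = 0 := by
      rintro (h | h)
      · rw [h3.2 h, map_zero, zero_mul]
      · rw [h4.2 h, mul_zero]
    refine ⟨⟨?_, h12⟩, ⟨?_, h34⟩⟩
    · by_cases h : p₁ = 0 ∨ q₂ = 0
      · rw [h12 h]; exact zero_mem _
      · have := mul_bideg (parity_bideg h1.1) h2.1
        rwa [show p₁ - 1 + p₂ = p₁ + p₂ - 1 by omega,
          show q₁ + (q₂ - 1) = q₁ + q₂ - 1 by omega] at this
    · by_cases h : q₁ = 0 ∨ p₂ = 0
      · rw [h34 h]; exact zero_mem _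
      · have := mul_bideg (parity_bideg h3.1) h4.1
        rwa [show p₁ + (p₂ - 1) = p₁ + p₂ - 1 by omega,
          show q₁ - 1 + q₂ = q₁ + q₂ - 1 by omega] at this
  rw [poisson_apply (finBasis K V)]
  refine ⟨sum_mem fun i _ => add_mem (key i).1.1 (key i).2.1, fun h => ?_⟩
  refine Finset.sum_eq_zero fun i _ => ?_
  rw [(key i).1.2 (by omega), (key i).2.2 (by omega), add_zero]

/-! ### Group actions on cochains -/

end BigBracket

section action

variable {K V G : Type*} [Field K] [AddCommGroup V] [Module K V] [Group G]

/-- The action of `G` on `C` induced by an action on `V` (contragredient action on `V*`). -/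
def cochainRep (ρ : Representation K G V) : Representation K G (Cochain K V) where
  toFun g := (ExteriorAlgebra.map ((ρ.dual.prod ρ) g)).toLinearMap
  map_one' := by ext x; simp [Module.End.one_eq_id]
  map_mul' g h := by
    rw [map_mul, Module.End.mul_eq_comp, ← ExteriorAlgebra.map_comp_map]
    rfl

lemma cochainRep_covec (ρ : Representation K G V) (g : G) (φ : Dual K V) :
    cochainRep ρ g (covec φ) = covec (ρ.dual g φ) := by
  simp [cochainRep, covec]

lemma cochainRep_vec (ρ : Representation K G V) (g : G) (v : V) :
    cochainRep ρ g (vec v) = vec (ρ g v) := by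
  simp [cochainRep, vec]

lemma cochainRep_mul (ρ : Representation K G V) (g : G) (x y : Cochain K V) :
    cochainRep ρ g (x * y) = cochainRep ρ g x * cochainRep ρ g y :=
  map_mul (ExteriorAlgebra.map ((ρ.dual.prod ρ) g)) x y

lemma cochainRep_involute (ρ : Representation K G V) (g : G) (x : Cochain K V) :
    cochainRep ρ g (parity x) = parity (cochainRep ρ g x) := by
  change ((ExteriorAlgebra.map ((ρ.dual.prod ρ) g)).comp parity) x
    = (parity.comp (ExteriorAlgebra.map ((ρ.dual.prod ρ) g))) x
  congr 1
  ext w <;> simp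

lemma contr_cochainRep (ρ : Representation K G V) (g : G) (d : Dual K (Dual K V × V))
    (x : Cochain K V) :
    contr d (cochainRep ρ g x) = cochainRep ρ g (contr (d ∘ₗ (ρ.dual.prod ρ) g) x) := by
  change contr d (ExteriorAlgebra.map _ x) = ExteriorAlgebra.map _ _
  induction x using CliffordAlgebra.left_induction with
  | algebraMap r => simp
  | add x x' hx hx' => simp only [map_add, hx, hx']
  | ι_mul x m hx =>
    have h : ∀ y, ExteriorAlgebra.map ((ρ.dual.prod ρ) g) (CliffordAlgebra.ι 0 m * y)
        = CliffordAlgebra.ι 0 ((ρ.dual.prod ρ) g m) * ExteriorAlgebra.map ((ρ.dual.prod ρ) g) y :=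
      fun y => (map_mul _ _ _).trans (congrArg (· * _) (ExteriorAlgebra.map_apply_ι _ m))
    rw [h, CliffordAlgebra.contractLeft_ι_mul, CliffordAlgebra.contractLeft_ι_mul, map_sub, h,
      map_smul, ← hx]
    rfl

/-- The basis `g b_i`. -/
def moved (ρ : Representation K G V) (g : G) {ι : Type*} (b : Basis ι K V) : Basis ι K V :=
  b.map (LinearEquiv.ofLinearMap (ρ g) (ρ g⁻¹) (by ext; simp) (by ext; simp))

lemma moved_apply (ρ : Representation K G V) (g : G) {ι : Type*} (b : Basis ι K V) (i : ι) :
    moved ρ g b i = ρ g (b i) := by simp [moved]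

lemma moved_coord (ρ : Representation K G V) (g : G) {ι : Type*} (b : Basis ι K V) (i : ι) :
    (moved ρ g b).coord i = ρ.dual g (b.coord i) := by
  ext v
  simp [moved, Module.Dual.transpose_apply]

theorem poisson_cochainRep [FiniteDimensional K V] (ρ : Representation K G V) (g : G) (x y : Cochain K V) :
    poisson (cochainRep ρ g x) (cochainRep ρ g y) = cochainRep ρ g (poisson x y) := by
  have h1 : ∀ v, (pairing (0, ρ g v) : Dual K (Dual K V × V)) ∘ₗ (ρ.dual.prod ρ) g
      = pairing (0, v) := by
    intro v; ext w <;> simp [Module.Dual.transpose_apply]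
  have h2 : ∀ φ, (pairing (ρ.dual g φ, 0) : Dual K (Dual K V × V)) ∘ₗ (ρ.dual.prod ρ) g
      = pairing (φ, 0) := by
    intro v; ext w <;> simp [Module.Dual.transpose_apply]
  rw [poisson_apply (moved ρ g (finBasis K V)), poisson_apply (finBasis K V), map_sum]
  refine Finset.sum_congr rfl fun i _ => ?_
  rw [moved_apply, moved_coord]
  simp only [contr_cochainRep, h1, h2, map_add, cochainRep_mul, ← cochainRep_involute]

lemma cochainRep_bideg (ρ : Representation K G V) (g : G) {p q : ℕ} {x : Cochain K V}
    (hx : x ∈ bideg K V p q) : cochainRep ρ g x ∈ bideg K V p q := by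
  have h : ∀ {S : Submodule K (Cochain K V)} (_ : S.map (cochainRep ρ g) ≤ S) {n : ℕ}
      {y : Cochain K V}, y ∈ S ^ n → cochainRep ρ g y ∈ S ^ n := by
    intro S hS n y hy
    have := Submodule.mem_map_of_mem (f := (ExteriorAlgebra.map ((ρ.dual.prod ρ) g)).toLinearMap) hy
    rw [Submodule.map_pow] at this
    exact pow_le_pow_left' hS n this
  refine bideg_induction (P := fun x => cochainRep ρ g x ∈ bideg K V p q) hx
    (fun a ha b hb => ?_) (fun a b ha hb => ?_)
  · rw [cochainRep_mul, bideg_eq]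
    refine Submodule.mul_mem_mul (h ?_ ha) (h ?_ hb)
    · rintro _ ⟨_, ⟨φ, rfl⟩, rfl⟩
      exact ⟨_, (cochainRep_covec ρ g φ).symm⟩
    · rintro _ ⟨_, ⟨φ, rfl⟩, rfl⟩
      exact ⟨_, (cochainRep_vec ρ g φ).symm⟩
  · rw [map_add]; exact add_mem ha hb

end action

/-! ### The cohomology of a Lie algebra with coefficients in its exterior algebra -/

section cohomology

variable (K : Type*) (𝔤 : Type*) [Field K] [LieRing 𝔤] [LieAlgebra K 𝔤]
  [FiniteDimensional K 𝔤]

/-- The Lie bracket of `𝔤`, seen as the element `μ = ½ ∑_{i,j} (b^i ∧ b^j) ⊗ [b_i, b_j]`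
of `C^{2,1} = ⋀² 𝔤* ⊗ 𝔤` (in characteristic zero). -/
def bracketCochain : Cochain K 𝔤 :=
  (2 : K)⁻¹ • ∑ i, ∑ j, covec ((finBasis K 𝔤).coord i) * covec ((finBasis K 𝔤).coord j)
    * vec ⁅finBasis K 𝔤 i, finBasis K 𝔤 j⁆

/-- The Chevalley-Eilenberg differential `d = {μ, -}`. -/
def diffCE : Cochain K 𝔤 →ₗ[K] Cochain K 𝔤 := poisson (bracketCochain K 𝔤)

/-- The space of cocycles. -/
def cocycles : Submodule K (Cochain K 𝔤) := LinearMap.ker (diffCE K 𝔤)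

/-- The space of coboundaries, inside the cocycles. -/
def coboundaries : Submodule K (cocycles K 𝔤) :=
  (LinearMap.range (diffCE K 𝔤)).comap (cocycles K 𝔤).subtype

/-- The cohomology `H^{•,•}(𝔤) = ⨁ H^p(𝔤, ⋀^q 𝔤)`. -/
abbrev Cohomology : Type _ := cocycles K 𝔤 ⧸ coboundaries K 𝔤

/-- The subspace `H^{p,q}(𝔤) = H^p(𝔤, ⋀^q 𝔤)`: the classes of cocycles in `C^{p,q}`. -/
def cohBideg (p q : ℕ) : Submodule K (Cohomology K 𝔤) :=
  ((bideg K 𝔤 p q).comap (cocycles K 𝔤).subtype).map (coboundaries K 𝔤).mkQ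

/-- The even part `H_E^{•,•}(𝔤) = ⨁_{p+q even} H^{p,q}(𝔤)`. -/
def evenCoh : Submodule K (Cohomology K 𝔤) :=
  ⨆ (p : ℕ) (q : ℕ) (_ : Even (p + q)), cohBideg K 𝔤 p q

variable {K 𝔤}

lemma bracketCochain_eq {ι : Type*} [Fintype ι] (b : Basis ι K 𝔤) :
    bracketCochain K 𝔤
      = (2 : K)⁻¹ • ∑ i, ∑ j, covec (b.coord i) * covec (b.coord j) * vec ⁅b i, b j⁆ := by
  let F : Dual K 𝔤 → 𝔤 → Dual K 𝔤 →ₗ[K] 𝔤 →ₗ[K] Cochain K 𝔤 := fun φ v =>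
    LinearMap.mk₂ K (fun ψ w => covec φ * covec ψ * vec ⁅v, w⁆)
      (fun ψ ψ' w => by simp only [map_add]; noncomm_ring)
      (fun r ψ w => by simp)
      (fun ψ w w' => by simp only [lie_add, map_add]; noncomm_ring)
      (fun r ψ w => by simp)
  have hF : ∀ φ v, ∑ j, covec φ * covec ((finBasis K 𝔤).coord j) * vec ⁅v, finBasis K 𝔤 j⁆
      = ∑ j, covec φ * covec (b.coord j) * vec ⁅v, b j⁆ := fun φ v => by
    simpa only [F, LinearMap.mk₂_apply] using casimir b (finBasis K 𝔤) (F φ v)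
  let F' : Dual K 𝔤 →ₗ[K] 𝔤 →ₗ[K] Cochain K 𝔤 :=
    LinearMap.mk₂ K (fun φ v => ∑ j, covec φ * covec (b.coord j) * vec ⁅v, b j⁆)
      (fun ψ ψ' w => by simp only [map_add, add_mul, Finset.sum_add_distrib])
      (fun r ψ w => by simp [Finset.smul_sum])
      (fun ψ w w' => by simp only [add_lie, map_add, mul_add, Finset.sum_add_distrib])
      (fun r ψ w => by simp [Finset.smul_sum])
  have hF' := casimir b (finBasis K 𝔤) F'
  simp only [F', LinearMap.mk₂_apply] at hF'
  rw [bracketCochain, ← hF']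
  simp only [hF]

lemma bracketCochain_mem : bracketCochain K 𝔤 ∈ bideg K 𝔤 2 1 := by
  rw [bracketCochain, bideg_eq]
  refine Submodule.smul_mem _ _ (sum_mem fun i _ => sum_mem fun j _ => ?_)
  rw [pow_one, pow_two]
  exact Submodule.mul_mem_mul (Submodule.mul_mem_mul ⟨_, rfl⟩ ⟨_, rfl⟩) ⟨_, rfl⟩

lemma isOd_bracketCochain : IsOd (bracketCochain K 𝔤) :=
  (ev_od_bideg bracketCochain_mem).2 (by decide)

lemma diffCE_poisson (x y : Cochain K 𝔤) :
    diffCE K 𝔤 (poisson x y)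
      = poisson (diffCE K 𝔤 x) y + poisson (parity x) (diffCE K 𝔤 y) :=
  poisson_jacobi_od _ _ _ isOd_bracketCochain

lemma diffCE_parity (x : Cochain K 𝔤) : diffCE K 𝔤 (parity x) = - parity (diffCE K 𝔤 x) :=
  poisson_od_involute _ _ isOd_bracketCochain

lemma mem_cocycles {x : Cochain K 𝔤} : x ∈ cocycles K 𝔤 ↔ diffCE K 𝔤 x = 0 := Iff.rfl

lemma poisson_mem_cocycles {x y : Cochain K 𝔤} (hx : x ∈ cocycles K 𝔤)
    (hy : y ∈ cocycles K 𝔤) : poisson x y ∈ cocycles K 𝔤 := by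
  rw [mem_cocycles] at *
  rw [diffCE_poisson, hx, hy, map_zero, map_zero, LinearMap.zero_apply, add_zero]

lemma poisson_mem_left {x y : Cochain K 𝔤} (hx : x ∈ LinearMap.range (diffCE K 𝔤))
    (hy : y ∈ cocycles K 𝔤) : poisson x y ∈ LinearMap.range (diffCE K 𝔤) := by
  obtain ⟨z, rfl⟩ := hx
  refine ⟨poisson z y, ?_⟩
  rw [diffCE_poisson, mem_cocycles.1 hy, map_zero, add_zero]

lemma poisson_mem_right {x y : Cochain K 𝔤} (hx : x ∈ cocycles K 𝔤)
    (hy : y ∈ LinearMap.range (diffCE K 𝔤)) : poisson x y ∈ LinearMap.range (diffCE K 𝔤) := by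
  obtain ⟨z, rfl⟩ := hy
  refine ⟨poisson (parity x) z, ?_⟩
  rw [diffCE_poisson, diffCE_parity, mem_cocycles.1 hx, map_zero, neg_zero, map_zero,
    LinearMap.zero_apply, zero_add, CliffordAlgebra.involute_involute]

/-- The bracket of two cocycles, as a class. -/
def cocycleBracket : cocycles K 𝔤 →ₗ[K] cocycles K 𝔤 →ₗ[K] Cohomology K 𝔤 :=
  LinearMap.mk₂ K (fun x y => (coboundaries K 𝔤).mkQ ⟨poisson x.1 y.1, poisson_mem_cocycles x.2 y.2⟩)
    (fun x x' y => by
      rw [← map_add]; congr 1; ext; simp)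
    (fun r x y => by
      rw [← map_smul]; congr 1; ext; simp)
    (fun x y y' => by
      rw [← map_add]; congr 1; ext; simp)
    (fun r x y => by
      rw [← map_smul]; congr 1; ext; simp)

/-- The Poisson super-bracket on cohomology, `{[x], [y]} = [{x, y}]`. -/
def cohBracket : Cohomology K 𝔤 →ₗ[K] Cohomology K 𝔤 →ₗ[K] Cohomology K 𝔤 :=
  (coboundaries K 𝔤).liftQ
    ((coboundaries K 𝔤).liftQ (cocycleBracket (K := K) (𝔤 := 𝔤)).flip (by
      intro y hy
      ext x
      exact (Submodule.Quotient.mk_eq_zero _).2 (poisson_mem_right x.2 hy))).flip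
    (by
      intro x hx
      refine LinearMap.ext fun y => ?_
      obtain ⟨y, rfl⟩ := (coboundaries K 𝔤).mkQ_surjective y
      exact (Submodule.Quotient.mk_eq_zero _).2 (poisson_mem_left hx y.2))

lemma cohBracket_mkQ (x y : cocycles K 𝔤) :
    cohBracket ((coboundaries K 𝔤).mkQ x) ((coboundaries K 𝔤).mkQ y)
      = (coboundaries K 𝔤).mkQ ⟨poisson x.1 y.1, poisson_mem_cocycles x.2 y.2⟩ := rfl

lemma cohBracket_mem_evenCoh {x y : Cohomology K 𝔤} (hx : x ∈ evenCoh K 𝔤)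
    (hy : y ∈ evenCoh K 𝔤) : cohBracket x y ∈ evenCoh K 𝔤 := by
  have hmem : ∀ {p q : ℕ}, Even (p + q) → cohBideg K 𝔤 p q ≤ evenCoh K 𝔤 := fun {p q} h =>
    le_iSup_of_le p (le_iSup_of_le q (le_iSup_of_le h le_rfl))
  have key : ∀ {p₁ q₁ p₂ q₂ : ℕ}, Even (p₁ + q₁) → Even (p₂ + q₂) → ∀ x ∈ cohBideg K 𝔤 p₁ q₁,
      ∀ y ∈ cohBideg K 𝔤 p₂ q₂, cohBracket x y ∈ evenCoh K 𝔤 := by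
    rintro p₁ q₁ p₂ q₂ h₁ h₂ _ ⟨x, hx, rfl⟩ _ ⟨y, hy, rfl⟩
    have hb := poisson_bideg (show x.1 ∈ bideg K 𝔤 p₁ q₁ from hx)
      (show y.1 ∈ bideg K 𝔤 p₂ q₂ from hy)
    rw [cohBracket_mkQ]
    by_cases h : p₁ + p₂ = 0 ∨ q₁ + q₂ = 0
    · have h0 := hb.2 h
      have : (⟨poisson x.1 y.1, poisson_mem_cocycles x.2 y.2⟩ : cocycles K 𝔤) = 0 :=
        Subtype.ext h0
      rw [this, map_zero]; exact zero_mem _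
    · refine hmem (p := p₁ + p₂ - 1) (q := q₁ + q₂ - 1) ?_ ⟨_, hb.1, rfl⟩
      rw [Nat.even_iff] at *
      omega
  have key2 : ∀ {p₁ q₁ : ℕ}, Even (p₁ + q₁) → ∀ x ∈ cohBideg K 𝔤 p₁ q₁,
      ∀ y ∈ evenCoh K 𝔤, cohBracket x y ∈ evenCoh K 𝔤 := by
    intro p₁ q₁ h₁ x hx y hy
    have : evenCoh K 𝔤 ≤ (evenCoh K 𝔤).comap (cohBracket x) :=
      iSup_le fun p => iSup_le fun q => iSup_le fun h y hy => key h₁ h x hx y hy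
    exact this hy
  have : evenCoh K 𝔤 ≤ (evenCoh K 𝔤).comap (cohBracket.flip y) :=
    iSup_le fun p => iSup_le fun q => iSup_le fun h x hx => key2 h x hx y hy
  exact this hx

/-- The Poisson bracket on the even cohomology `H_E^{•,•}(𝔤)`. -/
def evenBracket : evenCoh K 𝔤 →ₗ[K] evenCoh K 𝔤 →ₗ[K] evenCoh K 𝔤 :=
  LinearMap.mk₂ K (fun x y => ⟨cohBracket x.1 y.1, cohBracket_mem_evenCoh x.2 y.2⟩)
    (fun x x' y => by ext; simp) (fun r x y => by ext; simp)
    (fun x y y' => by ext; simp) (fun r x y => by ext; simp)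

/-! ### Actions by Lie algebra automorphisms -/

variable {G : Type*} [Group G] (ρ : Representation K G 𝔤)
  (hρ : ∀ g x y, ρ g ⁅x, y⁆ = ⁅ρ g x, ρ g y⁆)

lemma cochainRep_bracketCochain (hρ : ∀ g x y, ρ g ⁅x, y⁆ = ⁅ρ g x, ρ g y⁆) (g : G) :
    cochainRep ρ g (bracketCochain K 𝔤) = bracketCochain K 𝔤 := by
  conv_lhs => rw [bracketCochain]
  rw [bracketCochain_eq (moved ρ g (finBasis K 𝔤))]
  simp only [map_smul, map_sum, cochainRep_mul, cochainRep_covec, cochainRep_vec, hρ,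
    moved_apply, moved_coord]

lemma diffCE_cochainRep (hρ : ∀ g x y, ρ g ⁅x, y⁆ = ⁅ρ g x, ρ g y⁆) (g : G) (x : Cochain K 𝔤) :
    diffCE K 𝔤 (cochainRep ρ g x) = cochainRep ρ g (diffCE K 𝔤 x) := by
  rw [diffCE, ← poisson_cochainRep, cochainRep_bracketCochain ρ hρ]

/-- The induced action of `G` on cocycles. -/
def cocycleRep : Representation K G (cocycles K 𝔤) :=
  (cochainRep ρ).subrepresentation (cocycles K 𝔤) (fun g x hx => by
    change diffCE K 𝔤 (cochainRep ρ g x) = 0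
    rw [diffCE_cochainRep ρ hρ, mem_cocycles.1 hx, map_zero])

/-- The induced action of `G` on cohomology. -/
def cohRep : Representation K G (Cohomology K 𝔤) :=
  (cocycleRep ρ hρ).quotient (coboundaries K 𝔤) (fun g x hx => by
    obtain ⟨z, hz⟩ := hx
    refine ⟨cochainRep ρ g z, ?_⟩
    rw [diffCE_cochainRep ρ hρ, hz]
    rfl)

/-- The induced action of `G` on the even cohomology. -/
def evenRep : Representation K G (evenCoh K 𝔤) :=
  (cohRep ρ hρ).subrepresentation (evenCoh K 𝔤) (fun g => by
    refine iSup_le fun p => iSup_le fun q => iSup_le fun h => ?_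
    rintro _ ⟨x, hx, rfl⟩
    refine le_iSup_of_le (f := fun p => ⨆ (q : ℕ) (_ : Even (p + q)), cohBideg K 𝔤 p q) p
      (le_iSup_of_le q (le_iSup_of_le h le_rfl)) ?_
    exact ⟨cocycleRep ρ hρ g x, cochainRep_bideg ρ g hx, rfl⟩)

end cohomology

/-! ### Partial labelings and `G`-tables -/

/-- A partial labeling of `Rep(G)`: pairwise non-isomorphic finite dimensional irreducible
representations `V_i`, and for all `i`, `j`, `k` a basis `m_1, …, m_d` of
`Hom_G(V_i ⊗ V_j, V_k)`. -/
structure PartialLabeling (K : Type u) [Field K] (G : Type v) [Group G] where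
  Idx : Type
  V : Idx → Type u
  [addCommGroup : ∀ i, AddCommGroup (V i)]
  [module : ∀ i, Module K (V i)]
  [finite : ∀ i, FiniteDimensional K (V i)]
  ρ : ∀ i, Representation K G (V i)
  irreducible : ∀ i, (ρ i).IsIrreducible
  eq_of_equiv : ∀ i j, Nonempty ((ρ i).Equiv (ρ j)) → i = j
  dim : Idx → Idx → Idx → ℕ
  m : ∀ i j k, Fin (dim i j k) → ((ρ i).tprod (ρ j)).IntertwiningMap (ρ k)
  m_linearIndependent : ∀ i j k, LinearIndependent K (m i j k)
  m_span : ∀ i j k, ⊤ ≤ Submodule.span K (Set.range (m i j k))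

attribute [instance] PartialLabeling.addCommGroup PartialLabeling.module PartialLabeling.finite

/-- `IsGTable L μ π ε τ c`: the scalars `c` are the `G`-table, for the labeling `L`, of the algebra
`A` with multiplication `μ` and `G`-action `π`, with respect to the `G`-morphisms
`τ_r : V_{ε r} → A`. That is, `G` acts by algebra automorphisms, `A` is the direct sum of the
`A_r = τ_r(V_{ε r}) ≅ V_{ε r}`, and the restriction of `μ` to `A_{r₁} ⊗ A_{r₂}` is
`∑_s ∑_q c_{r₁,r₂}^{s,q} τ_s ∘ m_q ∘ (τ_{r₁} ⊗ τ_{r₂})⁻¹`. -/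
structure IsGTable {K : Type u} [Field K] {G : Type v} [Group G] (L : PartialLabeling K G)
    {A : Type w} [AddCommGroup A] [Module K A] (μ : A →ₗ[K] A →ₗ[K] A)
    (π : Representation K G A) {R : Type} [Fintype R] [DecidableEq R] (ε : R → L.Idx)
    (τ : ∀ r, (L.ρ (ε r)).IntertwiningMap π)
    (c : ∀ r₁ r₂ s, Fin (L.dim (ε r₁) (ε r₂) (ε s)) → K) : Prop where
  map_mul : ∀ g a b, π g (μ a b) = μ (π g a) (π g b)
  injective : ∀ r, Function.Injective (τ r)
  isInternal : DirectSum.IsInternal fun r => LinearMap.range (τ r).toLinearMap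
  mul_eq : ∀ r₁ r₂ (u : L.V (ε r₁)) (v : L.V (ε r₂)),
    μ (τ r₁ u) (τ r₂ v) = ∑ s, ∑ q, c r₁ r₂ s q • τ s (L.m (ε r₁) (ε r₂) (ε s) q (u ⊗ₜ[K] v))

/-! ### The partial labeling of `Rep(SL(2, K))` -/

section labeling

variable (K : Type u) [Field K]

local notation "SL2" => Matrix.SpecialLinearGroup (Fin 2) K

/-- The space of traceless `2 × 2` matrices. -/
abbrev Sl2 : Type u := LieAlgebra.SpecialLinear.sl (Fin 2) K

/-- The spaces `V_0 = K`, `V_1 = K²` and `V_2 = 𝔰𝔩(2, K)`. -/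
def IrrSpace : Fin 3 → Type u
  | 0 => K
  | 1 => Fin 2 → K
  | 2 => Sl2 K

instance : ∀ i, AddCommGroup (IrrSpace K i)
  | 0 => inferInstanceAs (AddCommGroup K)
  | 1 => inferInstanceAs (AddCommGroup (Fin 2 → K))
  | 2 => inferInstanceAs (AddCommGroup (Sl2 K))

instance : ∀ i, Module K (IrrSpace K i)
  | 0 => inferInstanceAs (Module K K)
  | 1 => inferInstanceAs (Module K (Fin 2 → K))
  | 2 => inferInstanceAs (Module K (Sl2 K))

instance : ∀ i, FiniteDimensional K (IrrSpace K i)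
  | 0 => inferInstanceAs (FiniteDimensional K K)
  | 1 => inferInstanceAs (FiniteDimensional K (Fin 2 → K))
  | 2 => inferInstanceAs (FiniteDimensional K (Sl2 K))

variable {K}

lemma trace_eq_zero (A : Sl2 K) : A.1.trace = 0 := A.2

/-- A traceless matrix as an element of `𝔰𝔩(2, K)`. -/
def mkSl2 (A : Matrix (Fin 2) (Fin 2) K) (h : A.trace = 0) : Sl2 K :=
  ⟨A, h⟩

variable (K)

/-- The canonical representation of `SL(2, K)` on `K²`. -/
def canonicalRep : Representation K SL2 (Fin 2 → K) where
  toFun g := Matrix.mulVecLin g.1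
  map_one' := by ext; simp
  map_mul' g h := by ext; simp

/-- The adjoint representation of `SL(2, K)` on `𝔰𝔩(2, K)`, `A ↦ g A g⁻¹`. -/
def adjointRep : Representation K SL2 (Sl2 K) where
  toFun g :=
    { toFun := fun A => mkSl2 (g.1 * A.1 * (g⁻¹).1) (by
        rw [Matrix.trace_mul_cycle, ← Matrix.SpecialLinearGroup.coe_mul, inv_mul_cancel,
          Matrix.SpecialLinearGroup.coe_one, one_mul, trace_eq_zero])
      map_add' := fun A B => Subtype.ext (by simp [mkSl2, mul_add, add_mul])
      map_smul' := fun r A => Subtype.ext (by simp [mkSl2]) }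
  map_one' := by ext; simp [mkSl2]
  map_mul' g h := by
    refine LinearMap.ext fun A => Subtype.ext ?_
    simp only [mkSl2, mul_inv_rev, Matrix.SpecialLinearGroup.coe_mul, LinearMap.coe_mk,
      AddHom.coe_mk, Module.End.mul_apply, mul_assoc]

/-- The trivial, canonical and adjoint representations `π_0`, `π_1`, `π_2`. -/
def irrRep : ∀ i, Representation K SL2 (IrrSpace K i)
  | 0 => Representation.trivial K SL2 K
  | 1 => canonicalRep K
  | 2 => adjointRep K

variable {K}

/-- `m^{1,1,0}`, the determinant. -/
def m110 : (Fin 2 → K) →ₗ[K] (Fin 2 → K) →ₗ[K] K :=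
  LinearMap.mk₂ K (fun x y => Matrix.det !![x 0, x 1; y 0, y 1])
    (fun x x' y => by simp [Matrix.det_fin_two]; ring)
    (fun r x y => by simp [Matrix.det_fin_two]; ring)
    (fun x x' y => by simp [Matrix.det_fin_two]; ring)
    (fun r x y => by simp [Matrix.det_fin_two]; ring)

/-- `m^{1,1,2}`. -/
def m112 : (Fin 2 → K) →ₗ[K] (Fin 2 → K) →ₗ[K] Sl2 K :=
  LinearMap.mk₂ K (fun x y => mkSl2
      !![x 0 * y 1 + x 1 * y 0, -2 * x 0 * y 0; 2 * x 1 * y 1, - x 0 * y 1 - x 1 * y 0]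
      (by rw [Matrix.trace_fin_two_of]; ring))
    (fun x x' y => by ext i j; fin_cases i <;> fin_cases j <;> simp [mkSl2] <;> ring)
    (fun r x y => by ext i j; fin_cases i <;> fin_cases j <;> simp [mkSl2] <;> ring)
    (fun x x' y => by ext i j; fin_cases i <;> fin_cases j <;> simp [mkSl2] <;> ring)
    (fun r x y => by ext i j; fin_cases i <;> fin_cases j <;> simp [mkSl2] <;> ring)

/-- `m^{2,1,1}`: `A ⊗ x ↦ x Aᵗ`, for row vectors `x`. -/
def m211 : Sl2 K →ₗ[K] (Fin 2 → K) →ₗ[K] (Fin 2 → K) :=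
  LinearMap.mk₂ K (fun A x => Matrix.vecMul x A.1.transpose)
    (fun A B x => by simp [Matrix.vecMul_add]) (fun r A x => by simp [Matrix.vecMul_smul])
    (fun A x y => by simp [Matrix.add_vecMul]) (fun r A x => by simp [Matrix.smul_vecMul])

/-- `m^{2,2,0}`: `A ⊗ B ↦ tr(AB)`. -/
def m220 : Sl2 K →ₗ[K] Sl2 K →ₗ[K] K :=
  LinearMap.mk₂ K (fun A B => (A.1 * B.1).trace)
    (fun A B x => by simp [add_mul]) (fun r A x => by simp)
    (fun A x y => by simp [mul_add]) (fun r A x => by simp)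

/-- `m^{2,2,2}`: `A ⊗ B ↦ AB - BA`. -/
def m222 : Sl2 K →ₗ[K] Sl2 K →ₗ[K] Sl2 K :=
  LinearMap.mk₂ K (fun A B => mkSl2 (A.1 * B.1 - B.1 * A.1)
      (by rw [Matrix.trace_sub, Matrix.trace_mul_comm, sub_self]))
    (fun A B x => Subtype.ext (by simp [mkSl2]; noncomm_ring))
    (fun r A x => Subtype.ext (by simp [mkSl2, smul_sub]))
    (fun A B x => Subtype.ext (by simp [mkSl2]; noncomm_ring))
    (fun r A x => Subtype.ext (by simp [mkSl2, smul_sub]))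

/-- The bilinear maps `V_i × V_j → V_k` of the labeling; `m^{0,i,i}` and `m^{i,0,i}` are the
multiplication by scalars, `m^{1,2,1}` is `m^{2,1,1}` up to the braiding. -/
def bilin : ∀ i j k, IrrSpace K i →ₗ[K] IrrSpace K j →ₗ[K] IrrSpace K k
  | 0, 0, 0 => LinearMap.lsmul K K
  | 0, 1, 1 => LinearMap.lsmul K (Fin 2 → K)
  | 0, 2, 2 => LinearMap.lsmul K (Sl2 K)
  | 1, 0, 1 => (LinearMap.lsmul K (Fin 2 → K)).flip
  | 2, 0, 2 => (LinearMap.lsmul K (Sl2 K)).flip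
  | 1, 1, 0 => m110
  | 1, 1, 2 => m112
  | 2, 1, 1 => m211
  | 1, 2, 1 => m211.flip
  | 2, 2, 0 => m220
  | 2, 2, 2 => m222
  | _, _, _ => 0

/-- The multiplicities `d^{i,j,k} = dim Hom(V_i ⊗ V_j, V_k)`. -/
def mult : Fin 3 → Fin 3 → Fin 3 → ℕ
  | 0, 0, 0 => 1
  | 0, 1, 1 => 1
  | 0, 2, 2 => 1
  | 1, 0, 1 => 1
  | 2, 0, 2 => 1
  | 1, 1, 0 => 1
  | 1, 1, 2 => 1
  | 2, 1, 1 => 1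
  | 1, 2, 1 => 1
  | 2, 2, 0 => 1
  | 2, 2, 2 => 1
  | _, _, _ => 0

lemma coe_inv_SL2 (g : SL2) : (g⁻¹).1 = !![g.1 1 1, -g.1 0 1; -g.1 1 0, g.1 0 0] := by
  rw [← Matrix.adjugate_fin_two]; rfl

lemma det_SL2 (g : SL2) : g.1 0 0 * g.1 1 1 - g.1 0 1 * g.1 1 0 = 1 := by
  rw [← Matrix.det_fin_two, g.2]

lemma canonicalRep_apply (g : SL2) (x : Fin 2 → K) :
    canonicalRep K g x = ![g.1 0 0 * x 0 + g.1 0 1 * x 1, g.1 1 0 * x 0 + g.1 1 1 * x 1] := by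
  ext i; fin_cases i <;> simp [canonicalRep, Matrix.mulVec, dotProduct, Fin.sum_univ_two]

lemma adjointRep_apply (g : SL2) (A : Sl2 K) :
    (adjointRep K g A).1 = g.1 * A.1 * (g⁻¹).1 := rfl

lemma sl2_apply_one_one (A : Sl2 K) : A.1 1 1 = - A.1 0 0 := by
  have := trace_eq_zero A
  rw [Matrix.trace_fin_two] at this
  linear_combination this

lemma adjointRep_entries (g : SL2) (A : Sl2 K) :
    (adjointRep K g A).1 = !![
      (g.1 0 0 * g.1 1 1 + g.1 0 1 * g.1 1 0) * A.1 0 0 - g.1 0 0 * g.1 1 0 * A.1 0 1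
        + g.1 0 1 * g.1 1 1 * A.1 1 0,
      -2 * g.1 0 0 * g.1 0 1 * A.1 0 0 + g.1 0 0 ^ 2 * A.1 0 1 - g.1 0 1 ^ 2 * A.1 1 0;
      2 * g.1 1 0 * g.1 1 1 * A.1 0 0 - g.1 1 0 ^ 2 * A.1 0 1 + g.1 1 1 ^ 2 * A.1 1 0,
      -((g.1 0 0 * g.1 1 1 + g.1 0 1 * g.1 1 0) * A.1 0 0 - g.1 0 0 * g.1 1 0 * A.1 0 1
        + g.1 0 1 * g.1 1 1 * A.1 1 0)] := by
  rw [adjointRep_apply, coe_inv_SL2]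
  have h := sl2_apply_one_one A
  ext i j
  fin_cases i <;> fin_cases j <;>
    simp [Matrix.mul_apply, Fin.sum_univ_two, h] <;> ring

lemma inv_mul_SL2 (g : SL2) : (g⁻¹).1 * g.1 = 1 := by
  rw [← Matrix.SpecialLinearGroup.coe_mul, inv_mul_cancel, Matrix.SpecialLinearGroup.coe_one]

lemma m110_equivariant (g : SL2) (x y : Fin 2 → K) :
    m110 (canonicalRep K g x) (canonicalRep K g y) = m110 x y := by
  simp only [m110, LinearMap.mk₂_apply, canonicalRep_apply, Matrix.det_fin_two_of,
    Matrix.cons_val_zero, Matrix.cons_val_one]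
  linear_combination (x 0 * y 1 - x 1 * y 0) * det_SL2 g

lemma m112_equivariant (g : SL2) (x y : Fin 2 → K) :
    m112 (canonicalRep K g x) (canonicalRep K g y) = adjointRep K g (m112 x y) := by
  refine Subtype.ext ?_
  rw [adjointRep_entries]
  simp only [m112, LinearMap.mk₂_apply, canonicalRep_apply, mkSl2]
  ext i j
  fin_cases i <;> fin_cases j <;> simp <;> ring

lemma m211_equivariant (g : SL2) (A : Sl2 K) (x : Fin 2 → K) :
    m211 (adjointRep K g A) (canonicalRep K g x) = canonicalRep K g (m211 A x) := by
  simp only [m211, LinearMap.mk₂_apply, Matrix.vecMul_transpose, adjointRep_apply]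
  change (g.1 * A.1 * (g⁻¹).1).mulVec (g.1.mulVec x) = g.1.mulVec (A.1.mulVec x)
  rw [Matrix.mulVec_mulVec, Matrix.mulVec_mulVec, mul_assoc _ _ g.1, inv_mul_SL2, mul_one]

lemma conj_mul_SL2 (g : SL2) (A B : Matrix (Fin 2) (Fin 2) K) :
    g.1 * A * (g⁻¹).1 * (g.1 * B * (g⁻¹).1) = g.1 * (A * B) * (g⁻¹).1 := by
  rw [mul_assoc g.1 B, mul_assoc (g.1 * A), ← mul_assoc (g⁻¹).1, inv_mul_SL2, one_mul,
    mul_assoc g.1 A, ← mul_assoc A B, ← mul_assoc g.1]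

lemma m220_equivariant (g : SL2) (A B : Sl2 K) :
    m220 (adjointRep K g A) (adjointRep K g B) = m220 A B := by
  simp only [m220, LinearMap.mk₂_apply, adjointRep_apply]
  rw [conj_mul_SL2, Matrix.trace_mul_cycle, inv_mul_SL2, one_mul]

lemma m222_equivariant (g : SL2) (A B : Sl2 K) :
    m222 (adjointRep K g A) (adjointRep K g B) = adjointRep K g (m222 A B) := by
  refine Subtype.ext ?_
  simp only [m222, LinearMap.mk₂_apply, adjointRep_apply, mkSl2]
  rw [conj_mul_SL2, conj_mul_SL2, mul_sub, sub_mul]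

lemma bilin_equivariant (g : SL2) : ∀ i j k (x : IrrSpace K i) (y : IrrSpace K j),
    bilin i j k (irrRep K i g x) (irrRep K j g y) = irrRep K k g (bilin i j k x y)
  | 0, 0, 0, _, _ => rfl
  | 0, 1, 1, x, y => (LinearMap.map_smul (canonicalRep K g) (show K from x) y).symm
  | 0, 2, 2, x, y => (LinearMap.map_smul (adjointRep K g) (show K from x) y).symm
  | 1, 0, 1, x, y => (LinearMap.map_smul (canonicalRep K g) (show K from y) x).symm
  | 2, 0, 2, x, y => (LinearMap.map_smul (adjointRep K g) (show K from y) x).symm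
  | 1, 1, 0, x, y => m110_equivariant g x y
  | 1, 1, 2, x, y => m112_equivariant g x y
  | 2, 1, 1, x, y => m211_equivariant g x y
  | 1, 2, 1, x, y => m211_equivariant g y x
  | 2, 2, 0, x, y => m220_equivariant g x y
  | 2, 2, 2, x, y => m222_equivariant g x y
  | 0, 1, 0, _, _ | 0, 2, 0, _, _ | 1, 0, 0, _, _ | 1, 2, 0, _, _ | 2, 0, 0, _, _
  | 2, 1, 0, _, _ => rfl
  | 0, 0, 1, _, _ | 0, 2, 1, _, _ | 1, 1, 1, _, _ | 2, 0, 1, _, _ | 2, 2, 1, _, _ =>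
    (map_zero (canonicalRep K g)).symm
  | 0, 0, 2, _, _ | 0, 1, 2, _, _ | 1, 0, 2, _, _ | 1, 2, 2, _, _ | 2, 1, 2, _, _ =>
    (map_zero (adjointRep K g)).symm

/-- The matrix `(0 1; 0 0)`. -/
def matE : Sl2 K := mkSl2 !![0, 1; 0, 0] (by simp [Matrix.trace_fin_two])

/-- The matrix `(0 0; 1 0)`. -/
def matF : Sl2 K := mkSl2 !![0, 0; 1, 0] (by simp [Matrix.trace_fin_two])

/-- The highest weight vectors `1 ∈ K`, `(1, 0) ∈ K²` and `(0 1; 0 0) ∈ 𝔰𝔩(2, K)`. -/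
def highVec : ∀ i, IrrSpace K i
  | 0 => (1 : K)
  | 1 => (![1, 0] : Fin 2 → K)
  | 2 => matE

/-- The lowest weight vectors `1 ∈ K`, `(0, 1) ∈ K²` and `(0 0; 1 0) ∈ 𝔰𝔩(2, K)`. -/
def lowVec : ∀ i, IrrSpace K i
  | 0 => (1 : K)
  | 1 => (![0, 1] : Fin 2 → K)
  | 2 => matF

lemma matE_val : (matE : Sl2 K).1 = !![0, 1; 0, 0] := rfl

lemma matF_val : (matF : Sl2 K).1 = !![0, 0; 1, 0] := rfl

lemma matE_ne : (matE : Sl2 K) ≠ 0 := fun h =>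
  one_ne_zero (α := K) (congrFun (congrFun (congrArg Subtype.val h) 0) 1)

lemma matF_ne : (matF : Sl2 K) ≠ 0 := fun h =>
  one_ne_zero (α := K) (congrFun (congrFun (congrArg Subtype.val h) 1) 0)

lemma sl2_add (A B : Sl2 K) (i j : Fin 2) : (A + B).1 i j = A.1 i j + B.1 i j := rfl

lemma sl2_sub (A B : Sl2 K) (i j : Fin 2) : (A - B).1 i j = A.1 i j - B.1 i j := rfl

lemma sl2_smul (r : K) (A : Sl2 K) (i j : Fin 2) : (r • A).1 i j = r * A.1 i j := rfl

/-- `(1 t; 0 1)`. -/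
def upper (t : K) : SL2 := ⟨!![1, t; 0, 1], by simp [Matrix.det_fin_two]⟩

/-- `(1 0; t 1)`. -/
def lower (t : K) : SL2 := ⟨!![1, 0; t, 1], by simp [Matrix.det_fin_two]⟩

/-- `(2 0; 0 ½)`. -/
def torus [CharZero K] : SL2 := ⟨!![2, 0; 0, 2⁻¹], by simp [Matrix.det_fin_two]⟩

lemma sl2_ext {A B : Sl2 K} (h0 : A.1 0 0 = B.1 0 0) (h1 : A.1 0 1 = B.1 0 1)
    (h2 : A.1 1 0 = B.1 1 0) : A = B := by
  refine Subtype.ext (Matrix.ext fun i j => ?_)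
  fin_cases i <;> fin_cases j
  · exact h0
  · exact h1
  · exact h2
  · exact (sl2_apply_one_one A).trans ((congrArg Neg.neg h0).trans (sl2_apply_one_one B).symm)

lemma adj_upper (t : K) (A : Sl2 K) :
    (adjointRep K (upper t) A).1 0 0 = A.1 0 0 + t * A.1 1 0 ∧
    (adjointRep K (upper t) A).1 0 1 = A.1 0 1 - 2 * t * A.1 0 0 - t ^ 2 * A.1 1 0 ∧
    (adjointRep K (upper t) A).1 1 0 = A.1 1 0 := by
  rw [adjointRep_entries]
  simp [upper]; ring

lemma adj_lower (t : K) (A : Sl2 K) :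
    (adjointRep K (lower t) A).1 0 0 = A.1 0 0 - t * A.1 0 1 ∧
    (adjointRep K (lower t) A).1 0 1 = A.1 0 1 ∧
    (adjointRep K (lower t) A).1 1 0 = A.1 1 0 + 2 * t * A.1 0 0 - t ^ 2 * A.1 0 1 := by
  rw [adjointRep_entries]
  simp [lower]; ring

lemma adj_torus [CharZero K] (A : Sl2 K) :
    (adjointRep K torus A).1 0 0 = A.1 0 0 ∧
    (adjointRep K torus A).1 0 1 = 4 * A.1 0 1 ∧
    (adjointRep K torus A).1 1 0 = 4⁻¹ * A.1 1 0 := by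
  rw [adjointRep_entries]
  simp [torus]
  constructor <;> norm_num

lemma span_triv (S : Submodule K K) (h : (1 : K) ∈ S) : S = ⊤ := by
  rw [eq_top_iff]
  rintro y -
  have : y = y • (1 : K) := (mul_one y).symm
  rw [this]
  exact S.smul_mem _ h

lemma span_can (S : Submodule K (Fin 2 → K))
    (h : ∀ t : K, canonicalRep K (lower t) ![1, 0] ∈ S) : S = ⊤ := by
  rw [eq_top_iff]
  rintro x -
  have : x = x 1 • canonicalRep K (lower 1) ![1, 0]
      + (x 0 - x 1) • canonicalRep K (lower 0) ![1, 0] := by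
    rw [canonicalRep_apply, canonicalRep_apply]
    ext i; fin_cases i <;> simp [lower]
  rw [this]
  exact add_mem (S.smul_mem _ (h 1)) (S.smul_mem _ (h 0))

lemma span_adj [CharZero K] (S : Submodule K (Sl2 K))
    (h : ∀ t : K, adjointRep K (lower t) matE ∈ S) : S = ⊤ := by
  rw [eq_top_iff]
  rintro A -
  have e0 := adj_lower 0 (matE : Sl2 K)
  have e1 := adj_lower 1 (matE : Sl2 K)
  have e2 := adj_lower (-1) (matE : Sl2 K)
  simp only [matE_val] at e0 e1 e2
  have : A = (-(2 : K)⁻¹ * A.1 0 0 - 2⁻¹ * A.1 1 0) • adjointRep K (lower 1) (matE : Sl2 K)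
      + ((2 : K)⁻¹ * A.1 0 0 - 2⁻¹ * A.1 1 0) • adjointRep K (lower (-1)) (matE : Sl2 K)
      + (A.1 0 1 + A.1 1 0) • adjointRep K (lower 0) (matE : Sl2 K) := by
    refine sl2_ext ?_ ?_ ?_ <;>
      simp only [sl2_add, sl2_smul,
        e0.1, e0.2.1, e0.2.2, e1.1, e1.2.1, e1.2.2, e2.1, e2.2.1, e2.2.2,
        Matrix.of_apply, Matrix.cons_val_zero, Matrix.cons_val_one,
        Matrix.cons_val', Matrix.cons_val_fin_one] <;> field_simp <;> ring
  rw [this]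
  exact add_mem (add_mem (S.smul_mem _ (h 1)) (S.smul_mem _ (h (-1)))) (S.smul_mem _ (h 0))

lemma span_lower [CharZero K] : ∀ (i : Fin 3) (S : Submodule K (IrrSpace K i)),
    (∀ t : K, irrRep K i (lower t) (highVec i) ∈ S) → S = ⊤
  | 0, S, h => span_triv S (h 0)
  | 1, S, h => span_can S h
  | 2, S, h => span_adj S h

lemma triv_top (S : Submodule K K) (hS : ∃ x ∈ S, x ≠ 0) : S = ⊤ := by
  obtain ⟨x, hx, hx0⟩ := hS
  refine span_triv S ?_
  have : x⁻¹ • x ∈ S := S.smul_mem _ hx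
  rwa [smul_eq_mul, inv_mul_cancel₀ hx0] at this

lemma can_top (S : Submodule K (Fin 2 → K))
    (hS : ∀ g : SL2, ∀ x ∈ S, canonicalRep K g x ∈ S) (h : ∃ x ∈ S, x ≠ 0) : S = ⊤ := by
  obtain ⟨x, hx, hx0⟩ := h
  suffices hE : (![1, 0] : Fin 2 → K) ∈ S from span_can S fun t => hS _ _ hE
  by_cases h1 : x 1 = 0
  · have h0 : x 0 ≠ 0 := fun h0 => hx0 (by
      funext i; fin_cases i; exacts [h0, h1])
    have : (![1, 0] : Fin 2 → K) = (x 0)⁻¹ • x := by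
      ext i; fin_cases i
      · simp [h0]
      · simp [h1]
    rw [this]; exact S.smul_mem _ hx
  · have : (![1, 0] : Fin 2 → K) = (x 1)⁻¹ • (canonicalRep K (upper 1) x - x) := by
      rw [canonicalRep_apply]
      funext i
      fin_cases i
      · change 1 = (x 1)⁻¹ * (1 * x 0 + 1 * x 1 - x 0)
        field_simp; ring
      · change 0 = (x 1)⁻¹ * (0 * x 0 + 1 * x 1 - x 1)
        ring
    rw [this]; exact S.smul_mem _ (sub_mem (hS _ _ hx) hx)

lemma adj_top [CharZero K] (S : Submodule K (Sl2 K))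
    (hS : ∀ g : SL2, ∀ x ∈ S, adjointRep K g x ∈ S) (h : ∃ x ∈ S, x ≠ 0) : S = ⊤ := by
  obtain ⟨x, hx, hx0⟩ := h
  suffices hE : (matE : Sl2 K) ∈ S from span_adj S fun t => hS _ _ hE
  have key : ∀ y ∈ S, ∀ r : K, y.1 0 0 = 0 → y.1 1 0 = 0 → y.1 0 1 = r → r ≠ 0 →
      (matE : Sl2 K) ∈ S := by
    intro y hy r h0 h1 h2 hr
    have : (matE : Sl2 K) = r⁻¹ • y := by
      refine sl2_ext ?_ ?_ ?_ <;> simp [matE_val, sl2_smul, h0, h1, h2, hr]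
    rw [this]; exact S.smul_mem _ hy
  have hd : ∀ y ∈ S, adjointRep K (upper 1) y - y ∈ S := fun y hy => sub_mem (hS _ _ hy) hy
  have hde : ∀ y : Sl2 K, (adjointRep K (upper 1) y - y).1 0 0 = y.1 1 0 ∧
      (adjointRep K (upper 1) y - y).1 0 1 = - 2 * y.1 0 0 - y.1 1 0 ∧
      (adjointRep K (upper 1) y - y).1 1 0 = 0 := by
    intro y
    have := adj_upper 1 y
    simp only [sl2_sub, this.1, this.2.1, this.2.2]
    refine ⟨by ring, by ring, by ring⟩
  by_cases h1 : x.1 1 0 = 0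
  · by_cases h0 : x.1 0 0 = 0
    · refine key x hx _ h0 h1 rfl fun h2 => hx0 (sl2_ext h0 h2 h1)
    · refine key _ (hd x hx) (-2 * x.1 0 0) ?_ (hde x).2.2 ?_ (by simpa using h0)
      · rw [(hde x).1, h1]
      · rw [(hde x).2.1, h1, sub_zero]
  · have h2 := hde (adjointRep K (upper 1) x - x)
    refine key _ (hd _ (hd x hx)) (-2 * x.1 1 0) ?_ h2.2.2 ?_ (by simpa using h1)
    · rw [h2.1, (hde x).2.2]
    · rw [h2.2.1, (hde x).2.2, (hde x).1, sub_zero]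

lemma irreducible_of {V : Type*} [AddCommGroup V] [Module K V] [Nontrivial V]
    (ρ : Representation K SL2 V) (h : ∀ S : Submodule K V, (∀ g, ∀ x ∈ S, ρ g x ∈ S) →
      (∃ x ∈ S, x ≠ 0) → S = ⊤) : ρ.IsIrreducible where
  exists_pair_ne := ⟨⊥, ⊤, fun e => by
    have := congrArg Subrepresentation.toSubmodule e
    exact bot_ne_top (α := Submodule K V) this⟩
  eq_bot_or_eq_top S := by
    by_cases hS : ∃ x ∈ S.toSubmodule, x ≠ 0
    · right
      exact Subrepresentation.toSubmodule_injective
        (h S.toSubmodule (fun g x hx => S.apply_mem_toSubmodule g hx) hS)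
    · left
      push Not at hS
      exact Subrepresentation.toSubmodule_injective ((Submodule.eq_bot_iff _).2 hS)

lemma irrRep_irreducible [CharZero K] : ∀ i, (irrRep K i).IsIrreducible
  | 0 =>
    have : Nontrivial (IrrSpace K 0) := inferInstanceAs (Nontrivial K)
    irreducible_of _ fun S _ h => triv_top S h
  | 1 =>
    have : Nontrivial (IrrSpace K 1) := inferInstanceAs (Nontrivial (Fin 2 → K))
    irreducible_of _ fun S hS h => can_top S hS h
  | 2 =>
    have : Nontrivial (IrrSpace K 2) := ⟨(matE : Sl2 K), 0, matE_ne⟩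
    irreducible_of _ fun S hS h => adj_top S hS h

/-- Coordinates on `𝔰𝔩(2, K)`. -/
def sl2Equiv : Sl2 K ≃ₗ[K] (Fin 3 → K) where
  toFun A := ![A.1 0 0, A.1 0 1, A.1 1 0]
  map_add' A B := by ext i; fin_cases i <;> simp
  map_smul' r A := by ext i; fin_cases i <;> simp
  invFun v := mkSl2 !![v 0, v 1; v 2, - v 0] (by simp [Matrix.trace_fin_two])
  left_inv A := sl2_ext rfl rfl rfl
  right_inv v := by ext i; fin_cases i <;> simp [mkSl2]

lemma finrank_irrSpace : ∀ i : Fin 3, finrank K (IrrSpace K i) = i.1 + 1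
  | 0 => finrank_self K
  | 1 => (finrank_fin_fun K).trans rfl
  | 2 => (sl2Equiv (K := K)).finrank_eq.trans (finrank_fin_fun K)

lemma irrRep_eq_of_equiv (i j : Fin 3) (h : Nonempty ((irrRep K i).Equiv (irrRep K j))) :
    i = j := by
  obtain ⟨e⟩ := h
  have := e.toLinearEquiv.finrank_eq
  rw [finrank_irrSpace, finrank_irrSpace] at this
  exact Fin.ext (by omega)

/-- The `G`-morphism `V_i ⊗ V_j → V_k` given by `bilin`. -/
def morph (i j k : Fin 3) : ((irrRep K i).tprod (irrRep K j)).IntertwiningMap (irrRep K k) where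
  toLinearMap := TensorProduct.lift (bilin i j k)
  isIntertwining' g := TensorProduct.ext' fun x y => by
    simpa using bilin_equivariant g i j k x y

lemma morph_tmul (i j k : Fin 3) (x : IrrSpace K i) (y : IrrSpace K j) :
    morph i j k (x ⊗ₜ[K] y) = bilin i j k x y := TensorProduct.lift.tmul _ _

lemma intertwining_tmul {i j k : Fin 3}
    (f : ((irrRep K i).tprod (irrRep K j)).IntertwiningMap (irrRep K k)) (g : SL2)
    (x : IrrSpace K i) (y : IrrSpace K j) :
    f (irrRep K i g x ⊗ₜ[K] irrRep K j g y) = irrRep K k g (f (x ⊗ₜ[K] y)) := by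
  rw [← f.isIntertwining]; rfl

lemma lower_lowVec : ∀ (j : Fin 3) (t : K), irrRep K j (lower t) (lowVec j) = lowVec j
  | 0, _ => rfl
  | 1, t => by
    change canonicalRep K (lower t) ![0, 1] = ![0, 1]
    rw [canonicalRep_apply]; simp [lower]
  | 2, t => by
    have h := adj_lower t (matF : Sl2 K)
    change adjointRep K (lower t) matF = matF
    refine sl2_ext (h.1.trans ?_) (h.2.1.trans rfl) (h.2.2.trans ?_) <;> simp [matF_val]

lemma lowVec_ne : ∀ j : Fin 3, (lowVec j : IrrSpace K j) ≠ 0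
  | 0 => one_ne_zero (α := K)
  | 1 => fun h => by simpa using congrFun (show (![0, 1] : Fin 2 → K) = 0 from h) 1
  | 2 => matF_ne

/-- `V_i ⊗ V_j` is generated by the tensor of a highest and a lowest weight vector. -/
lemma intertwining_eq_zero [CharZero K] {i j k : Fin 3}
    (f : ((irrRep K i).tprod (irrRep K j)).IntertwiningMap (irrRep K k))
    (h : f (highVec i ⊗ₜ[K] lowVec j) = 0) : f = 0 := by
  have h1 : ∀ x, f (x ⊗ₜ[K] lowVec j) = 0 := by
    have := span_lower i (LinearMap.ker (f.toLinearMap ∘ₗ (TensorProduct.mk K _ _).flip (lowVec j)))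
      (fun t => by
        change f (irrRep K i (lower t) (highVec i) ⊗ₜ[K] lowVec j) = 0
        conv_lhs => rw [← lower_lowVec j t]
        rw [intertwining_tmul, h, map_zero])
    intro x
    exact (LinearMap.ker_eq_top.1 this ▸ rfl :
      (f.toLinearMap ∘ₗ (TensorProduct.mk K _ _).flip (lowVec j)) x = 0)
  let S : Subrepresentation (irrRep K j) :=
    { toSubmodule := LinearMap.ker ((TensorProduct.mk K (IrrSpace K i) (IrrSpace K j)).compr₂
        f.toLinearMap).flip
      apply_mem_toSubmodule := fun g y hy => by
        refine LinearMap.ext fun x => ?_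
        have hx : x = irrRep K i g (irrRep K i g⁻¹ x) := by simp
        change f (x ⊗ₜ[K] _) = 0
        rw [hx, intertwining_tmul]
        have := LinearMap.congr_fun (LinearMap.mem_ker.1 hy) (irrRep K i g⁻¹ x)
        change f (_ ⊗ₜ[K] _) = 0 at this
        rw [this, map_zero] }
  have := irrRep_irreducible (K := K) j
  have hS : S = ⊤ := by
    rcases eq_bot_or_eq_top S with hS | hS
    · exfalso
      have hm : lowVec j ∈ S.toSubmodule := LinearMap.ext fun x => h1 x
      rw [hS] at hm
      exact lowVec_ne j hm
    · exact hS
  refine Representation.IntertwiningMap.ext (TensorProduct.ext' fun x y => ?_)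
  have hy : y ∈ S.toSubmodule := by rw [hS]; exact Submodule.mem_top
  exact LinearMap.congr_fun (LinearMap.mem_ker.1 hy) x

/-- The matrix `(1 0; 0 -1)`. -/
def matH : Sl2 K := mkSl2 !![1, 0; 0, -1] (by simp [Matrix.trace_fin_two])

lemma matH_val : (matH : Sl2 K).1 = !![1, 0; 0, -1] := rfl

lemma eq_zero_of_mul_eq {a b x : K} (hab : a ≠ b) (h : a * x = b * x) : x = 0 := by
  rcases mul_eq_mul_right_iff.1 h with h | h
  · exact absurd h hab
  · exact h

lemma triv_weight {r : K} (x : K) (h : x = r • x) (hr : 1 ≠ r) : x = 0 :=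
  eq_zero_of_mul_eq hr (by rw [one_mul]; exact h)

lemma can_weight [CharZero K] {r : K} (x : Fin 2 → K) (h : canonicalRep K torus x = r • x) :
    (2 ≠ r → x 0 = 0) ∧ (2⁻¹ ≠ r → x 1 = 0) := by
  rw [canonicalRep_apply] at h
  refine ⟨fun hr => eq_zero_of_mul_eq hr ?_, fun hr => eq_zero_of_mul_eq hr ?_⟩
  · simpa [torus] using congrFun h 0
  · simpa [torus] using congrFun h 1

lemma adj_weight [CharZero K] {r : K} (A : Sl2 K) (h : adjointRep K torus A = r • A) :
    (1 ≠ r → A.1 0 0 = 0) ∧ (4 ≠ r → A.1 0 1 = 0) ∧ (4⁻¹ ≠ r → A.1 1 0 = 0) := by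
  have e := adj_torus A
  rw [h] at e
  refine ⟨fun hr => eq_zero_of_mul_eq hr ?_, fun hr => eq_zero_of_mul_eq hr ?_,
    fun hr => eq_zero_of_mul_eq hr ?_⟩
  · rw [one_mul]; exact e.1.symm
  · exact e.2.1.symm
  · exact e.2.2.symm

lemma can_eq (x : Fin 2 → K) : x = x 0 • ![1, 0] + x 1 • ![0, 1] := by
  ext i; fin_cases i <;> simp

lemma adj_eq (A : Sl2 K) : A = A.1 0 0 • matH + A.1 0 1 • matE + A.1 1 0 • matF := by
  refine sl2_ext ?_ ?_ ?_ <;> simp [sl2_add, sl2_smul, matH_val, matE_val, matF_val]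

lemma torus_highVec [CharZero K] : ∀ i : Fin 3,
    irrRep K i torus (highVec i) = (2 : K) ^ (i : ℕ) • highVec i
  | 0 => by
    change (1 : K) = (2 : K) ^ 0 * 1
    simp
  | 1 => by
    change canonicalRep K torus ![1, 0] = (2 : K) ^ 1 • (![1, 0] : Fin 2 → K)
    rw [canonicalRep_apply]; simp [torus]
  | 2 => by
    have h := adj_torus (matE : Sl2 K)
    have e : adjointRep K torus matE = (2 : K) ^ 2 • (matE : Sl2 K) := by
      refine sl2_ext (h.1.trans ?_) (h.2.1.trans ?_) (h.2.2.trans ?_) <;>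
        simp [matE_val, sl2_smul]
      norm_num
    exact e

lemma torus_lowVec [CharZero K] : ∀ i : Fin 3,
    irrRep K i torus (lowVec i) = (2⁻¹ : K) ^ (i : ℕ) • lowVec i
  | 0 => by
    change (1 : K) = (2⁻¹ : K) ^ 0 * 1
    simp
  | 1 => by
    change canonicalRep K torus ![0, 1] = (2⁻¹ : K) ^ 1 • (![0, 1] : Fin 2 → K)
    rw [canonicalRep_apply]; simp [torus]
  | 2 => by
    have h := adj_torus (matF : Sl2 K)
    have e : adjointRep K torus matF = (2⁻¹ : K) ^ 2 • (matF : Sl2 K) := by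
      refine sl2_ext (h.1.trans ?_) (h.2.1.trans ?_) (h.2.2.trans ?_) <;>
        simp [matF_val, sl2_smul]
      norm_num
    exact e

lemma upper_highVec : ∀ (j : Fin 3) (t : K), irrRep K j (upper t) (highVec j) = highVec j
  | 0, _ => rfl
  | 1, t => by
    change canonicalRep K (upper t) ![1, 0] = ![1, 0]
    rw [canonicalRep_apply]; simp [upper]
  | 2, t => by
    have h := adj_upper t (matE : Sl2 K)
    change adjointRep K (upper t) matE = matE
    refine sl2_ext (h.1.trans ?_) (h.2.1.trans ?_) (h.2.2.trans rfl) <;> simp [matE_val]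

/-- The value of `bilin` at a highest and a lowest weight vector. -/
lemma m110_val : m110 (![1, 0] : Fin 2 → K) ![0, 1] = 1 := by
  simp [m110]

lemma m112_val : m112 (![1, 0] : Fin 2 → K) ![0, 1] = matH := by
  refine sl2_ext ?_ ?_ ?_ <;> simp [m112, mkSl2, matH_val]

lemma m211_val : m211 (matE : Sl2 K) ![0, 1] = ![1, 0] := by
  ext i; fin_cases i <;> simp [m211, matE_val, Matrix.vecMul, dotProduct, Fin.sum_univ_two]

lemma m211_val' : m211 (matF : Sl2 K) ![1, 0] = ![0, 1] := by
  ext i; fin_cases i <;> simp [m211, matF_val, Matrix.vecMul, dotProduct, Fin.sum_univ_two]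

lemma m220_val : m220 (matE : Sl2 K) matF = 1 := by
  simp [m220, matE_val, matF_val, Matrix.trace_fin_two]

lemma m222_val : m222 (matE : Sl2 K) matF = matH := by
  refine sl2_ext ?_ ?_ ?_ <;> simp [m222, mkSl2, matH_val, matE_val, matF_val]

lemma exists_zero {V : Type*} [AddCommGroup V] [Module K V] {w : V} (v : V) (h : w = 0) :
    ∃ c : K, w = c • v := ⟨0, by rw [h, zero_smul]⟩

lemma exists_weight_zero [CharZero K] : ∀ (i j : Fin 3) (w : K),
    w = ((2 : K) ^ (i : ℕ) * 2⁻¹ ^ (j : ℕ)) • w →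
    ∃ c : K, w = c • (bilin i j 0 (highVec i) (lowVec j) : K)
  | 0, 0, w, _ => ⟨w, (mul_one w).symm.trans (congrArg (w * ·) (mul_one (1 : K)).symm)⟩
  | 0, 1, w, h => exists_zero _ (triv_weight w h (by norm_num))
  | 0, 2, w, h => exists_zero _ (triv_weight w h (by norm_num))
  | 1, 0, w, h => exists_zero _ (triv_weight w h (by norm_num))
  | 1, 1, w, _ => ⟨w, (mul_one w).symm.trans (congrArg (w * ·) m110_val.symm)⟩
  | 1, 2, w, h => exists_zero _ (triv_weight w h (by norm_num))
  | 2, 0, w, h => exists_zero _ (triv_weight w h (by norm_num))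
  | 2, 1, w, h => exists_zero _ (triv_weight w h (by norm_num))
  | 2, 2, w, _ => ⟨w, (mul_one w).symm.trans (congrArg (w * ·) m220_val.symm)⟩

lemma can_zero [CharZero K] {r : K} (x : Fin 2 → K) (h : canonicalRep K torus x = r • x)
    (h2 : 2 ≠ r) (h2' : 2⁻¹ ≠ r) : x = 0 := by
  rw [can_eq x, (can_weight x h).1 h2, (can_weight x h).2 h2']; simp

lemma can_high [CharZero K] {r : K} (x : Fin 2 → K) (h : canonicalRep K torus x = r • x)
    (h2' : 2⁻¹ ≠ r) : ∃ c : K, x = c • ![1, 0] :=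
  ⟨x 0, by conv_lhs => rw [can_eq x, (can_weight x h).2 h2', zero_smul, add_zero]⟩

lemma can_low [CharZero K] {r : K} (x : Fin 2 → K) (h : canonicalRep K torus x = r • x)
    (h2 : 2 ≠ r) : ∃ c : K, x = c • ![0, 1] :=
  ⟨x 1, by conv_lhs => rw [can_eq x, (can_weight x h).1 h2, zero_smul, zero_add]⟩

lemma exists_weight_one [CharZero K] : ∀ (i j : Fin 3) (w : Fin 2 → K),
    canonicalRep K torus w = ((2 : K) ^ (i : ℕ) * 2⁻¹ ^ (j : ℕ)) • w →
    ∃ c : K, w = c • (bilin i j 1 (highVec i) (lowVec j) : Fin 2 → K)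
  | 0, 0, w, h => exists_zero _ (can_zero w h (by norm_num) (by norm_num))
  | 0, 1, w, h => by
    obtain ⟨c, hc⟩ := can_low w h (by norm_num)
    exact ⟨c, hc.trans (congrArg (c • ·) (one_smul K _).symm)⟩
  | 0, 2, w, h => exists_zero _ (can_zero w h (by norm_num) (by norm_num))
  | 1, 0, w, h => by
    obtain ⟨c, hc⟩ := can_high w h (by norm_num)
    exact ⟨c, hc.trans (congrArg (c • ·) (one_smul K _).symm)⟩
  | 1, 1, w, h => exists_zero _ (can_zero w h (by norm_num) (by norm_num))
  | 1, 2, w, h => by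
    obtain ⟨c, hc⟩ := can_low w h (by norm_num)
    exact ⟨c, hc.trans (congrArg (c • ·) m211_val'.symm)⟩
  | 2, 0, w, h => exists_zero _ (can_zero w h (by norm_num) (by norm_num))
  | 2, 1, w, h => by
    obtain ⟨c, hc⟩ := can_high w h (by norm_num)
    exact ⟨c, hc.trans (congrArg (c • ·) m211_val.symm)⟩
  | 2, 2, w, h => exists_zero _ (can_zero w h (by norm_num) (by norm_num))

lemma adj_zero [CharZero K] {r : K} (A : Sl2 K) (h : adjointRep K torus A = r • A)
    (h1 : 1 ≠ r) (h4 : 4 ≠ r) (h4' : 4⁻¹ ≠ r) : A = 0 := by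
  rw [adj_eq A, (adj_weight A h).1 h1, (adj_weight A h).2.1 h4, (adj_weight A h).2.2 h4']; simp

lemma adj_mid [CharZero K] {r : K} (A : Sl2 K) (h : adjointRep K torus A = r • A)
    (h4 : 4 ≠ r) (h4' : 4⁻¹ ≠ r) : A = A.1 0 0 • matH := by
  conv_lhs => rw [adj_eq A, (adj_weight A h).2.1 h4, (adj_weight A h).2.2 h4', zero_smul,
    zero_smul, add_zero, add_zero]

lemma exists_weight_two [CharZero K] : ∀ (i j : Fin 3) (w : Sl2 K),
    adjointRep K torus w = ((2 : K) ^ (i : ℕ) * 2⁻¹ ^ (j : ℕ)) • w →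
    (i = 0 → j = 0 → adjointRep K (upper 1) w = w) →
    ∃ c : K, w = c • (bilin i j 2 (highVec i) (lowVec j) : Sl2 K)
  | 0, 0, w, h, h' => by
    have hm := adj_mid w h (by norm_num) (by norm_num)
    have hu := (adj_upper 1 w).2.1
    rw [h' rfl rfl] at hu
    have h10 := (adj_weight w h).2.2 (by norm_num)
    have h00 : w.1 0 0 = 0 := by
      rw [h10] at hu
      linear_combination (2⁻¹ : K) * hu
    exact exists_zero _ (by rw [hm, h00, zero_smul])
  | 0, 1, w, h, _ => exists_zero _ (adj_zero w h (by norm_num) (by norm_num) (by norm_num))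
  | 0, 2, w, h, _ => by
    have e : w = w.1 1 0 • matF := by
      conv_lhs => rw [adj_eq w, (adj_weight w h).1 (by norm_num), (adj_weight w h).2.1 (by norm_num),
        zero_smul, zero_smul, zero_add, zero_add]
    exact ⟨w.1 1 0, e.trans (congrArg (w.1 1 0 • ·) (one_smul K (matF : Sl2 K)).symm)⟩
  | 1, 0, w, h, _ => exists_zero _ (adj_zero w h (by norm_num) (by norm_num) (by norm_num))
  | 1, 1, w, h, _ => ⟨w.1 0 0, (adj_mid w h (by norm_num) (by norm_num)).trans
      (congrArg (w.1 0 0 • ·) m112_val.symm)⟩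
  | 1, 2, w, h, _ => exists_zero _ (adj_zero w h (by norm_num) (by norm_num) (by norm_num))
  | 2, 0, w, h, _ => by
    have e : w = w.1 0 1 • matE := by
      conv_lhs => rw [adj_eq w, (adj_weight w h).1 (by norm_num), (adj_weight w h).2.2 (by norm_num),
        zero_smul, zero_smul, zero_add, add_zero]
    exact ⟨w.1 0 1, e.trans (congrArg (w.1 0 1 • ·) (one_smul K (matE : Sl2 K)).symm)⟩
  | 2, 1, w, h, _ => exists_zero _ (adj_zero w h (by norm_num) (by norm_num) (by norm_num))
  | 2, 2, w, h, _ => ⟨w.1 0 0, (adj_mid w h (by norm_num) (by norm_num)).trans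
      (congrArg (w.1 0 0 • ·) m222_val.symm)⟩

lemma exists_weight [CharZero K] (i j : Fin 3) : ∀ (k : Fin 3) (w : IrrSpace K k),
    irrRep K k torus w = ((2 : K) ^ (i : ℕ) * 2⁻¹ ^ (j : ℕ)) • w →
    (i = 0 → j = 0 → irrRep K k (upper 1) w = w) →
    ∃ c : K, w = c • bilin i j k (highVec i) (lowVec j)
  | 0, (w : K), h, _ => exists_weight_zero (K := K) i j w h
  | 1, w, h, _ => exists_weight_one (K := K) i j w h
  | 2, w, h, h' => exists_weight_two (K := K) i j w h h'

lemma exists_morph [CharZero K] {i j k : Fin 3}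
    (f : ((irrRep K i).tprod (irrRep K j)).IntertwiningMap (irrRep K k)) :
    ∃ c : K, f = c • morph i j k := by
  obtain ⟨c, hc⟩ := exists_weight i j k (f (highVec i ⊗ₜ[K] lowVec j))
    (by rw [← intertwining_tmul, torus_highVec, torus_lowVec, TensorProduct.smul_tmul_smul,
          map_smul])
    (by
      rintro rfl rfl
      rw [← intertwining_tmul, upper_highVec]
      rfl)
  refine ⟨c, sub_eq_zero.1 (intertwining_eq_zero _ ?_)⟩
  change f _ - c • morph i j k _ = 0
  rw [morph_tmul, hc, sub_self]

lemma morph_ne_zero [CharZero K] {i j k : Fin 3}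
    (h : (bilin i j k (highVec i) (lowVec j) : IrrSpace K k) ≠ 0) : morph (K := K) i j k ≠ 0 := by
  intro h0
  refine h ?_
  rw [← morph_tmul, h0]
  rfl

lemma matH_ne : (matH : Sl2 K) ≠ 0 := fun h =>
  one_ne_zero (α := K) (congrFun (congrFun (congrArg Subtype.val h) 0) 0)

lemma can_high_ne : (![1, 0] : Fin 2 → K) ≠ 0 := fun h => one_ne_zero (α := K) (congrFun h 0)

lemma can_low_ne : (![0, 1] : Fin 2 → K) ≠ 0 := fun h => one_ne_zero (α := K) (congrFun h 1)

lemma mult_cases [CharZero K] : ∀ i j k : Fin 3, (mult i j k = 0 ∧ morph (K := K) i j k = 0) ∨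
    (mult i j k = 1 ∧ (bilin i j k (highVec i) (lowVec j) : IrrSpace K k) ≠ 0)
  | 0, 0, 0 => Or.inr ⟨rfl, fun h => one_ne_zero (α := K) ((mul_one (1 : K)).symm.trans h)⟩
  | 0, 1, 1 => Or.inr ⟨rfl, fun h => can_low_ne (K := K) ((one_smul K _).symm.trans h)⟩
  | 0, 2, 2 => Or.inr ⟨rfl, fun h => matF_ne (K := K) ((one_smul K _).symm.trans h)⟩
  | 1, 0, 1 => Or.inr ⟨rfl, fun h => can_high_ne (K := K) ((one_smul K _).symm.trans h)⟩
  | 2, 0, 2 => Or.inr ⟨rfl, fun h => matE_ne (K := K) ((one_smul K _).symm.trans h)⟩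
  | 1, 1, 0 => Or.inr ⟨rfl, fun h => one_ne_zero (α := K) (m110_val.symm.trans h)⟩
  | 1, 1, 2 => Or.inr ⟨rfl, fun h => matH_ne (K := K) (m112_val.symm.trans h)⟩
  | 2, 1, 1 => Or.inr ⟨rfl, fun h => can_high_ne (K := K) (m211_val.symm.trans h)⟩
  | 1, 2, 1 => Or.inr ⟨rfl, fun h => can_low_ne (K := K) (m211_val'.symm.trans h)⟩
  | 2, 2, 0 => Or.inr ⟨rfl, fun h => one_ne_zero (α := K) (m220_val.symm.trans h)⟩
  | 2, 2, 2 => Or.inr ⟨rfl, fun h => matH_ne (K := K) (m222_val.symm.trans h)⟩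
  | 0, 0, 1 | 0, 0, 2 | 0, 1, 0 | 0, 1, 2 | 0, 2, 0 | 0, 2, 1 | 1, 0, 0 | 1, 0, 2 | 1, 1, 1
  | 1, 2, 0 | 1, 2, 2 | 2, 0, 0 | 2, 0, 1 | 2, 1, 0 | 2, 1, 2 | 2, 2, 1 =>
    Or.inl ⟨rfl, Representation.IntertwiningMap.ext (TensorProduct.ext' fun x y =>
      morph_tmul _ _ _ x y)⟩

variable (K) in
/-- The partial labeling of `Rep(SL(2, K))` by `V_0 = K`, `V_1 = K²`, `V_2 = 𝔰𝔩(2, K)` and the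
morphisms `m^{i,j,k}`. -/
abbrev sl2Labeling [CharZero K] : PartialLabeling K SL2 where
  Idx := Fin 3
  V := IrrSpace K
  ρ := irrRep K
  irreducible := irrRep_irreducible
  eq_of_equiv := irrRep_eq_of_equiv
  dim := mult
  m i j k _ := morph i j k
  m_linearIndependent i j k := by
    rcases mult_cases (K := K) i j k with ⟨h, _⟩ | ⟨h, h'⟩
    · rw [h]; exact linearIndependent_empty_type
    · rw [h]; exact LinearIndependent.of_subsingleton 0 (morph_ne_zero h')
  m_span i j k := by
    rintro f -
    obtain ⟨c, rfl⟩ := exists_morph f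
    rcases mult_cases (K := K) i j k with ⟨_, h⟩ | ⟨h, _⟩
    · rw [h, smul_zero]; exact zero_mem _
    · exact Submodule.smul_mem _ _ (Submodule.subset_span ⟨⟨0, by omega⟩, rfl⟩)

end labeling

/-! ### The Heisenberg Lie algebra of dimension 3 -/

section heisenberg

variable (K : Type u) [Field K]

local notation "SL2" => Matrix.SpecialLinearGroup (Fin 2) K

/-- The Heisenberg Lie algebra `𝔥` of dimension 3; `((a, b), s)` is `a x₁ + b x₋₁ + s h₀`. -/
def Heis : Type u := (Fin 2 → K) × K

instance : AddCommGroup (Heis K) := inferInstanceAs (AddCommGroup ((Fin 2 → K) × K))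

instance : Module K (Heis K) := inferInstanceAs (Module K ((Fin 2 → K) × K))

instance : FiniteDimensional K (Heis K) := inferInstanceAs (FiniteDimensional K ((Fin 2 → K) × K))

namespace Heis

variable {K} in
/-- The element with given coordinates. -/
def mk (u : Fin 2 → K) (s : K) : Heis K := (u, s)

/-- `x₁` -/
def x₁ : Heis K := mk ![1, 0] 0

/-- `x₋₁` -/
def xm₁ : Heis K := mk ![0, 1] 0

/-- `h₀` -/
def h₀ : Heis K := mk 0 1

/-- `x¹`, the dual basis vector of `x₋₁`. -/
def dx₁ : Dual K (Heis K) := LinearMap.proj 1 ∘ₗ LinearMap.fst K (Fin 2 → K) K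

/-- `x⁻¹`, the dual basis vector of `x₁`. -/
def dxm₁ : Dual K (Heis K) := LinearMap.proj 0 ∘ₗ LinearMap.fst K (Fin 2 → K) K

/-- `h⁰`, the dual basis vector of `h₀`. -/
def dh₀ : Dual K (Heis K) := LinearMap.snd K (Fin 2 → K) K

end Heis

lemma Heis.ext {K : Type u} {x y : Heis K} (h0 : x.1 0 = y.1 0) (h1 : x.1 1 = y.1 1) (h2 : x.2 = y.2) :
    x = y := Prod.ext (funext fun i => by fin_cases i; exacts [h0, h1]) h2

/-- The Lie bracket: `[x₁, x₋₁] = h₀` and `h₀` is central. -/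
instance : Bracket (Heis K) (Heis K) :=
  ⟨fun x y => Heis.mk 0 (x.1 0 * y.1 1 - x.1 1 * y.1 0)⟩

variable {K} in
lemma Heis.bracket_def (x y : Heis K) : ⁅x, y⁆ = Heis.mk 0 (x.1 0 * y.1 1 - x.1 1 * y.1 0) := rfl

instance : LieRing (Heis K) where
  add_lie x y z := by
    refine Heis.ext (add_zero 0).symm (add_zero 0).symm ?_
    change (x.1 0 + y.1 0) * z.1 1 - (x.1 1 + y.1 1) * z.1 0
      = (x.1 0 * z.1 1 - x.1 1 * z.1 0) + (y.1 0 * z.1 1 - y.1 1 * z.1 0)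
    ring
  lie_add x y z := by
    refine Heis.ext (add_zero 0).symm (add_zero 0).symm ?_
    change x.1 0 * (y.1 1 + z.1 1) - x.1 1 * (y.1 0 + z.1 0)
      = (x.1 0 * y.1 1 - x.1 1 * y.1 0) + (x.1 0 * z.1 1 - x.1 1 * z.1 0)
    ring
  lie_self x := by
    refine Heis.ext rfl rfl ?_
    change x.1 0 * x.1 1 - x.1 1 * x.1 0 = 0
    ring
  leibniz_lie x y z := by
    refine Heis.ext (add_zero 0).symm (add_zero 0).symm ?_
    change x.1 0 * 0 - x.1 1 * 0 = (0 * z.1 1 - 0 * z.1 0) + (y.1 0 * 0 - y.1 1 * 0)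
    ring

instance : LieAlgebra K (Heis K) where
  lie_smul r x y := by
    refine Heis.ext (mul_zero r).symm (mul_zero r).symm ?_
    change x.1 0 * (r * y.1 1) - x.1 1 * (r * y.1 0) = r * (x.1 0 * y.1 1 - x.1 1 * y.1 0)
    ring

/-- The action of `SL(2, K)` on `𝔥`: canonical on the span of `x₁`, `x₋₁`, trivial on `h₀`. -/
def heisRep : Representation K SL2 (Heis K) where
  toFun g := LinearMap.prodMap (canonicalRep K g) LinearMap.id
  map_one' := by rw [map_one]; rfl
  map_mul' g h := by rw [map_mul]; rfl

lemma heisRep_lie (g : SL2) (x y : Heis K) :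
    heisRep K g ⁅x, y⁆ = ⁅heisRep K g x, heisRep K g y⁆ := by
  have h1 : ∀ z : Heis K, (heisRep K g z).1 = ![g.1 0 0 * z.1 0 + g.1 0 1 * z.1 1,
      g.1 1 0 * z.1 0 + g.1 1 1 * z.1 1] := fun z => canonicalRep_apply g z.1
  have h2 : ∀ z : Heis K, (heisRep K g z).2 = z.2 := fun z => rfl
  have h0 : (heisRep K g ⁅x, y⁆).1 = 0 := map_zero (canonicalRep K g)
  refine Heis.ext (congrFun h0 0) (congrFun h0 1) ?_
  rw [h2, Heis.bracket_def, Heis.bracket_def, h1 x, h1 y]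
  change x.1 0 * y.1 1 - x.1 1 * y.1 0
    = (g.1 0 0 * x.1 0 + g.1 0 1 * x.1 1) * (g.1 1 0 * y.1 0 + g.1 1 1 * y.1 1)
      - (g.1 1 0 * x.1 0 + g.1 1 1 * x.1 1) * (g.1 0 0 * y.1 0 + g.1 0 1 * y.1 1)
  linear_combination (-(x.1 0 * y.1 1 - x.1 1 * y.1 0)) * det_SL2 g

/-- The even cohomology `H_E^{•,•}(𝔥)`. -/
abbrev HE : Type u := evenCoh K (Heis K)

/-- The action of `SL(2, K)` on `H_E^{•,•}(𝔥)` induced by its action on `𝔥`. -/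
def repHE : Representation K SL2 (HE K) := evenRep (heisRep K) (heisRep_lie K)

/-- The indices of the irreducible components: `Hpq_k` is the index of `H^{p,q}_k`. -/
inductive Component
  | H00_0 | H11_0 | H11_2 | H20_1 | H02_1 | H22_0 | H22_2 | H31_1 | H13_1 | H33_0
  deriving DecidableEq

open Component

instance : Fintype Component :=
  ⟨{H00_0, H11_0, H11_2, H20_1, H02_1, H22_0, H22_2, H31_1, H13_1, H33_0},
    fun r => by cases r <;> decide⟩

/-- The highest weight of the component. -/
def hw : Component → Fin 3
  | H00_0 | H11_0 | H22_0 | H33_0 => 0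
  | H20_1 | H02_1 | H31_1 | H13_1 => 1
  | H11_2 | H22_2 => 2

/-- The cochains that represent the chosen highest weight vectors of the components. -/
def hwCochain : Component → Cochain K (Heis K) :=
  let x₁ := ExteriorAlgebra.ι K (Heis.x₁ K)
  let xm₁ := ExteriorAlgebra.ι K (Heis.xm₁ K)
  let h₀ := ExteriorAlgebra.ι K (Heis.h₀ K)
  let dx₁ := ExteriorAlgebra.ι K (Heis.dx₁ K)
  let dxm₁ := ExteriorAlgebra.ι K (Heis.dxm₁ K)
  let dh₀ := ExteriorAlgebra.ι K (Heis.dh₀ K)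
  fun
  | H00_0 => tens 1 1
  | H20_1 => tens (dx₁ * dh₀) 1
  | H11_0 => tens dx₁ xm₁ + tens dxm₁ x₁ + (2 : K) • tens dh₀ h₀
  | H11_2 => tens dx₁ x₁
  | H31_1 => tens (dxm₁ * dx₁ * dh₀) x₁
  | H02_1 => tens 1 (x₁ * h₀)
  | H22_0 => tens (dxm₁ * dx₁) (x₁ * xm₁)
  | H22_2 => tens (dx₁ * dh₀) (x₁ * h₀)
  | H13_1 => tens dx₁ (x₁ * xm₁ * h₀)
  | H33_0 => tens (dxm₁ * dx₁ * dh₀) (x₁ * xm₁ * h₀)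

/-- The `SL(2, K)`-morphisms `τ_r : V_{hw r} → H_E^{•,•}(𝔥)` send the highest weight vector of
`V_{hw r}` to the cohomology class of the cocycle `hwCochain r`. -/
def SendsHighestWeight
    (τ : ∀ r, (irrRep K (hw r)).IntertwiningMap (repHE K)) : Prop :=
  ∀ r, ∃ h : hwCochain K r ∈ cocycles K (Heis K),
    (τ r (highVec (hw r)) : Cohomology K (Heis K))
      = (coboundaries K (Heis K)).mkQ ⟨hwCochain K r, h⟩

/-- The table: `poissonTable r₁ r₂ s` is the coefficient of `s` in the entry `{r₁, r₂}`. -/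
def poissonTable : Component → Component → Component → K
  | H11_0, H20_1, H20_1 => 3
  | H11_0, H02_1, H02_1 => -3
  | H11_0, H31_1, H31_1 => 3
  | H11_0, H13_1, H13_1 => -3
  | H11_2, H11_2, H11_2 => -1
  | H11_2, H20_1, H20_1 => -1
  | H11_2, H02_1, H02_1 => -1
  | H11_2, H22_2, H22_2 => -1
  | H11_2, H31_1, H31_1 => -1
  | H11_2, H13_1, H13_1 => -1
  | H20_1, H11_0, H20_1 => -3
  | H20_1, H11_2, H20_1 => 1
  | H20_1, H02_1, H11_2 => 1 / 2
  | H20_1, H02_1, H11_0 => -1 / 2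
  | H20_1, H22_0, H31_1 => 1
  | H20_1, H22_2, H31_1 => 1
  | H20_1, H13_1, H22_2 => -1 / 2
  | H20_1, H13_1, H22_0 => -3 / 2
  | H02_1, H11_0, H02_1 => 3
  | H02_1, H11_2, H02_1 => 1
  | H02_1, H20_1, H11_2 => -1 / 2
  | H02_1, H20_1, H11_0 => -1 / 2
  | H02_1, H22_0, H13_1 => 1
  | H02_1, H22_2, H13_1 => -1
  | H02_1, H31_1, H22_2 => -1 / 2
  | H02_1, H31_1, H22_0 => 3 / 2
  | H22_0, H20_1, H31_1 => -1
  | H22_0, H02_1, H13_1 => -1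
  | H22_2, H11_2, H22_2 => -1
  | H22_2, H20_1, H31_1 => -1
  | H22_2, H02_1, H13_1 => 1
  | H31_1, H11_0, H31_1 => -3
  | H31_1, H11_2, H31_1 => 1
  | H31_1, H02_1, H22_2 => 1 / 2
  | H31_1, H02_1, H22_0 => 3 / 2
  | H13_1, H11_0, H13_1 => 3
  | H13_1, H11_2, H13_1 => 1
  | H13_1, H20_1, H22_2 => 1 / 2
  | H13_1, H20_1, H22_0 => -3 / 2
  | _, _, _ => 0

end heisenberg

end LiePoisson

end

noncomputable section

universe u

namespace LiePoisson

open Module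

open scoped TensorProduct

/-! The cochains of `𝔥` form the exterior algebra on six generators, of dimension 64. In terms of
words in these generators, the product, the contractions, the bracket and the differential have
rational structure constants. An identity between finitely many words is therefore a computation
over `ℚ`, which the kernel evaluates and `eval` carries to every field `K` of characteristic zero.
The comparison of cochains is reduced to coefficients of the 64 increasing words (`eval_eq`), and
that of linear maps to their values on these words (`hom_ext`).

For the cohomology, every component gets explicit cocycles that span a copy of `V_k` and transform
correctly under `G` already as cochains (`cochainRep_repMap`). Functionals that vanish on
coboundaries and are dual to these cocycles (`pair_diff`, `pair_cocycle`) show that the classes are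
independent. They exhaust the even cohomology because of a homotopy: on even cochains `id = P + d h
+ h' d`, where `P` projects to the chosen cocycles (`coef_homotopy`, `even_decomposition`). The
ranks are `32 = 18 + 7 + 7`. On an even cocycle the last term vanishes, so the cocycle is
cohomologous to its projection.

For the table, both sides of an entry are equivariant bilinear maps on `V_i × V_j`. The group `G`
generates `V_i ⊗ V_j` from the tensor of a highest and a lowest weight vector: the lower unipotent
matrices fix the lowest weight vector and move the highest one through a spanning set of `V_i`, and
`V_j` is irreducible. Hence one evaluation per pair of components decides the entry
(`equivariant_ext`), and the dual functionals read off its coefficients (`pair_poisson`). In the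
same way a `G`-morphism on `V_k` is determined by the image of the highest weight vector, so that
the morphisms `τ` are unique (`eq_componentMap`). -/

/-! ### Formal combinations of monomials -/

/-- Formal rational combinations of words in the six generators
`x⁻¹, x¹, h⁰, x₁, x₋₁, h₀` of the exterior algebra of `𝔥* ⊕ 𝔥`. -/
abbrev Formal : Type := List (ℚ × List (Fin 6))

/-! ### The basis of the Heisenberg algebra and its dual basis. -/

namespace Heis

variable {K : Type u} [Field K]

@[simp] lemma dxm₁_mk (c : Fin 2 → K) (s : K) : dxm₁ K (mk c s) = c 0 := rfl

@[simp] lemma dx₁_mk (c : Fin 2 → K) (s : K) : dx₁ K (mk c s) = c 1 := rfl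

@[simp] lemma dh₀_mk (c : Fin 2 → K) (s : K) : dh₀ K (mk c s) = s := rfl

@[simp] lemma mk_zero : (mk 0 0 : Heis K) = 0 := rfl

lemma lie_mk (c c' : Fin 2 → K) (s s' : K) :
    ⁅mk c s, mk c' s'⁆ = (c 0 * c' 1 - c 1 * c' 0) • h₀ K := by
  rw [bracket_def]
  exact Heis.ext (mul_zero _).symm (mul_zero _).symm (mul_one _).symm

variable (K) in
/-- The coordinates with respect to `x₁, x₋₁, h₀`. -/
def coordEquiv : Heis K ≃ₗ[K] (Fin 3 → K) where
  toFun x := ![x.1 0, x.1 1, x.2]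
  map_add' x y := by ext i; fin_cases i <;> rfl
  map_smul' r x := by ext i; fin_cases i <;> rfl
  invFun c := mk ![c 0, c 1] (c 2)
  left_inv x := Heis.ext rfl rfl rfl
  right_inv c := by ext i; fin_cases i <;> rfl

variable (K) in
/-- The basis `x₁, x₋₁, h₀` of `𝔥`. -/
def basis : Basis (Fin 3) K (Heis K) := Basis.ofEquivFun (coordEquiv K)

lemma basis_apply : ⇑(basis K) = ![x₁ K, xm₁ K, h₀ K] := by
  ext i : 1
  rw [basis, Basis.coe_ofEquivFun, LinearEquiv.symm_apply_eq]
  ext j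
  fin_cases i <;> fin_cases j <;> simp <;> rfl

lemma basis_coord : (basis K).coord = ![dxm₁ K, dx₁ K, dh₀ K] := by
  ext i : 1
  fin_cases i <;> rfl

end Heis

/-! ### Exterior calculus with words over the rational numbers. -/

namespace Formal

/-- Scalar multiple. -/
def smul (r : ℚ) (a : Formal) : Formal := a.map fun t => (r * t.1, t.2)

/-- Left multiplication by a generator. -/
def cons (i : Fin 6) (a : Formal) : Formal := a.map fun t => (t.1, i :: t.2)

/-- The parity involution. -/
def parity (a : Formal) : Formal := a.map fun t => ((-1) ^ t.2.length * t.1, t.2)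

/-- The product. -/
def mul (a b : Formal) : Formal := a.flatMap fun t => b.map fun s => (t.1 * s.1, t.2 ++ s.2)

/-- The odd derivation of a word along the generator `i`. -/
def contrWord (i : Fin 6) : List (Fin 6) → Formal
  | [] => []
  | j :: l => (if j = i then [(1, l)] else []) ++ smul (-1) (cons j (contrWord i l))

/-- The odd derivation along the generator `i`. -/
def contr (i : Fin 6) (a : Formal) : Formal := a.flatMap fun t => smul t.1 (contrWord i t.2)

/-- The Poisson bracket. -/
def poisson (a b : Formal) : Formal :=
  -- Addition in `Fin 6` is modulo 6, so `i ↦ i + 3` is an involution. It exchanges each of `x⁻¹,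
  -- x¹, h⁰` with the vector `x₁, x₋₁, h₀` to which it is dual.
  (List.finRange 6).flatMap fun i => mul (parity (contr i a)) (contr (i + 3) b)

/-- The coefficient of the word `S`, for a formal combination of words without repetitions. -/
def coef : List (Fin 6) → Formal → ℚ
  | [], a => (a.map fun t => if t.2 = [] then t.1 else 0).sum
  | i :: S, a => coef S (contr i a)

/-- The differential `{x⁻¹ x¹ h₀, -}`. -/
def diff (a : Formal) : Formal := poisson [(1, [0, 1, 5])] a

/-- The pairing of formal combinations that makes the increasing words orthonormal. -/
def pair (f a : Formal) : ℚ := (f.map fun t => t.1 * coef t.2 a).sum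

/-- The product of a generator and an increasing word, as a multiple of an increasing word. -/
def insert (i : Fin 6) : List (Fin 6) → Formal
  | [] => [(1, [i])]
  | j :: l => if i < j then [(1, i :: j :: l)] else if i = j then [] else
      smul (-1) (cons j (insert i l))

/-- The subwords of a word. -/
def subwords : List (Fin 6) → List (List (Fin 6))
  | [] => [[]]
  | i :: l => subwords l ++ (subwords l).map (i :: ·)

/-- The increasing words. -/
def increasing : List (List (Fin 6)) := subwords (List.finRange 6)

/-! ### Evaluation of formal combinations as cochains over `K`. -/

variable (K : Type u) [Field K]

/-- The generators of `𝔥* ⊕ 𝔥`. -/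
def gen : Fin 6 → Dual K (Heis K) × Heis K :=
  ![(Heis.dxm₁ K, 0), (Heis.dx₁ K, 0), (Heis.dh₀ K, 0), (0, Heis.x₁ K), (0, Heis.xm₁ K),
    (0, Heis.h₀ K)]

/-- The product of the generators in a word. -/
def word (l : List (Fin 6)) : Cochain K (Heis K) :=
  (l.map fun i => ExteriorAlgebra.ι K (gen K i)).prod

/-- The value of a formal combination. -/
def eval (a : Formal) : Cochain K (Heis K) := (a.map fun t => (t.1 : K) • word K t.2).sum

/-- The linear form dual to the generator `i`. -/
def genForm (i : Fin 6) : Dual K (Dual K (Heis K) × Heis K) := pairing (gen K (i + 3))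

/-- The functional on cochains that corresponds to `coef`. -/
def coefForm : List (Fin 6) → Cochain K (Heis K) →ₗ[K] K
  | [] => ExteriorAlgebra.algebraMapInv.toLinearMap
  | i :: S => coefForm S ∘ₗ LiePoisson.contr (genForm K i)

/-- The functional on cochains that corresponds to `pair`. -/
def pairForm (f : Formal) : Cochain K (Heis K) →ₗ[K] K :=
  (f.map fun t => (t.1 : K) • coefForm K t.2).sum

variable {K}

@[simp] lemma eval_nil : eval K [] = 0 := rfl

@[simp] lemma eval_cons (t : ℚ × List (Fin 6)) (a : Formal) :
    eval K (t :: a) = (t.1 : K) • word K t.2 + eval K a := by simp [eval]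

@[simp] lemma eval_append (a b : Formal) : eval K (a ++ b) = eval K a + eval K b := by
  simp [eval]

lemma word_cons (i : Fin 6) (l : List (Fin 6)) :
    word K (i :: l) = ExteriorAlgebra.ι K (gen K i) * word K l := by simp [word]

lemma word_append (l l' : List (Fin 6)) : word K (l ++ l') = word K l * word K l' := by
  simp [word]

lemma genForm_gen (i j : Fin 6) : genForm K i (gen K j) = if j = i then 1 else 0 := by
  fin_cases i <;> fin_cases j <;>
    simp [genForm, gen, Heis.x₁, Heis.xm₁, Heis.h₀]

lemma eval_flatMap {α : Type*} (l : List α) (f : α → Formal) :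
    eval K (l.flatMap f) = (l.map fun x => eval K (f x)).sum := by
  induction l with
  | nil => rfl
  | cons x l ih => simp [ih]

lemma eval_cons_gen (i : Fin 6) (a : Formal) :
    eval K (cons i a) = ExteriorAlgebra.ι K (gen K i) * eval K a := by
  induction a with
  | nil => simp [cons]
  | cons t a ih =>
    rw [cons, List.map_cons, eval_cons, ← cons, ih, eval_cons, mul_add, word_cons, mul_smul_comm]

lemma parity_word (l : List (Fin 6)) :
    LiePoisson.parity (word K l) = (-1 : K) ^ l.length • word K l := by
  induction l with
  | nil => simp [word]
  | cons i l ih =>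
    rw [word_cons, map_mul, ih, CliffordAlgebra.involute_ι, List.length_cons, pow_succ]
    simp

lemma eval_mem_span {s : Set (List (Fin 6))} {a : Formal} (h : ∀ t ∈ a, t.2 ∈ s) :
    eval K a ∈ Submodule.span K (word K '' s) := by
  induction a with
  | nil => exact zero_mem _
  | cons t a ih =>
    rw [eval_cons]
    exact add_mem (Submodule.smul_mem _ _ (Submodule.subset_span ⟨_, h t (by simp), rfl⟩))
      (ih fun s hs => h s (by simp [hs]))

lemma eq_sum_gen (w : Dual K (Heis K) × Heis K) : w = ∑ i, genForm K i w • gen K i := by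
  have h := (Heis.basis K).sum_dual_apply_smul_coord w.1
  have h' := (Heis.basis K).sum_repr w.2
  simp only [← Basis.coord_apply, Fin.sum_univ_three, Heis.basis_coord, Heis.basis_apply] at h h'
  rw [Fin.sum_univ_six]
  ext1
  · simpa [genForm, gen] using h.symm
  · simpa [genForm, gen] using h'.symm

lemma word_eq_eval (S : List (Fin 6)) : word K S = eval K [(1, S)] := by simp

lemma coef_nil (S : List (Fin 6)) : coef S [] = 0 := by
  induction S with
  | nil => rfl
  | cons i S ih => exact ih

section charZero

variable [CharZero K]

@[simp] lemma eval_smul (r : ℚ) (a : Formal) : eval K (smul r a) = (r : K) • eval K a := by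
  induction a with
  | nil => simp [smul]
  | cons t a ih =>
    rw [smul, List.map_cons, eval_cons, ← smul, ih, eval_cons, smul_add, smul_smul, Rat.cast_mul]

lemma eval_parity (a : Formal) : eval K (parity a) = LiePoisson.parity (eval K a) := by
  induction a with
  | nil => simp [parity]
  | cons t a ih =>
    rw [parity, List.map_cons, eval_cons, ← parity, ih, eval_cons, map_add, map_smul, parity_word,
      smul_smul]
    push_cast
    rw [mul_comm]

lemma eval_mul (a b : Formal) : eval K (mul a b) = eval K a * eval K b := by
  have h : ∀ (t : ℚ × List (Fin 6)),
      eval K (b.map fun s => (t.1 * s.1, t.2 ++ s.2)) = (t.1 : K) • word K t.2 * eval K b := by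
    intro t
    induction b with
    | nil => simp
    | cons s b ih =>
      rw [List.map_cons, eval_cons, ih, eval_cons, mul_add, word_append]
      simp [smul_smul, mul_comm]
  rw [mul, eval_flatMap]
  simp only [h]
  rw [List.sum_map_mul_right]
  rfl

lemma eval_contrWord (i : Fin 6) (l : List (Fin 6)) :
    eval K (contrWord i l) = LiePoisson.contr (genForm K i) (word K l) := by
  induction l with
  | nil => simp [contrWord, word]
  | cons j l ih =>
    change _ = CliffordAlgebra.contractLeft _ (CliffordAlgebra.ι 0 (gen K j) * word K l)
    rw [contrWord, eval_append, eval_smul, eval_cons_gen, ih, CliffordAlgebra.contractLeft_ι_mul,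
      genForm_gen]
    split <;> simp [sub_eq_add_neg]

lemma eval_contr (i : Fin 6) (a : Formal) :
    eval K (contr i a) = LiePoisson.contr (genForm K i) (eval K a) := by
  induction a with
  | nil => simp [contr]
  | cons t a ih =>
    rw [contr, List.flatMap_cons, eval_append, ← contr, ih, eval_cons, map_add, map_smul,
      eval_smul, eval_contrWord]

/-- Contractions commute with `eval`, and what remains after them is the scalar part. Hence the
coefficients of an evaluated combination are images of rational numbers that can be computed. -/
lemma coefForm_eval (S : List (Fin 6)) (a : Formal) :
    coefForm K S (eval K a) = (coef S a : K) := by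
  induction S generalizing a with
  | nil =>
    induction a with
    | nil => simp [coef]
    | cons t a ih =>
      have h : ∀ l : List (Fin 6), coefForm K [] (word K l) = if l = [] then 1 else 0 := by
        rintro (_ | ⟨i, l⟩)
        · simp [coefForm, word]
        · simp only [coefForm, word_cons, AlgHom.toLinearMap_apply, map_mul]
          simp [ExteriorAlgebra.algebraMapInv]
      rw [eval_cons, map_add, map_smul, ih, h]
      simp only [coef, List.map_cons, List.sum_cons, Rat.cast_add]
      split <;> simp
  | cons i S ih =>
    rw [coefForm, LinearMap.comp_apply, ← eval_contr, ih, coef]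

lemma pairForm_eval (f a : Formal) : pairForm K f (eval K a) = (pair f a : K) := by
  induction f with
  | nil => simp [pairForm, pair]
  | cons t f ih =>
    simp only [pairForm, pair, List.map_cons, List.sum_cons, LinearMap.add_apply,
      LinearMap.smul_apply, Rat.cast_add, Rat.cast_mul, coefForm_eval] at ih ⊢
    rw [ih, smul_eq_mul]

end charZero

/-! ### The bracket, the differential and the basis of increasing words. -/

variable {K : Type u} [Field K] [CharZero K]

/-- The bracket may be computed in any basis of `𝔥` (`poisson_apply`). In the basis `x₁, x₋₁, h₀`
its three summands, with two terms each, are the six terms of the formal bracket. -/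
lemma eval_poisson (a b : Formal) :
    eval K (poisson a b) = LiePoisson.poisson (eval K a) (eval K b) := by
  rw [poisson_apply (Heis.basis K), poisson, eval_flatMap]
  simp only [eval_mul, eval_parity, eval_contr, ← List.ofFn_eq_map, List.sum_ofFn]
  rw [Fin.sum_univ_six, Fin.sum_univ_three, Heis.basis_apply, Heis.basis_coord]
  simp [genForm, gen]
  abel

variable (K) in
-- Only `[x₁, x₋₁]` and `[x₋₁, x₁]` contribute to the double sum. The two terms agree, because the
-- bracket and the product of covectors both change sign, and this cancels the factor `½`.
lemma bracketCochain_heis : bracketCochain K (Heis K) = word K [0, 1, 5] := by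
  have hs : covec (Heis.dx₁ K) * covec (Heis.dxm₁ K)
      = -(covec (Heis.dxm₁ K) * covec (Heis.dx₁ K)) :=
    eq_neg_of_add_eq_zero_left (ExteriorAlgebra.ι_add_mul_swap (R := K) _ _)
  have hw : word K [0, 1, 5] = covec (Heis.dxm₁ K) * covec (Heis.dx₁ K) * vec (Heis.h₀ K) := by
    simp [word, gen, covec, vec, mul_assoc]
  rw [bracketCochain_eq (Heis.basis K), Heis.basis_apply, Heis.basis_coord, hw]
  simp only [Fin.sum_univ_three, Matrix.cons_val_zero, Matrix.cons_val_one, Matrix.cons_val]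
  rw [Heis.x₁, Heis.xm₁, Heis.h₀]
  simp only [Heis.lie_mk, map_smul, mul_smul_comm, hs]
  rw [inv_smul_eq_iff₀ two_ne_zero]
  simp [two_smul, Heis.h₀]

lemma eval_diff (a : Formal) : eval K (diff a) = diffCE K (Heis K) (eval K a) := by
  rw [diff, eval_poisson, diffCE, bracketCochain_heis]
  simp

/-- The new letter moves to its place by anticommutation, with one sign for each letter that it
passes, and the product vanishes if it meets an equal letter. This is what makes the span of the
increasing words stable under left multiplication. -/
lemma eval_insert (i : Fin 6) (l : List (Fin 6)) :
    eval K (insert i l) = ExteriorAlgebra.ι K (gen K i) * word K l := by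
  induction l with
  | nil => simp [insert, word]
  | cons j l ih =>
    rw [insert]
    split
    · simp [word_cons]
    split
    · subst i
      rw [word_cons, ← mul_assoc, ExteriorAlgebra.ι_sq_zero, zero_mul, eval_nil]
    · rw [eval_smul, eval_cons_gen, ih, word_cons, ← mul_assoc, ← mul_assoc,
        eq_neg_of_add_eq_zero_left (ExteriorAlgebra.ι_add_mul_swap (R := K) (gen K i) (gen K j))]
      simp

lemma insert_increasing : ∀ i, ∀ S ∈ increasing, ∀ t ∈ insert i S, t.2 ∈ increasing := by
  decide +kernel

lemma span_word : Submodule.span K (word K '' {S | S ∈ increasing}) = ⊤ := by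
  rw [eq_top_iff]
  rintro x -
  induction x using CliffordAlgebra.left_induction with
  | algebraMap r =>
    have : algebraMap K (Cochain K (Heis K)) r = r • word K [] := by
      simp [word, Algebra.algebraMap_eq_smul_one]
    rw [this]
    exact Submodule.smul_mem _ _ (Submodule.subset_span ⟨_, by decide +kernel, rfl⟩)
  | add x y hx hy => exact add_mem hx hy
  | ι_mul x w hx =>
    change ExteriorAlgebra.ι K w * x ∈ _
    rw [eq_sum_gen w, map_sum, Finset.sum_mul]
    refine sum_mem fun i _ => ?_
    rw [map_smul, smul_mul_assoc]
    refine Submodule.smul_mem _ _ ?_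
    -- The span contains the empty word, so stability under left multiplication by the generators
    -- makes it everything.
    have : Submodule.span K (word K '' {S | S ∈ increasing})
        ≤ (Submodule.span K (word K '' {S | S ∈ increasing})).comap
          (LinearMap.mulLeft K (ExteriorAlgebra.ι K (gen K i))) := by
      rw [Submodule.span_le]
      rintro _ ⟨S, hS, rfl⟩
      rw [SetLike.mem_coe, Submodule.mem_comap, LinearMap.mulLeft_apply]
      rw [← eval_insert]
      exact eval_mem_span (insert_increasing i S hS)
    exact this hx

/-- Linear maps that agree on increasing words are equal. -/
lemma hom_ext {M : Type*} [AddCommGroup M] [Module K M] {f g : Cochain K (Heis K) →ₗ[K] M}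
    (h : ∀ S ∈ increasing, f (word K S) = g (word K S)) : f = g :=
  LinearMap.ext_on span_word (by rintro _ ⟨S, hS, rfl⟩; exact h S hS)

/-- The letters of `S` are contracted from the left, so each is removed from the front of the
remaining word and no sign arises. A different increasing word lacks one of the letters or keeps
another one, which has no scalar part. -/
lemma coef_increasing : ∀ S ∈ increasing, ∀ S' ∈ increasing,
    coef S [(1, S')] = if S = S' then 1 else 0 := by
  decide +kernel

/-- Formal combinations have no normal form, so cochains are compared through these functionals,
which separate points. -/
lemma eq_zero_of_coefForm {x : Cochain K (Heis K)} (h : ∀ S ∈ increasing, coefForm K S x = 0) :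
    x = 0 := by
  -- The resolution of the identity that belongs to the dual systems of coefficient functionals and
  -- increasing words.
  have key : ∑ S ∈ increasing.toFinset, (coefForm K S).smulRight (word K S)
      = LinearMap.id := by
    refine hom_ext fun S' hS' => ?_
    rw [LinearMap.sum_apply, Finset.sum_eq_single_of_mem S' (by simpa using hS')]
    · rw [LinearMap.smulRight_apply, word_eq_eval S', coefForm_eval, coef_increasing S' hS' S' hS',
        if_pos rfl, Rat.cast_one, one_smul, LinearMap.id_apply]
    · intro S hS hne
      rw [LinearMap.smulRight_apply, word_eq_eval S', coefForm_eval,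
        coef_increasing S (by simpa using hS) S' hS', if_neg hne, Rat.cast_zero, zero_smul]
  rw [← LinearMap.id_apply (R := K) x, ← key, LinearMap.sum_apply]
  refine Finset.sum_eq_zero fun S hS => ?_
  rw [LinearMap.smulRight_apply, h S (by simpa using hS), zero_smul]

/-- Equality of values of formal combinations. -/
lemma eval_eq {a b : Formal} (h : ∀ S ∈ increasing, coef S a = coef S b) :
    eval K a = eval K b := by
  refine sub_eq_zero.1 (eq_zero_of_coefForm fun S hS => ?_)
  rw [map_sub, coefForm_eval, coefForm_eval, h S hS, sub_self]

end Formal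

/-! ### Coordinates on the irreducible representations -/

section coordinates

variable (K : Type u) [Field K]

/-- The vector of `V_i` with given coordinates: `c 0`, `(c 0, c 1)` or `(c 0 c 1; c 2 -c 0)`. -/
def ofCoords : ∀ i : Fin 3, (Fin 3 → K) →ₗ[K] IrrSpace K i
  | 0 => LinearMap.proj 0
  | 1 => LinearMap.pi ![LinearMap.proj 0, LinearMap.proj 1]
  | 2 => sl2Equiv.symm.toLinearMap

/-- The coordinates of a vector of `V_i`, extended by zeros. -/
def coords : ∀ i : Fin 3, IrrSpace K i →ₗ[K] (Fin 3 → K)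
  | 0 => LinearMap.pi ![LinearMap.id, 0, 0]
  | 1 => LinearMap.pi ![LinearMap.proj 0, LinearMap.proj 1, 0]
  | 2 => sl2Equiv.toLinearMap

variable {K}

lemma ofCoords_coords : ∀ (i : Fin 3) (x : IrrSpace K i), ofCoords K i (coords K i x) = x
  | 0, _ => rfl
  | 1, x => by
    refine funext fun j => ?_
    fin_cases j <;> rfl
  | 2, x => sl2Equiv.symm_apply_apply x

lemma coords_zero_apply (x : K) : coords K 0 x = ![x, 0, 0] := by
  ext i; fin_cases i <;> rfl

lemma coords_one_apply (x : Fin 2 → K) : coords K 1 x = ![x 0, x 1, 0] := by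
  ext i; fin_cases i <;> rfl

lemma coords_two_apply (A : Sl2 K) : coords K 2 A = ![A.1 0 0, A.1 0 1, A.1 1 0] := by
  ext i; fin_cases i <;> rfl

/-! ### Rational coordinates of weight vectors and of their products. -/

/-- The coordinates of `highVec i`. -/
def highCoords : Fin 3 → Fin 3 → ℚ := ![![1, 0, 0], ![1, 0, 0], ![0, 1, 0]]

/-- The coordinates of `lowVec i`. -/
def lowCoords : Fin 3 → Fin 3 → ℚ := ![![1, 0, 0], ![0, 1, 0], ![0, 0, 1]]

/-- The coordinates of `bilin i j k (highVec i) (lowVec j)`. -/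
def bilinCoords : Fin 3 → Fin 3 → Fin 3 → Fin 3 → ℚ
  | 0, 0, 0 => ![1, 0, 0]
  | 0, 1, 1 => ![0, 1, 0]
  | 0, 2, 2 => ![0, 0, 1]
  | 1, 0, 1 => ![1, 0, 0]
  | 2, 0, 2 => ![0, 1, 0]
  | 1, 1, 0 => ![1, 0, 0]
  | 1, 1, 2 => ![1, 0, 0]
  | 2, 1, 1 => ![1, 0, 0]
  | 1, 2, 1 => ![0, 1, 0]
  | 2, 2, 0 => ![1, 0, 0]
  | 2, 2, 2 => ![1, 0, 0]
  | _, _, _ => 0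

lemma coords_highVec : ∀ i k, coords K i (highVec i) k = (highCoords i k : K)
  | 0, k => (congrFun (coords_zero_apply (K := K) 1) k).trans (by
      fin_cases k <;> simp [highCoords])
  | 1, k => by fin_cases k <;> simp [highVec, coords_one_apply, highCoords]
  | 2, k => by fin_cases k <;> simp [highVec, coords_two_apply, highCoords, matE_val]

lemma coords_lowVec : ∀ i k, coords K i (lowVec i) k = (lowCoords i k : K)
  | 0, k => (congrFun (coords_zero_apply (K := K) 1) k).trans (by
      fin_cases k <;> simp [lowCoords])
  | 1, k => by fin_cases k <;> simp [lowVec, coords_one_apply, lowCoords]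
  | 2, k => by fin_cases k <;> simp [lowVec, coords_two_apply, lowCoords, matF_val]

lemma coords_matH (k : Fin 3) : coords K 2 matH k = ((![1, 0, 0] : Fin 3 → ℚ) k : K) := by
  fin_cases k <;> simp [coords_two_apply, matH_val]

lemma coords_bilin : ∀ i j k l,
    coords K k (bilin i j k (highVec i) (lowVec j)) l = (bilinCoords i j k l : K)
  | 0, 0, 0, l => (congrArg (coords K 0 · l) (one_smul K (1 : K))).trans (coords_highVec 0 l)
  | 0, 1, 1, l => (congrArg (coords K 1 · l) (one_smul K (![0, 1] : Fin 2 → K))).trans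
      (coords_lowVec 1 l)
  | 0, 2, 2, l => (congrArg (coords K 2 · l) (one_smul K (matF : Sl2 K))).trans (coords_lowVec 2 l)
  | 1, 0, 1, l => (congrArg (coords K 1 · l) (one_smul K (![1, 0] : Fin 2 → K))).trans
      (coords_highVec 1 l)
  | 2, 0, 2, l => (congrArg (coords K 2 · l) (one_smul K (matE : Sl2 K))).trans (coords_highVec 2 l)
  | 1, 1, 0, l => (congrArg (coords K 0 · l) (m110_val (K := K))).trans (coords_highVec 0 l)
  | 1, 1, 2, l => (congrArg (coords K 2 · l) m112_val).trans (coords_matH l)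
  | 2, 1, 1, l => (congrArg (coords K 1 · l) m211_val).trans (coords_highVec 1 l)
  | 1, 2, 1, l => (congrArg (coords K 1 · l) m211_val').trans (coords_lowVec 1 l)
  | 2, 2, 0, l => (congrArg (coords K 0 · l) (m220_val (K := K))).trans (coords_highVec 0 l)
  | 2, 2, 2, l => (congrArg (coords K 2 · l) m222_val).trans (coords_matH l)
  | 0, 0, 1, l | 0, 0, 2, l | 0, 1, 0, l | 0, 1, 2, l | 0, 2, 0, l | 0, 2, 1, l | 1, 0, 0, l
  | 1, 0, 2, l | 1, 1, 1, l | 1, 2, 0, l | 1, 2, 2, l | 2, 0, 0, l | 2, 0, 1, l | 2, 1, 0, l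
  | 2, 1, 2, l | 2, 2, 1, l =>
    (congrFun (map_zero (coords K _)) l).trans Rat.cast_zero.symm

end coordinates

/-! ### Representatives of the cohomology classes -/

namespace Formal

open Component

/-- The cocycles that represent the images of the coordinate vectors of `V_{hw r}`. -/
def cocycle : Component → Fin 3 → Formal
  | H00_0 => ![[(1, [])], [], []]
  | H11_0 => ![[(1, [0, 3]), (1, [1, 4]), (2, [2, 5])], [], []]
  -- The coordinate vectors of `𝔰𝔩(2)` are `matH`, `matE`, `matF`. The matrix `(1 0; t 1)` sends
  -- `matE` to `matE - t matH - t² matF`, and it sends `x¹ x₁` to `(x¹ - t x⁻¹)(x₁ + t x₋₁)`;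
  -- comparing powers of `t` gives the three cocycles.
  | H11_2 => ![[(1, [0, 3]), (-1, [1, 4])], [(1, [1, 3])], [(1, [0, 4])]]
  -- The sign is that of the isomorphism of `K²` with its dual: `x¹, -x⁻¹` transform like `x₁, x₋₁`.
  | H20_1 => ![[(1, [1, 2])], [(-1, [0, 2])], []]
  | H02_1 => ![[(1, [3, 5])], [(1, [4, 5])], []]
  | H22_0 => ![[(1, [0, 1, 3, 4])], [], []]
  | H22_2 => ![[(1, [0, 2, 3, 5]), (-1, [1, 2, 4, 5])], [(1, [1, 2, 3, 5])], [(1, [0, 2, 4, 5])]]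
  | H31_1 => ![[(1, [0, 1, 2, 3])], [(1, [0, 1, 2, 4])], []]
  | H13_1 => ![[(1, [1, 3, 4, 5])], [(-1, [0, 3, 4, 5])], []]
  | H33_0 => ![[(1, [0, 1, 2, 3, 4, 5])], [], []]

/-- Functionals on the even cochains that vanish on coboundaries, dual to `cocycle`. -/
def dualForm : Component → Fin 3 → Formal
  | H00_0 => ![[(1, [])], [], []]
  | H11_0 => ![[(1/2, [2, 5])], [], []]
  -- On cocycles the coefficient of `h⁰ h₀` is the sum of those of `x⁻¹ x₁` and `x¹ x₋₁`. The first
  -- functional is therefore half their difference there, and it is written without `[0, 3]`, since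
  -- the dual functionals have to vanish on the words that occur as values in `homotopyOdd`.
  | H11_2 => ![[(-1, [1, 4]), (1/2, [2, 5])], [(1, [1, 3])], [(1, [0, 4])]]
  | H20_1 => ![[(1, [1, 2])], [(-1, [0, 2])], []]
  | H02_1 => ![[(1, [3, 5])], [(1, [4, 5])], []]
  -- The halves compensate the coboundary `d(h⁰ x₁ x₋₁)`, which is `[0, 1, 3, 4] - [0, 2, 3, 5] -
  -- [1, 2, 4, 5]`.
  | H22_0 => ![[(1, [0, 1, 3, 4]), (1/2, [0, 2, 3, 5]), (1/2, [1, 2, 4, 5])], [], []]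
  | H22_2 => ![[(1/2, [0, 2, 3, 5]), (-1/2, [1, 2, 4, 5])], [(1, [1, 2, 3, 5])],
      [(1, [0, 2, 4, 5])]]
  | H31_1 => ![[(1, [0, 1, 2, 3])], [(1, [0, 1, 2, 4])], []]
  | H13_1 => ![[(1, [1, 3, 4, 5])], [(-1, [0, 3, 4, 5])], []]
  | H33_0 => ![[(1, [0, 1, 2, 3, 4, 5])], [], []]

/-- A contracting homotopy on the even cochains, as a sum of operators of rank one. -/
def homotopyEven : List (Formal × List (Fin 6)) :=
  -- The differentials of the seven words on the right are a basis of the even coboundaries, and the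
  -- functionals are dual to these differentials. For instance, `d h⁰ = x⁻¹ x¹` gives the first
  -- entry.
  [([(1, [0, 1])], [2]), ([(1, [1, 5])], [3]), ([(-1, [0, 5])], [4]),
    ([(-1, [0, 1, 2, 5])], [0, 2, 3]), ([(1, [0, 1, 4, 5])], [0, 3, 4]),
    ([(-1, [0, 1, 3, 5])], [1, 3, 4]),
    ([(-1/2, [0, 2, 3, 5]), (-1/2, [1, 2, 4, 5])], [2, 3, 4])]

/-- A contracting homotopy on the odd cochains, as a sum of operators of rank one. -/
def homotopyOdd : List (Formal × List (Fin 6)) :=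
  -- The seven words on the right span a complement of the cocycles in the even cochains, and the
  -- functionals are dual to their differentials.
  [([(-1, [0, 1, 5])], [0, 3]), ([(1, [1, 2, 5])], [2, 3]), ([(-1, [0, 2, 5])], [2, 4]),
    ([(-1, [1, 4, 5])], [3, 4]), ([(1, [0, 1, 2, 4, 5])], [0, 2, 3, 4]),
    ([(-1, [0, 1, 2, 3, 5])], [1, 2, 3, 4]), ([(1, [0, 1, 3, 4, 5])], [2, 3, 4, 5])]

/-- A sum of operators of rank one. -/
def applyRankOne (h : List (Formal × List (Fin 6))) (a : Formal) : Formal :=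
  h.map fun t => (pair t.1 a, t.2)

/-- All components. -/
def components : List Component :=
  [H00_0, H11_0, H11_2, H20_1, H02_1, H22_0, H22_2, H31_1, H13_1, H33_0]

/-- The projection to the span of the `cocycle`s. -/
def project (a : Formal) : Formal :=
  components.flatMap fun r => (List.finRange 3).flatMap fun k =>
    smul (pair (dualForm r k) a) (cocycle r k)

/-! ### The finite verifications over the rational numbers. -/

lemma coef_diff_cocycle : ∀ r k, ∀ S ∈ increasing, coef S (diff (cocycle r k)) = 0 := by
  decide +kernel

/-- This duality gives the independence of the components. The condition `k ≤ hw r` accounts for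
`dim V_i = i + 1`: the lists beyond it are empty. -/
lemma pair_cocycle : ∀ r k s l, pair (dualForm s l) (cocycle r k)
    = if r = s ∧ k = l ∧ k ≤ hw r then 1 else 0 := by
  decide +kernel

/-- This lets the dual functionals descend to cohomology. -/
lemma pair_diff : ∀ r k, ∀ S ∈ increasing, pair (dualForm r k) (diff [(1, S)]) = 0 := by
  decide +kernel

/-- The completeness of the list of components rests on this identity: the even cochains are the sum
of the chosen cocycles, of coboundaries and of a complement on which `d` is injective. -/
lemma coef_homotopy : ∀ S ∈ increasing, Even S.length → ∀ S' ∈ increasing,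
    coef S' [(1, S)] = coef S' (project [(1, S)] ++ (diff (applyRankOne homotopyEven [(1, S)])
      ++ applyRankOne homotopyOdd (diff [(1, S)]))) := by
  decide +kernel

/-- The combination of `cocycle r k` with given coordinates. -/
def combine (r : Component) (c : Fin 3 → ℚ) : Formal :=
  (List.finRange 3).flatMap fun k => smul (c k) (cocycle r k)

/-- All entries of the table are computed here. The bracket of two representatives need not lie in
the span of the chosen cocycles, but a coboundary that it contains is invisible to `dualForm`. -/
lemma pair_poisson : ∀ r₁ r₂ s k,
    pair (dualForm s k) (poisson (combine r₁ (highCoords (hw r₁))) (combine r₂ (lowCoords (hw r₂))))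
      = poissonTable ℚ r₁ r₂ s * bilinCoords (hw r₁) (hw r₂) (hw s) k := by
  decide +kernel

end Formal

open Component Formal

/-! ### The splitting of the even cochains. -/

section decomposition

variable {K : Type u} [Field K]

lemma coords_eq_zero : ∀ (i : Fin 3) (x : IrrSpace K i) (k : Fin 3), i < k → coords K i x k = 0
  | 0, x, k, h => by fin_cases k <;> first | rfl | simp at h
  | 1, x, k, h => by fin_cases k <;> first | rfl | simp at h
  | 2, x, k, h => by fin_cases k <;> simp at h

variable (K) in
/-- The linear map `V_{hw r} → C` to cocycles that represent the component `r`. -/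
def repMap (r : Component) : IrrSpace K (hw r) →ₗ[K] Cochain K (Heis K) :=
  ∑ k, (LinearMap.proj k ∘ₗ coords K (hw r)).smulRight (eval K (cocycle r k))

lemma repMap_apply (r : Component) (x : IrrSpace K (hw r)) :
    repMap K r x = ∑ k, coords K (hw r) x k • eval K (cocycle r k) := by
  simp [repMap]

variable (K) in
/-- The linear map `C → V_{hw r}` that is inverse to `repMap K r` on the component `r`. -/
def coordMap (r : Component) : Cochain K (Heis K) →ₗ[K] IrrSpace K (hw r) :=
  ofCoords K (hw r) ∘ₗ LinearMap.pi fun k => pairForm K (dualForm r k)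

/-- The coordinates that `ofCoords` discards are multiplied by the value of an empty list, so they
do not contribute to the sum either. -/
lemma repMap_ofCoords (r : Component) (c : Fin 3 → K) :
    repMap K r (ofCoords K (hw r) c) = ∑ k, c k • eval K (cocycle r k) := by
  rw [repMap_apply]
  refine Finset.sum_congr rfl fun k _ => ?_
  cases r <;> fin_cases k <;> first | rfl | simp [cocycle]

variable [CharZero K]

lemma diffCE_repMap (r : Component) (x : IrrSpace K (hw r)) :
    diffCE K (Heis K) (repMap K r x) = 0 := by
  rw [repMap_apply, map_sum]
  refine Finset.sum_eq_zero fun k _ => ?_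
  rw [map_smul, ← eval_diff, eval_eq (b := []) fun S hS => ?_, eval_nil, smul_zero]
  rw [coef_diff_cocycle r k S hS]
  exact (coef_nil S).symm

lemma coordMap_diffCE (r : Component) (x : Cochain K (Heis K)) :
    coordMap K r (diffCE K (Heis K) x) = 0 := by
  have h : ∀ k, pairForm K (dualForm r k) ∘ₗ diffCE K (Heis K) = 0 := fun k =>
    hom_ext fun S hS => by
      rw [LinearMap.comp_apply, word_eq_eval, ← eval_diff, pairForm_eval, pair_diff r k S hS,
        Rat.cast_zero, LinearMap.zero_apply]
  rw [coordMap, LinearMap.comp_apply]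
  convert map_zero (ofCoords K (hw r))
  ext k
  exact LinearMap.congr_fun (h k) x

lemma pairForm_repMap (r s : Component) (x : IrrSpace K (hw r)) (l : Fin 3) :
    pairForm K (dualForm s l) (repMap K r x) = if r = s then coords K (hw r) x l else 0 := by
  have h : ∀ k, pairForm K (dualForm s l) (coords K (hw r) x k • eval K (cocycle r k))
      = if k = l then (if r = s then coords K (hw r) x k else 0) else 0 := by
    intro k
    rw [map_smul, pairForm_eval, pair_cocycle]
    by_cases hk : k ≤ hw r
    · by_cases hr : r = s
      · subst hr
        by_cases hl : k = l
        · subst hl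
          simp [hk]
        · simp [hl]
      · simp [hr]
    · rw [coords_eq_zero _ _ _ (not_le.1 hk)]
      simp
  rw [repMap_apply, map_sum]
  simp only [h, Finset.sum_ite_eq', Finset.mem_univ, if_true]

lemma coordMap_repMap (r : Component) (x : IrrSpace K (hw r)) :
    coordMap K r (repMap K r x) = x := by
  conv_rhs => rw [← ofCoords_coords (hw r) x]
  rw [coordMap, LinearMap.comp_apply]
  congr 1
  ext l
  rw [LinearMap.pi_apply, pairForm_repMap, if_pos rfl]

lemma coordMap_repMap_of_ne {r s : Component} (h : r ≠ s) (x : IrrSpace K (hw r)) :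
    coordMap K s (repMap K r x) = 0 := by
  rw [coordMap, LinearMap.comp_apply]
  convert map_zero (ofCoords K (hw s))
  ext l
  rw [LinearMap.pi_apply, pairForm_repMap, if_neg h, Pi.zero_apply]

variable (K) in
/-- A sum of operators of rank one on the cochains. -/
def rankOne (h : List (Formal × List (Fin 6))) : Cochain K (Heis K) →ₗ[K] Cochain K (Heis K) :=
  (h.map fun t => (pairForm K t.1).smulRight (word K t.2)).sum

lemma eval_applyRankOne (h : List (Formal × List (Fin 6))) (a : Formal) :
    eval K (applyRankOne h a) = rankOne K h (eval K a) := by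
  induction h with
  | nil => simp [applyRankOne, rankOne]
  | cons t h ih =>
    simp only [applyRankOne, rankOne, List.map_cons, List.sum_cons, LinearMap.add_apply,
      LinearMap.smulRight_apply, eval_cons, pairForm_eval] at ih ⊢
    rw [ih]

lemma sum_components {M : Type*} [AddCommMonoid M] (f : Component → M) :
    (components.map f).sum = ∑ r, f r := by
  rw [← List.sum_toFinset f (by decide)]
  rfl

lemma eval_project (a : Formal) :
    eval K (project a) = ∑ r, repMap K r (coordMap K r (eval K a)) := by
  rw [project, eval_flatMap, sum_components]
  refine Finset.sum_congr rfl fun r _ => ?_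
  rw [coordMap, LinearMap.comp_apply, repMap_ofCoords, eval_flatMap, ← List.ofFn_eq_map,
    List.sum_ofFn]
  refine Finset.sum_congr rfl fun k _ => ?_
  rw [eval_smul, LinearMap.pi_apply, pairForm_eval]

/-- Even cochains split into representatives of the components and exact terms. -/
lemma even_decomposition {x : Cochain K (Heis K)} (hx : parity x = x) :
    x = ∑ r, repMap K r (coordMap K r x) + (diffCE K (Heis K) (rankOne K homotopyEven x)
      + rankOne K homotopyOdd (diffCE K (Heis K) x)) := by
  let R : Cochain K (Heis K) →ₗ[K] Cochain K (Heis K) :=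
    ∑ r, repMap K r ∘ₗ coordMap K r + (diffCE K (Heis K) ∘ₗ rankOne K homotopyEven
      + rankOne K homotopyOdd ∘ₗ diffCE K (Heis K))
  have hR : ∀ y, R y = ∑ r, repMap K r (coordMap K r y)
      + (diffCE K (Heis K) (rankOne K homotopyEven y)
      + rankOne K homotopyOdd (diffCE K (Heis K) y)) := fun y => by simp [R]
  -- The second factor kills odd words and doubles even ones. So the identity on even words becomes
  -- an identity of maps on all cochains, for which the values on words suffice.
  have key : (LinearMap.id - R) ∘ₗ (LinearMap.id + parity.toLinearMap) = 0 := by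
    refine hom_ext fun S hS => ?_
    have h1 : (LinearMap.id + parity.toLinearMap : Cochain K (Heis K) →ₗ[K] _) (word K S)
        = (1 + (-1 : K) ^ S.length) • word K S := by
      rw [LinearMap.add_apply, AlgHom.toLinearMap_apply, parity_word, add_smul, one_smul,
        LinearMap.id_apply]
    rw [LinearMap.comp_apply, h1, map_smul, LinearMap.zero_apply]
    rcases Nat.even_or_odd S.length with h | h
    · have := eval_eq (K := K) (coef_homotopy S hS h)
      rw [eval_append, eval_append, eval_project, eval_diff, eval_applyRankOne,
        eval_applyRankOne, eval_diff, ← word_eq_eval, ← hR] at this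
      rw [LinearMap.sub_apply, ← this, LinearMap.id_apply, sub_self, smul_zero]
    · rw [h.neg_one_pow, add_neg_cancel, zero_smul]
  have h2 := LinearMap.congr_fun key x
  rw [LinearMap.comp_apply, LinearMap.add_apply, AlgHom.toLinearMap_apply, hx,
    LinearMap.id_apply, ← two_smul K x, map_smul, LinearMap.zero_apply,
    smul_eq_zero_iff_right two_ne_zero, LinearMap.sub_apply, LinearMap.id_apply, sub_eq_zero,
    hR] at h2
  exact h2

end decomposition

/-! ### Bidegrees and equivariance of the representatives. -/

/-- The bidegree of the component. -/
def degree : Component → ℕ × ℕ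
  | H00_0 => (0, 0)
  | H11_0 | H11_2 => (1, 1)
  | H20_1 => (2, 0)
  | H02_1 => (0, 2)
  | H22_0 | H22_2 => (2, 2)
  | H31_1 => (3, 1)
  | H13_1 => (1, 3)
  | H33_0 => (3, 3)

section equivariance

variable {K : Type u} [Field K]

local notation "SL2" => Matrix.SpecialLinearGroup (Fin 2) K

lemma word_mem_bideg (l : List (Fin 6)) :
    word K l ∈ bideg K (Heis K) (l.countP (· < 3)) (l.countP (3 ≤ ·)) := by
  induction l with
  | nil =>
    rw [bideg_eq]
    simp [word]
  | cons i l ih =>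
    rw [word_cons, List.countP_cons, List.countP_cons, add_comm, add_comm _ (ite _ _ _)]
    refine mul_bideg ?_ ih
    rw [bideg_eq]
    fin_cases i
    · simpa [gen] using ⟨Heis.dxm₁ K, rfl⟩
    · simpa [gen] using ⟨Heis.dx₁ K, rfl⟩
    · simpa [gen] using ⟨Heis.dh₀ K, rfl⟩
    · simpa [gen] using ⟨Heis.x₁ K, rfl⟩
    · simpa [gen] using ⟨Heis.xm₁ K, rfl⟩
    · simpa [gen] using ⟨Heis.h₀ K, rfl⟩

lemma degree_cocycle : ∀ r k, ∀ t ∈ cocycle r k, t.2.countP (· < 3) = (degree r).1 ∧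
    t.2.countP (3 ≤ ·) = (degree r).2 := by
  decide +kernel

lemma even_degree : ∀ r, Even ((degree r).1 + (degree r).2) := by decide

lemma repMap_mem_bideg (r : Component) (x : IrrSpace K (hw r)) :
    repMap K r x ∈ bideg K (Heis K) (degree r).1 (degree r).2 := by
  rw [repMap_apply]
  refine sum_mem fun k _ => Submodule.smul_mem _ _ (list_sum_mem fun y hy => ?_)
  obtain ⟨t, ht, rfl⟩ := List.mem_map.1 hy
  have := degree_cocycle r k t ht
  rw [← this.1, ← this.2]
  exact Submodule.smul_mem _ _ (word_mem_bideg t.2)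

lemma heisRep_mk (g : SL2) (c : Fin 2 → K) (s : K) : heisRep K g (Heis.mk c s)
    = Heis.mk ![g.1 0 0 * c 0 + g.1 0 1 * c 1, g.1 1 0 * c 0 + g.1 1 1 * c 1] s :=
  congrArg (Heis.mk · s) (canonicalRep_apply g c)

lemma heisRep_dual_apply (g : SL2) (φ : Dual K (Heis K)) (c : Fin 2 → K) (s : K) :
    (heisRep K).dual g φ (Heis.mk c s) = φ (Heis.mk ![g.1 1 1 * c 0 - g.1 0 1 * c 1,
      -g.1 1 0 * c 0 + g.1 0 0 * c 1] s) := by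
  -- The contragredient action is composition with `g⁻¹`, whose entries come from the adjugate
  -- because `det g = 1`.
  change φ (heisRep K g⁻¹ _) = _
  rw [heisRep_mk, coe_inv_SL2]
  simp [sub_eq_add_neg]

lemma cochainRep_ι (g : SL2) (w : Dual K (Heis K) × Heis K) :
    cochainRep (heisRep K) g (ExteriorAlgebra.ι K w)
      = ExteriorAlgebra.ι K ((heisRep K).dual g w.1, heisRep K g w.2) :=
  ExteriorAlgebra.map_apply_ι _ w

lemma heis_smul_mk (r : K) (c : Fin 2 → K) (s : K) :
    r • Heis.mk c s = Heis.mk (r • c) (r * s) := rfl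

lemma heis_mk_add_mk (c c' : Fin 2 → K) (s s' : K) :
    Heis.mk c s + Heis.mk c' s' = Heis.mk (c + c') (s + s') := rfl

lemma cochainRep_gen (g : SL2) (i : Fin 6) :
    cochainRep (heisRep K) g (ExteriorAlgebra.ι K (gen K i)) =
      (![g.1 1 1 • ExteriorAlgebra.ι K (gen K 0) - g.1 0 1 • ExteriorAlgebra.ι K (gen K 1),
        -g.1 1 0 • ExteriorAlgebra.ι K (gen K 0) + g.1 0 0 • ExteriorAlgebra.ι K (gen K 1),
        ExteriorAlgebra.ι K (gen K 2),
        g.1 0 0 • ExteriorAlgebra.ι K (gen K 3) + g.1 1 0 • ExteriorAlgebra.ι K (gen K 4),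
        g.1 0 1 • ExteriorAlgebra.ι K (gen K 3) + g.1 1 1 • ExteriorAlgebra.ι K (gen K 4),
        ExteriorAlgebra.ι K (gen K 5)] : Fin 6 → Cochain K (Heis K)) i := by
  rw [cochainRep_ι]
  have hd : ∀ (φ ψ : Dual K (Heis K)), (∀ c s, (heisRep K).dual g φ (Heis.mk c s)
      = ψ (Heis.mk c s)) → (heisRep K).dual g φ = ψ :=
    fun φ ψ h => LinearMap.ext fun x => h x.1 x.2
  fin_cases i
  · simp only [gen, ← map_smul, ← map_sub]
    congr 1
    refine Prod.ext (hd _ _ fun c s => ?_) (by simp)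
    rw [heisRep_dual_apply]
    simp
  · simp only [gen, ← map_smul, ← map_add]
    congr 1
    refine Prod.ext (hd _ _ fun c s => ?_) (by simp)
    rw [heisRep_dual_apply]
    simp
  · simp only [gen]
    congr 1
    refine Prod.ext (hd _ _ fun c s => ?_) (by simp)
    rw [heisRep_dual_apply]
    simp
  · simp only [gen, ← map_smul, ← map_add]
    congr 1
    refine Prod.ext (by simp) ?_
    simp [Heis.x₁, Heis.xm₁, heisRep_mk, heis_smul_mk, heis_mk_add_mk]
  · simp only [gen, ← map_smul, ← map_add]
    congr 1
    refine Prod.ext (by simp) ?_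
    simp [Heis.x₁, Heis.xm₁, heisRep_mk, heis_smul_mk, heis_mk_add_mk]
  · simp only [gen]
    congr 1
    exact Prod.ext (map_zero _) (congrArg (Heis.mk · 1) (map_zero (canonicalRep K g)))

lemma word_self (i : Fin 6) (l : List (Fin 6)) : word K (i :: i :: l) = 0 := by
  rw [word_cons, word_cons, ← mul_assoc, ExteriorAlgebra.ι_sq_zero, zero_mul]

lemma word_swap (i j : Fin 6) (l : List (Fin 6)) :
    word K (i :: j :: l) = - word K (j :: i :: l) := by
  simp only [word_cons, ← mul_assoc]
  rw [eq_neg_of_add_eq_zero_left (ExteriorAlgebra.ι_add_mul_swap (R := K) (gen K i) (gen K j)),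
    neg_mul]

lemma cochainRep_word_cons (g : SL2) (i : Fin 6) (l : List (Fin 6)) :
    cochainRep (heisRep K) g (word K (i :: l)) =
      cochainRep (heisRep K) g (ExteriorAlgebra.ι K (gen K i))
        * cochainRep (heisRep K) g (word K l) := by
  rw [word_cons, cochainRep_mul]

lemma word_nil : word K [] = 1 := rfl

lemma cochainRep_one (g : SL2) : cochainRep (heisRep K) g 1 = 1 :=
  map_one (ExteriorAlgebra.map (((heisRep K).dual.prod (heisRep K)) g))

/-- On the top exterior power of the span of `x⁻¹, x¹` a matrix acts by a power of its determinant,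
which is 1. Treating the two letters together removes the determinant from the later calculations.
-/
lemma cochainRep_word_zero_one (g : SL2) (l : List (Fin 6)) :
    cochainRep (heisRep K) g (word K (0 :: 1 :: l))
      = word K [0, 1] * cochainRep (heisRep K) g (word K l) := by
  rw [cochainRep_word_cons, cochainRep_word_cons, ← mul_assoc, cochainRep_gen, cochainRep_gen]
  congr 1
  have h0 := word_self (K := K) 0 []
  have h1 := word_self (K := K) 1 []
  have h2 := word_swap (K := K) 1 0 []
  simp only [word_cons, word_nil, mul_one] at h0 h1 h2 ⊢
  simp only [Matrix.cons_val_zero, Matrix.cons_val_one, mul_add, sub_mul, smul_mul_assoc,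
    mul_smul_comm, h0, h1, h2]
  linear_combination (norm := module)
    (det_SL2 g) • (ExteriorAlgebra.ι K (gen K 0) * ExteriorAlgebra.ι K (gen K 1))

lemma cochainRep_word_three_four (g : SL2) (l : List (Fin 6)) :
    cochainRep (heisRep K) g (word K (3 :: 4 :: l))
      = word K [3, 4] * cochainRep (heisRep K) g (word K l) := by
  rw [cochainRep_word_cons, cochainRep_word_cons, ← mul_assoc, cochainRep_gen, cochainRep_gen]
  congr 1
  have h0 := word_self (K := K) 3 []
  have h1 := word_self (K := K) 4 []
  have h2 := word_swap (K := K) 4 3 []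
  simp only [word_cons, word_nil, mul_one] at h0 h1 h2 ⊢
  simp only [Matrix.cons_val, mul_add, add_mul, smul_mul_assoc,
    mul_smul_comm, h0, h1, h2]
  linear_combination (norm := module)
    (det_SL2 g) • (ExteriorAlgebra.ι K (gen K 3) * ExteriorAlgebra.ι K (gen K 4))

/-- `repMap` is equivariant if the images of the coordinate vectors transform correctly. -/
lemma cochainRep_repMap_of (g : SL2) : ∀ (i : Fin 3) (E : Fin 3 → Cochain K (Heis K)),
    (i = 0 → cochainRep (heisRep K) g (E 0) = E 0) →
    (i = 1 → cochainRep (heisRep K) g (E 0) = g.1 0 0 • E 0 + g.1 1 0 • E 1) →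
    (i = 1 → cochainRep (heisRep K) g (E 1) = g.1 0 1 • E 0 + g.1 1 1 • E 1) →
    -- The coefficients in these three hypotheses are the coordinates of the conjugates by `g` of
    -- `matH`, `matE` and `matF`, see `adjointRep_entries`.
    (i = 2 → cochainRep (heisRep K) g (E 0) = (g.1 0 0 * g.1 1 1 + g.1 0 1 * g.1 1 0) • E 0
      - (2 * g.1 0 0 * g.1 0 1) • E 1 + (2 * g.1 1 0 * g.1 1 1) • E 2) →
    (i = 2 → cochainRep (heisRep K) g (E 1) = -(g.1 0 0 * g.1 1 0) • E 0
      + (g.1 0 0 ^ 2) • E 1 - (g.1 1 0 ^ 2) • E 2) →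
    (i = 2 → cochainRep (heisRep K) g (E 2) = (g.1 0 1 * g.1 1 1) • E 0
      - (g.1 0 1 ^ 2) • E 1 + (g.1 1 1 ^ 2) • E 2) →
    ∀ x : IrrSpace K i, cochainRep (heisRep K) g (∑ k, coords K i x k • E k)
      = ∑ k, coords K i (irrRep K i g x) k • E k
  | 0, E, h, _, _, _, _, _, x => by
    change cochainRep (heisRep K) g (∑ k, coords K 0 x k • E k) = ∑ k, coords K 0 x k • E k
    simp only [Fin.sum_univ_three, coords_eq_zero 0 x 1 (by decide),
      coords_eq_zero 0 x 2 (by decide), zero_smul, add_zero, map_smul, h rfl]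
  | 1, E, _, h0, h1, _, _, _, x => by
    have h : coords K 1 (irrRep K 1 g x) = ![g.1 0 0 * x 0 + g.1 0 1 * x 1,
        g.1 1 0 * x 0 + g.1 1 1 * x 1, 0] :=
      (congrArg (coords K 1) (canonicalRep_apply g x)).trans (coords_one_apply _)
    have h' : coords K 1 x = ![x 0, x 1, 0] := coords_one_apply x
    rw [h, h']
    simp only [Fin.sum_univ_three, Matrix.cons_val, map_add, map_smul, h0 rfl, h1 rfl]
    module
  | 2, E, _, _, _, h0, h1, h2, x => by
    revert x
    intro (A : Sl2 K)
    have h : coords K 2 (irrRep K 2 g A) = ![(adjointRep K g A).1 0 0, (adjointRep K g A).1 0 1,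
        (adjointRep K g A).1 1 0] := coords_two_apply _
    have h' : coords K 2 A = ![A.1 0 0, A.1 0 1, A.1 1 0] := coords_two_apply _
    rw [h, h', adjointRep_entries]
    simp only [Fin.sum_univ_three, Matrix.cons_val, Matrix.of_apply, map_add, map_smul, h0 rfl,
      h1 rfl, h2 rfl]
    module

/-- The cocycles are chosen so that equivariance holds before passing to cohomology; no coboundary
has to be corrected. -/
lemma cochainRep_repMap [CharZero K] (g : SL2) (r : Component) (x : IrrSpace K (hw r)) :
    cochainRep (heisRep K) g (repMap K r x) = repMap K r (irrRep K (hw r) g x) := by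
  rw [repMap_apply, repMap_apply]
  apply cochainRep_repMap_of
  all_goals intro hi
  all_goals cases r
  all_goals first | (exfalso; revert hi; decide) | skip
  all_goals
    simp only [cocycle, eval_cons, eval_nil, Matrix.cons_val, map_add, map_smul, add_zero,
      cochainRep_word_zero_one]
    -- Only covectors are split off at this point, so that a following `x₁ x₋₁` stays together for
    -- `cochainRep_word_three_four`.
    try simp only [cochainRep_word_cons g 0, cochainRep_word_cons g 1, cochainRep_word_cons g 2]
    try simp only [cochainRep_word_three_four]
    try simp only [cochainRep_word_cons, word_nil, cochainRep_one, cochainRep_gen, mul_one,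
      Rat.cast_one, one_smul, Rat.cast_neg]
    try simp only [word_cons, word_nil, mul_one, mul_add, add_mul, sub_mul, smul_mul_assoc,
      mul_smul_comm, mul_assoc, Matrix.cons_val]
  -- The invariance of `x⁻¹ x₁ + x¹ x₋₁` still needs `det g = 1`. The remaining cases are polynomial
  -- identities in the entries of `g`.
  case a.H11_0 =>
    linear_combination (norm := module) (det_SL2 g) •
      (ExteriorAlgebra.ι K (gen K 0) * ExteriorAlgebra.ι K (gen K 3)
        + ExteriorAlgebra.ι K (gen K 1) * ExteriorAlgebra.ι K (gen K 4))
  all_goals module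

end equivariance

/-! ### Passage to the even cohomology. -/

section table

variable {K : Type u} [Field K]

local notation "SL2" => Matrix.SpecialLinearGroup (Fin 2) K

lemma mkQ_mem_evenCoh {p q : ℕ} (h : Even (p + q)) (x : cocycles K (Heis K))
    (hx : x.1 ∈ bideg K (Heis K) p q) : (coboundaries K (Heis K)).mkQ x ∈ evenCoh K (Heis K) :=
  le_iSup_of_le (f := fun p => ⨆ (q : ℕ) (_ : Even (p + q)), cohBideg K (Heis K) p q) p
    (le_iSup_of_le q (le_iSup_of_le h le_rfl)) ⟨x, hx, rfl⟩

/-- Cochains of even total degree are fixed by the parity involution, and the fixed cocycles form a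
subspace. Its image contains all `H^{p,q}` with `p + q` even, hence their sum; this is the form in
which `even_decomposition` applies. -/
lemma exists_even_cocycle (y : HE K) : ∃ x : cocycles K (Heis K),
    parity x.1 = x.1 ∧ (coboundaries K (Heis K)).mkQ x = y.1 := by
  have h : evenCoh K (Heis K) ≤ ((LinearMap.ker (parity.toLinearMap - LinearMap.id)).comap
      (cocycles K (Heis K)).subtype).map (coboundaries K (Heis K)).mkQ := by
    refine iSup_le fun p => iSup_le fun q => iSup_le fun hpq => ?_
    refine Submodule.map_mono (Submodule.comap_mono fun x hx => ?_)
    rw [LinearMap.mem_ker, LinearMap.sub_apply, sub_eq_zero]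
    exact ((ev_od_bideg hx).1 hpq).1
  obtain ⟨x, hx, hy⟩ := h y.2
  exact ⟨x, sub_eq_zero.1 hx, hy⟩

/-- The bracket of cochains does not depend on the basis, so it is preserved by every linear action
on `𝔥` (`poisson_cochainRep`). The claim for classes follows on representatives. -/
lemma repHE_evenBracket (g : SL2) (x y : HE K) :
    repHE K g (evenBracket x y) = evenBracket (repHE K g x) (repHE K g y) := by
  obtain ⟨x, hx⟩ := x
  obtain ⟨y, hy⟩ := y
  obtain ⟨x, rfl⟩ := (coboundaries K (Heis K)).mkQ_surjective x
  obtain ⟨y, rfl⟩ := (coboundaries K (Heis K)).mkQ_surjective y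
  refine Subtype.ext (congrArg (coboundaries K (Heis K)).mkQ (Subtype.ext ?_))
  exact (poisson_cochainRep (heisRep K) g x.1 y.1).symm

lemma hwCochain_eq (r : Component) : hwCochain K r = repMap K r (highVec (hw r)) := by
  rw [repMap_apply]
  simp only [coords_highVec]
  cases r <;> simp [hwCochain, tens, Fin.sum_univ_three, hw, highCoords, cocycle, word, gen,
    mul_assoc, add_assoc]
  -- Only `H11_0` is left, where the first two summands come in opposite order.
  exact add_left_comm _ _ _

variable [CharZero K]

/-- Links the table over `K` to the one over `ℚ`, in which `pair_poisson` is decided. -/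
lemma poissonTable_eq_cast (r₁ r₂ s : Component) :
    poissonTable K r₁ r₂ s = (poissonTable ℚ r₁ r₂ s : K) := by
  cases s <;> cases r₁ <;> cases r₂ <;> first | exact Rat.cast_zero.symm | norm_num [poissonTable]

variable (K) in
/-- The coordinates of a cohomology class in the component `r`. -/
def coordHE (r : Component) : HE K →ₗ[K] IrrSpace K (hw r) :=
  (coboundaries K (Heis K)).liftQ (coordMap K r ∘ₗ (cocycles K (Heis K)).subtype) (by
    rintro x ⟨y, hy⟩
    rw [LinearMap.mem_ker, LinearMap.comp_apply, ← hy, coordMap_diffCE]) ∘ₗ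
    (evenCoh K (Heis K)).subtype

variable (K) in
/-- The `SL(2, K)`-morphism from `V_{hw r}` onto the component `r`. -/
def componentMap (r : Component) : (irrRep K (hw r)).IntertwiningMap (repHE K) where
  toLinearMap := LinearMap.codRestrict (evenCoh K (Heis K))
    ((coboundaries K (Heis K)).mkQ ∘ₗ LinearMap.codRestrict (cocycles K (Heis K)) (repMap K r)
      (diffCE_repMap r))
    fun x => mkQ_mem_evenCoh (even_degree r) _ (repMap_mem_bideg r x)
  isIntertwining' g := by
    refine LinearMap.ext fun x => Subtype.ext ?_
    refine congrArg (coboundaries K (Heis K)).mkQ (Subtype.ext ?_)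
    exact (cochainRep_repMap g r x).symm

/-- A class has the coordinates of any cocycle that represents it, here of `repMap K r x`. This left
inverse yields the injectivity of the morphisms. -/
lemma coordHE_componentMap (r : Component) (x : IrrSpace K (hw r)) :
    coordHE K r (componentMap K r x) = x := coordMap_repMap r x

lemma coordHE_componentMap_of_ne {r s : Component} (h : r ≠ s) (x : IrrSpace K (hw r)) :
    coordHE K s (componentMap K r x) = 0 := coordMap_repMap_of_ne h x

/-- Every even class is the sum of its components. -/
lemma sum_componentMap (y : HE K) : ∑ r, componentMap K r (coordHE K r y) = y := by
  obtain ⟨x, hx, hy⟩ := exists_even_cocycle y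
  have hc : ∀ r, coordHE K r y = coordMap K r x.1 := by
    intro r
    rw [coordHE, LinearMap.comp_apply, Submodule.subtype_apply, ← hy]
    rfl
  refine Subtype.ext ?_
  rw [← hy, AddSubmonoidClass.coe_finsetSum]
  have h1 : ∀ r, ((componentMap K r (coordHE K r y) : HE K) : Cohomology K (Heis K))
      = (coboundaries K (Heis K)).mkQ ⟨repMap K r (coordMap K r x.1), diffCE_repMap r _⟩ := by
    intro r
    rw [hc]
    rfl
  simp only [h1]
  rw [← map_sum, eq_comm, ← sub_eq_zero, ← map_sub, Submodule.mkQ_apply,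
    Submodule.Quotient.mk_eq_zero]
  -- The homotopy gives the primitive of the difference: the term `h' d x` drops out because `x` is
  -- a cocycle.
  refine ⟨rankOne K homotopyEven x.1, ?_⟩
  have h2 := even_decomposition hx
  rw [mem_cocycles.1 x.2, map_zero, add_zero] at h2
  simp only [Submodule.subtype_apply, AddSubgroupClass.coe_sub, AddSubmonoidClass.coe_finsetSum]
  exact (sub_eq_of_eq_add' h2).symm

lemma sendsHighestWeight_componentMap : SendsHighestWeight K (componentMap K) := fun r =>
  ⟨by rw [hwCochain_eq]; exact diffCE_repMap r _,
    congrArg (coboundaries K (Heis K)).mkQ (Subtype.ext (hwCochain_eq r).symm)⟩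

/-- The kernel of the difference of two such morphisms contains the translates of the highest weight
vector by lower unipotent matrices, and these span (`span_lower`). -/
lemma eq_componentMap {τ : ∀ r, (irrRep K (hw r)).IntertwiningMap (repHE K)}
    (h : SendsHighestWeight K τ) : τ = componentMap K := by
  funext r
  refine Representation.IntertwiningMap.ext (sub_eq_zero.1 (LinearMap.ker_eq_top.1 ?_))
  refine span_lower (hw r) _ fun t => ?_
  rw [LinearMap.mem_ker, LinearMap.sub_apply, sub_eq_zero]
  have h1 : τ r (highVec (hw r)) = componentMap K r (highVec (hw r)) := by
    obtain ⟨_, h2⟩ := h r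
    obtain ⟨_, h3⟩ := sendsHighestWeight_componentMap (K := K) r
    exact Subtype.ext (h2.trans h3.symm)
  change τ r _ = componentMap K r _
  rw [(τ r).isIntertwining, (componentMap K r).isIntertwining, h1]

/-! ### Equivariant bilinear maps and the entries of the table. -/

/-- An equivariant bilinear map on `V_i × V_j` is determined by its value at a highest and a
lowest weight vector. -/
lemma equivariant_eq_zero {i j : Fin 3} {W : Type*} [AddCommGroup W] [Module K W]
    (ρ : Representation K SL2 W) (B : IrrSpace K i →ₗ[K] IrrSpace K j →ₗ[K] W)
    (hB : ∀ g x y, B (irrRep K i g x) (irrRep K j g y) = ρ g (B x y))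
    (h : B (highVec i) (lowVec j) = 0) : B = 0 := by
  -- For a lower unipotent `g`, which fixes the lowest weight vector `v`, equivariance gives `B(g u,
  -- v) = B(g u, g v) = g B(u, v) = 0` with `u` the highest weight vector. The vectors `g u` span
  -- `V_i`.
  have h1 : B.flip (lowVec j) = 0 := by
    refine LinearMap.ker_eq_top.1 (span_lower i _ fun t => ?_)
    rw [LinearMap.mem_ker, LinearMap.flip_apply, ← lower_lowVec j t, hB, h, map_zero]
  -- The right kernel of `B` is a subrepresentation of the irreducible `V_j` and contains the
  -- nonzero lowest weight vector, so it is all of `V_j`.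
  let S : Subrepresentation (irrRep K j) :=
    { toSubmodule := LinearMap.ker B.flip
      apply_mem_toSubmodule := fun g y hy => by
        refine LinearMap.ext fun x => ?_
        have hx : x = irrRep K i g (irrRep K i g⁻¹ x) := by simp
        rw [LinearMap.flip_apply, hx, hB, ← LinearMap.flip_apply, LinearMap.mem_ker.1 hy,
          LinearMap.zero_apply, map_zero, LinearMap.zero_apply] }
  have := irrRep_irreducible (K := K) j
  have hS : S = ⊤ := by
    rcases eq_bot_or_eq_top S with hS | hS
    · exfalso
      have hm : lowVec j ∈ S.toSubmodule := h1
      rw [hS] at hm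
      exact lowVec_ne j hm
    · exact hS
  refine LinearMap.ext fun x => LinearMap.ext fun y => ?_
  have hy : y ∈ S.toSubmodule := by rw [hS]; exact Submodule.mem_top
  exact LinearMap.congr_fun (LinearMap.mem_ker.1 hy) x

lemma equivariant_ext {i j : Fin 3} {W : Type*} [AddCommGroup W] [Module K W]
    (ρ : Representation K SL2 W) {B₁ B₂ : IrrSpace K i →ₗ[K] IrrSpace K j →ₗ[K] W}
    (h₁ : ∀ g x y, B₁ (irrRep K i g x) (irrRep K j g y) = ρ g (B₁ x y))
    (h₂ : ∀ g x y, B₂ (irrRep K i g x) (irrRep K j g y) = ρ g (B₂ x y))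
    (h : B₁ (highVec i) (lowVec j) = B₂ (highVec i) (lowVec j)) : B₁ = B₂ := by
  refine sub_eq_zero.1 (equivariant_eq_zero ρ (B₁ - B₂) (fun g x y => ?_) ?_)
  · simp only [LinearMap.sub_apply, h₁, h₂, map_sub]
  · simp only [LinearMap.sub_apply, h, sub_self]

lemma eval_combine (r : Component) (c : Fin 3 → ℚ) :
    eval K (combine r c) = ∑ k, (c k : K) • eval K (cocycle r k) := by
  rw [combine, eval_flatMap, ← List.ofFn_eq_map, List.sum_ofFn]
  simp only [eval_smul]

/-- The components of the bracket of a highest and a lowest weight vector. -/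
lemma coordHE_evenBracket (r₁ r₂ s : Component) :
    coordHE K s (evenBracket (componentMap K r₁ (highVec (hw r₁)))
      (componentMap K r₂ (lowVec (hw r₂))))
      = poissonTable K r₁ r₂ s • bilin (hw r₁) (hw r₂) (hw s) (highVec (hw r₁))
        (lowVec (hw r₂)) := by
  change coordMap K s (poisson (repMap K r₁ (highVec (hw r₁))) (repMap K r₂ (lowVec (hw r₂)))) = _
  have h1 : repMap K r₁ (highVec (hw r₁)) = eval K (combine r₁ (highCoords (hw r₁))) := by
    rw [repMap_apply, eval_combine]
    simp only [coords_highVec]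
  have h2 : repMap K r₂ (lowVec (hw r₂)) = eval K (combine r₂ (lowCoords (hw r₂))) := by
    rw [repMap_apply, eval_combine]
    simp only [coords_lowVec]
  rw [h1, h2, ← eval_poisson, coordMap, LinearMap.comp_apply]
  conv_rhs => rw [← ofCoords_coords (hw s) (bilin _ _ _ _ _), ← map_smul]
  congr 1
  ext k
  rw [LinearMap.pi_apply, pairForm_eval, pair_poisson, Pi.smul_apply, coords_bilin, Rat.cast_mul,
    ← poissonTable_eq_cast, smul_eq_mul]

/-- Both sides are equivariant in `(x, y)`, so it suffices to compare them at a highest and a lowest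
weight vector, one component at a time. -/
lemma evenBracket_componentMap (r₁ r₂ : Component) (x : IrrSpace K (hw r₁))
    (y : IrrSpace K (hw r₂)) : evenBracket (componentMap K r₁ x) (componentMap K r₂ y)
      = ∑ s, poissonTable K r₁ r₂ s • componentMap K s (bilin (hw r₁) (hw r₂) (hw s) x y) := by
  let B₁ : IrrSpace K (hw r₁) →ₗ[K] IrrSpace K (hw r₂) →ₗ[K] HE K :=
    evenBracket.compl₁₂ (componentMap K r₁).toLinearMap (componentMap K r₂).toLinearMap
  let B₂ : IrrSpace K (hw r₁) →ₗ[K] IrrSpace K (hw r₂) →ₗ[K] HE K :=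
    ∑ s, poissonTable K r₁ r₂ s • (bilin (hw r₁) (hw r₂) (hw s)).compr₂
          (componentMap K s).toLinearMap
  have h₁ : ∀ x y, B₁ x y = evenBracket (componentMap K r₁ x) (componentMap K r₂ y) :=
    fun _ _ => rfl
  have h₂ : ∀ x y, B₂ x y
      = ∑ s, poissonTable K r₁ r₂ s • componentMap K s (bilin (hw r₁) (hw r₂) (hw s) x y) := by
    intro x y
    simp only [B₂, LinearMap.sum_apply, LinearMap.smul_apply]
    rfl
  have hB : B₁ = B₂ := by
    refine equivariant_ext (repHE K) (fun g x y => ?_) (fun g x y => ?_) ?_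
    · rw [h₁, h₁, repHE_evenBracket, (componentMap K r₁).isIntertwining,
        (componentMap K r₂).isIntertwining]
    · rw [h₂, h₂, map_sum]
      simp only [bilin_equivariant, map_smul, Representation.IntertwiningMap.isIntertwining]
    · rw [h₁, h₂, ← sum_componentMap (evenBracket _ _)]
      refine Finset.sum_congr rfl fun s _ => ?_
      rw [coordHE_evenBracket, map_smul]
  rw [← h₁, hB, h₂]

/-- The coordinate map of one component kills all the others and is injective on its own, whence
independence. The components generate by `sum_componentMap`. -/
lemma isInternal_componentMap :
    DirectSum.IsInternal fun r => LinearMap.range (componentMap K r).toLinearMap := by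
  rw [DirectSum.isInternal_submodule_iff_iSupIndep_and_iSup_eq_top]
  constructor
  · rw [iSupIndep_def]
    intro r
    rw [Submodule.disjoint_def]
    rintro _ ⟨x, rfl⟩ hx
    have h : (⨆ s, ⨆ (_ : s ≠ r), LinearMap.range (componentMap K s).toLinearMap)
        ≤ LinearMap.ker (coordHE K r) := by
      refine iSup_le fun s => iSup_le fun hs => ?_
      rintro _ ⟨y, rfl⟩
      exact coordHE_componentMap_of_ne hs y
    have h2 : coordHE K r (componentMap K r x) = 0 := h hx
    rw [coordHE_componentMap] at h2
    rw [h2, map_zero]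
  · rw [eq_top_iff]
    rintro y -
    rw [← sum_componentMap y]
    exact sum_mem fun r _ => Submodule.mem_iSup_of_mem r ⟨_, rfl⟩

/-- Matches the sum over a basis of the morphisms `V_i ⊗ V_j → V_k` with the single map `bilin`. The
multiplicity is 0 or 1, and if it is 0, then `bilin` vanishes as well. -/
lemma sum_labeling {M : Type*} [AddCommGroup M] [Module K M] {i j k : Fin 3}
    (f : IrrSpace K k →ₗ[K] M) (c : K) (x : IrrSpace K i) (y : IrrSpace K j) :
    ∑ q, c • f ((sl2Labeling K).m i j k q (x ⊗ₜ[K] y)) = c • f (bilin i j k x y) := by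
  change ∑ q : Fin (mult i j k), c • f (morph i j k (x ⊗ₜ[K] y)) = _
  rw [Finset.sum_const, Finset.card_univ, Fintype.card_fin, ← morph_tmul]
  rcases mult_cases (K := K) i j k with ⟨h, h'⟩ | ⟨h, _⟩
  · rw [h, h', zero_smul]
    change 0 = c • f 0
    rw [map_zero, smul_zero]
  · rw [h, one_smul]

end table

end LiePoisson

end

theorem mainTheorem4 (K : Type*) [Field K] [CharZero K] :
    (∃ τ : ∀ r, (LiePoisson.irrRep K (LiePoisson.hw r)).IntertwiningMap (LiePoisson.repHE K),
      LiePoisson.SendsHighestWeight K τ) ∧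
    ∀ τ : ∀ r, (LiePoisson.irrRep K (LiePoisson.hw r)).IntertwiningMap (LiePoisson.repHE K),
      LiePoisson.SendsHighestWeight K τ →
        LiePoisson.IsGTable (LiePoisson.sl2Labeling K) LiePoisson.evenBracket (LiePoisson.repHE K)
          LiePoisson.hw τ (fun r₁ r₂ s _ => LiePoisson.poissonTable K r₁ r₂ s) := by
  refine ⟨⟨_, LiePoisson.sendsHighestWeight_componentMap⟩, fun τ hτ => ?_⟩
  -- By uniqueness, an arbitrary choice of the morphisms is the one that was constructed.
  obtain rfl := LiePoisson.eq_componentMap hτ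
  exact
    { map_mul := LiePoisson.repHE_evenBracket
      injective := fun r => Function.LeftInverse.injective (LiePoisson.coordHE_componentMap r)
      isInternal := LiePoisson.isInternal_componentMap
      mul_eq := fun r₁ r₂ x y => (LiePoisson.evenBracket_componentMap r₁ r₂ x y).trans
        (Finset.sum_congr rfl fun s _ => (LiePoisson.sum_labeling
          (LiePoisson.componentMap K s).toLinearMap _ x y).symm) }
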